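/- Let $M$ be a smooth finite-dimensional manifold (Hausdorff, $\sigma$-compact) and let $(\tau:E\to M,\rho,[\cdot,\cdot])$ be a Lie algebroid: a smooth vector bundle of finite rank with a smooth anchor $\rho:E\to TM$ over $\mathrm{id}_M$ and a real Lie bracket on sections with $[\sigma,f\eta]=(\rho(\sigma)f)\eta+f[\sigma,\eta]$. A curve $a$ in $E$ with base curve $\gamma=\tau\circ a$ is admissible if $\dot\gamma=\rho\circ a$. For $j\ge 1$ let $E^j$ be the manifold of $(j-1)$-jets $[a]^{j-1}$ at $0$ of admissible curves, let $E^0=M$, and let $\tau_{j,l}:E^j\to E^l$ be the projections; put $a^j(t)=[s\mapsto a(t+s)]^{j-1}$. A local basis $(e_\alpha)$ of sections of $E$ with $[e_\alpha,e_\beta]=C^\gamma_{\alpha\beta}e_\gamma$ gives fibre coordinates $y^\alpha_r=\frac{d^{r-1}a^\alpha}{dt^{r-1}}(0)$, $1\le r\le j$, on $E^j$ over $M$. Let $\mathcal T^EE^j\to E^j$ be the Lie algebroid with fibre $\{(b,v)\in E_x\times T_AE^j:\rho(b)=T\tau_{j,0}(v)\}$ at $A\in E^j$, $x=\tau_{j,0}(A)$,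 with anchor $(b,v)\mapsto v$, local basis $\mathcal X_\alpha=(e_\alpha,\rho^i_\alpha\partial_{x^i})$, $\mathcal V^r_\alpha=(0,\partial_{y^\alpha_r})$, whose only non-zero brackets are $[\mathcal X_\alpha,\mathcal X_\beta]=C^\gamma_{\alpha\beta}\mathcal X_\gamma$, and with exterior differential $d$. Let $\mathsf T$ be the section of $\mathcal T^EE^j$ along $\tau_{j+1,j}$ given by $\mathsf T(a^{j+1}(0))=\bigl(a(0),\tfrac{d}{dt}a^j(t)|_{t=0}\bigr)$, and let $d_{\mathsf T}=d\circ i_{\mathsf T}+i_{\mathsf T}\circ d$ be the total time derivative, which maps functions and $1$-forms on $E^j$ to functions and $1$-forms on $E^{j+1}$. The vertical endomorphism $S$ is the tensorial endomorphism of $(\mathcal T^EE^j)^*$ with $S(d_{\mathsf T}^r\theta)=r\,d_{\mathsf T}^{r-1}\theta$ for all sections $\theta$ of $E^*$ and $0\le r\le j$ (pullbacks to $E^j$ omitted). For a section $\eta=\eta^\alpha e_\alpha$ of $E$, its $j$-th order complete lift is the section $$\eta^j=\eta^\alpha\mathcal X_\alpha+\sum_{r=1}^j d_{\mathsf T}^{\,r-1}\bigl[d_{\mathsf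 T}\eta^\alpha+C^\alpha_{\beta\gamma}y_1^\beta\eta^\gamma\bigr]\mathcal V^r_\alpha$$ of $\mathcal T^EE^j$; its vector field part generates the flow on $E^j$ obtained by jet prolongation from the flow of $\eta$ on $E$. For a function $L$ write $d_{\eta^j}L=\langle dL,\eta^j\rangle$. Let $k\ge 1$ and $L\in C^\infty(E^k)$. Let $$\theta_L=\mathbb S(dL)=\sum_{j=1}^k\frac{(-1)^{j-1}}{j!}d_{\mathsf T}^{\,j-1}(S^j dL),\qquad \mathbb E(dL)=\sum_{j=0}^k\frac{(-1)^{j}}{j!}d_{\mathsf T}^{\,j}(S^j dL)$$ (forms on $E^{2k-1}$ and $E^{2k}$). The form $\mathbb E(dL)$ is $\tau_{2k,0}$-semibasic; let $\delta L:E^{2k}\to E^*$ be the associated map, $\langle\mathbb E(dL),(b,v)\rangle=\langle\delta L,b\rangle$. A solution of the Euler–Lagrange equations on an interval $J$ is an admissible curve $a$ of class $C^{2k-1}$, defined near $J$, with $\delta L(a^{2k}(t))=0$ for all $t\in J$. **Theorem (Noether).** Let $\eta$ be a smooth section of $E$ such that $d_{\eta^k}L=d_{\mathsf T}F$ for some $F\in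 C^\infty(E^{k-1})$ (pullbacks omitted). Then the function $G=F-\langle\theta_L,\eta^{2k-1}\rangle$ on $E^{2k-1}$ is smooth and is a first integral of the Euler–Lagrange equations: for every solution $a$ on an interval $J$, the function $t\mapsto G(a^{2k-1}(t))$ is constant on $J$. -/

import Mathlib

open Set Filter Topology Bundle
open scoped Manifold ContDiff

noncomputable section

/-- The derivative `v f` of a function `f` on a manifold along a tangent vector `v` at `x`. -/
def dirDeriv {B M : Type*} [NormedAddCommGroup B] [NormedSpace ℝ B] [TopologicalSpace M]
    [ChartedSpace B M] (f : M → ℝ) (x : M) (v : TangentSpace 𝓘(ℝ, B) x) : ℝ :=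
  mfderiv 𝓘(ℝ, B) 𝓘(ℝ, ℝ) f x v

/-- A Lie algebroid structure on a smooth vector bundle `E → M` with typical fibre `F`: a smooth
vector bundle map `anchor : E → TM` over the identity, and a real Lie algebra structure on the space
of smooth sections of `E` which satisfies the Leibniz rule
`[s, f u] = f [s, u] + (ρ(s) f) u`. -/
structure LieAlgebroid (B F : Type*) [NormedAddCommGroup B] [NormedSpace ℝ B]
    [NormedAddCommGroup F] [NormedSpace ℝ F]
    {M : Type*} [TopologicalSpace M] [ChartedSpace B M] [IsManifold 𝓘(ℝ, B) ∞ M]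
    (E : M → Type*) [TopologicalSpace (TotalSpace F E)] [∀ x, TopologicalSpace (E x)]
    [∀ x, AddCommGroup (E x)] [∀ x, Module ℝ (E x)] [FiberBundle F E] [VectorBundle ℝ F E]
    [ContMDiffVectorBundle ∞ F E 𝓘(ℝ, B)] where
  anchor : ∀ x : M, E x →L[ℝ] TangentSpace 𝓘(ℝ, B) x
  contMDiff_anchor : ContMDiff (𝓘(ℝ, B).prod 𝓘(ℝ, F)) (𝓘(ℝ, B).prod 𝓘(ℝ, B)) ∞
    (fun v : TotalSpace F E => (⟨v.1, anchor v.1 v.2⟩ : TangentBundle 𝓘(ℝ, B) M))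
  bracket : Cₛ^∞⟮𝓘(ℝ, B); F, E⟯ →ₗ[ℝ] Cₛ^∞⟮𝓘(ℝ, B); F, E⟯ →ₗ[ℝ] Cₛ^∞⟮𝓘(ℝ, B); F, E⟯
  bracket_self : ∀ s, bracket s s = 0
  jacobi : ∀ s t u, bracket s (bracket t u) + bracket t (bracket u s) + bracket u (bracket s t) = 0
  leibniz : ∀ (f : M → ℝ), ContMDiff 𝓘(ℝ, B) 𝓘(ℝ, ℝ) ∞ f →
    ∀ s u fu : Cₛ^∞⟮𝓘(ℝ, B); F, E⟯, (∀ x, fu x = f x • u x) →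
      ∀ x, bracket s fu x = f x • bracket s u x
        + dirDeriv f x (anchor x (s x)) • u x

namespace LieAlgebroid

variable {B F : Type*} [NormedAddCommGroup B] [NormedSpace ℝ B]
  [NormedAddCommGroup F] [NormedSpace ℝ F]
  {M : Type*} [TopologicalSpace M] [ChartedSpace B M] [IsManifold 𝓘(ℝ, B) ∞ M]
  {E : M → Type*} [TopologicalSpace (TotalSpace F E)] [∀ x, TopologicalSpace (E x)]
  [∀ x, AddCommGroup (E x)] [∀ x, Module ℝ (E x)] [FiberBundle F E] [VectorBundle ℝ F E]
  [ContMDiffVectorBundle ∞ F E 𝓘(ℝ, B)]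
  (𝔄 : LieAlgebroid B F E)

/-! ### Admissible curves and their jets -/

/-- Near the time `t`, the curve `a` in `E` is of class `C^n` and admissible: the velocity of the
base curve `γ = τ ∘ a` is `ρ ∘ a`. -/
def AdmissibleAt (n : ℕ) (a : ℝ → TotalSpace F E) (t : ℝ) : Prop :=
  ContMDiffAt 𝓘(ℝ, ℝ) (𝓘(ℝ, B).prod 𝓘(ℝ, F)) n a t ∧
  ∀ᶠ s in 𝓝 t, HasMFDerivAt 𝓘(ℝ, ℝ) 𝓘(ℝ, B) (fun r => (a r).proj) s
    ((1 : ℝ →L[ℝ] ℝ).smulRight (𝔄.anchor (a s).proj (a s).2))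

variable {𝔄} in
theorem AdmissibleAt.of_le {m n : ℕ} (h : m ≤ n) {a : ℝ → TotalSpace F E} {t : ℝ}
    (ha : 𝔄.AdmissibleAt n a t) : 𝔄.AdmissibleAt m a t :=
  ⟨ha.1.of_le (by exact_mod_cast h), ha.2⟩

variable {𝔄} in
theorem AdmissibleAt.translate {n : ℕ} {a : ℝ → TotalSpace F E} {t : ℝ}
    (ha : 𝔄.AdmissibleAt n a t) : 𝔄.AdmissibleAt n (fun s => a (t + s)) 0 := by
  have hc : ContDiff ℝ n (fun s : ℝ => t + s) := contDiff_const.add contDiff_id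
  refine ⟨?_, ?_⟩
  · have h1 : ContMDiffAt 𝓘(ℝ, ℝ) (𝓘(ℝ, B).prod 𝓘(ℝ, F)) n a ((fun s : ℝ => t + s) 0) := by
      simpa using ha.1
    exact h1.comp 0 hc.contMDiff.contMDiffAt
  · have h2 : Tendsto (fun s : ℝ => t + s) (𝓝 0) (𝓝 t) := by
      simpa using hc.continuous.tendsto 0
    filter_upwards [h2.eventually ha.2] with s hs
    have h3 : HasFDerivAt (fun s : ℝ => t + s) (1 : ℝ →L[ℝ] ℝ) s :=
      (hasFDerivAt_id s).const_add t
    exact HasMFDerivAt.comp s hs h3.hasMFDerivAt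

/-- Curves defined near `0`, of class `C^(k-1)` and admissible there. -/
def AdmCurve (k : ℕ) : Type _ := {a : ℝ → TotalSpace F E // 𝔄.AdmissibleAt (k - 1) a 0}

/-- The base point `x` of `a 0`, and the derivatives of order `0, …, k - 1` at the time `0` of the
expression of the curve `a` in the chart of the manifold `E` at `a 0`. -/
def jetData (k : ℕ) (a : 𝔄.AdmCurve k) : M × (Fin k → B × F) :=
  ((a.1 0).proj, fun j => iteratedDeriv j
    (fun t => extChartAt (𝓘(ℝ, B).prod 𝓘(ℝ, F)) (a.1 0) (a.1 t)) 0)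

/-- Equality of `(k-1)`-jets at `0` (for `k = 0`: equality of base points). -/
def jetSetoid (k : ℕ) : Setoid (𝔄.AdmCurve k) := Setoid.ker (𝔄.jetData k)

/-- The space `E^k` of `(k-1)`-jets `[a]^(k-1)` of admissible curves; `E^1 = E` and `E^0 = M`. -/
def Jet (k : ℕ) : Type _ := Quotient (𝔄.jetSetoid k)

/-- The jet prolongation `a^k(t) = [s ↦ a (t + s)]^(k-1)` of an admissible curve. -/
def jet (k : ℕ) (a : ℝ → TotalSpace F E) (t : ℝ) (h : 𝔄.AdmissibleAt (k - 1) a t) : 𝔄.Jet k :=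
  Quotient.mk (𝔄.jetSetoid k) ⟨fun s => a (t + s), h.translate⟩

variable {𝔄}

/-- The projection `τ_{k,l} : E^k → E^l`. -/
def proj {k l : ℕ} (h : l ≤ k) : 𝔄.Jet k → 𝔄.Jet l :=
  Quotient.map' (s₁ := 𝔄.jetSetoid k) (s₂ := 𝔄.jetSetoid l)
    (fun a => ⟨a.1, a.2.of_le (Nat.sub_le_sub_right h 1)⟩) (by
      intro a b hab
      have hab' : 𝔄.jetData k a = 𝔄.jetData k b := hab
      refine Prod.ext (congrArg Prod.fst hab' :) (funext fun j => ?_)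
      exact congrFun (congrArg Prod.snd hab') (Fin.castLE h j))

/-- The projection `τ_{k,0} : E^k → M`. -/
def base {k : ℕ} (A : 𝔄.Jet k) : M :=
  Quotient.lift (s := 𝔄.jetSetoid k) (fun a => (a.1 0).proj)
    (fun _ _ hab => congrArg Prod.fst hab) A

/-! ### Coordinates

For `c : M` we write `e_c` for the trivialization `trivializationAt F E c` of `E` around `c`. A
choice of `c` plays the role of the choice of a local basis of sections of `E`; the sets
`e_c.baseSet` cover `M`. -/

/-- The fibre coordinates `(y_1, …, y_k)` of a point of `E^k` over the domain of `e_c`: the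
derivatives of order `0, …, k - 1` of the fibre component of a representing curve. -/
def coord {k : ℕ} (c : M) (A : 𝔄.Jet k) : Fin k → F := fun j =>
  iteratedDeriv j
    (fun t => (trivializationAt F E c ((Quotient.out (s := 𝔄.jetSetoid k) A).1 t)).2) 0

/-- The expression of `Φ : E^k → V` in the coordinates `(x, y_1, …, y_k)` given by `e_c`. It is
meaningful on `e_c.baseSet × F^k`: over the domain of `e_c` the coordinates are a bijection of
`E^k` onto this set, because an admissible curve can be prescribed by its initial base point and
its fibre component. -/
def localRep {k : ℕ} {V : Type*} [Zero V] (c : M) (Φ : 𝔄.Jet k → V) : M × (Fin k → F) → V :=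
  Function.extend
    (fun A : {A : 𝔄.Jet k // base A ∈ (trivializationAt F E c).baseSet} => (base A.1, coord c A.1))
    (fun A => Φ A.1) 0

/-- Smooth functions on `E^k`. -/
def IsSmooth {k : ℕ} (Φ : 𝔄.Jet k → ℝ) : Prop :=
  ∀ c : M, ContMDiffOn (𝓘(ℝ, B).prod 𝓘(ℝ, Fin k → F)) 𝓘(ℝ, ℝ) ∞ (localRep c Φ)
    ((trivializationAt F E c).baseSet ×ˢ univ)

variable (𝔄) in
/-- The anchor in the trivialization `e_c`: the map `f ↦ ρ(e_c⁻¹(x, f))`, i.e. the functions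
`ρ^i_α`. -/
def localAnchor (c x : M) : F →L[ℝ] TangentSpace 𝓘(ℝ, B) x :=
  (𝔄.anchor x).comp ((trivializationAt F E c).symmL ℝ x)

open Classical in
/-- A smooth section of `E` which near `x` is constant, equal to `f`, in the trivialization
`e_c`. -/
def frameSection (B : Type*) [NormedAddCommGroup B] [NormedSpace ℝ B] [ChartedSpace B M]
    (E : M → Type*) [TopologicalSpace (TotalSpace F E)] [∀ x, TopologicalSpace (E x)]
    [∀ x, AddCommGroup (E x)] [∀ x, Module ℝ (E x)] [FiberBundle F E] [VectorBundle ℝ F E]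
    (c x : M) (f : F) : Cₛ^∞⟮𝓘(ℝ, B); F, E⟯ :=
  if h : ∃ s : Cₛ^∞⟮𝓘(ℝ, B); F, E⟯,
      ∀ᶠ x' in 𝓝 x, s x' = (trivializationAt F E c).symm x' f
  then h.choose else 0

variable [FiniteDimensional ℝ F]

variable (𝔄) in
/-- The structure functions of the bracket in the trivialization `e_c`: with `e_α` the local basis
of sections of `E` given by `e_c` and a basis of `F`, the bilinear map
`(f, g) ↦ f^α g^β C^γ_{αβ}(x)`, where `[e_α, e_β] = C^γ_{αβ} e_γ`. -/
def structureMap (c x : M) : F →L[ℝ] F →L[ℝ] F :=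
  let b := Module.finBasis ℝ F
  ∑ α, ∑ β, (LinearMap.toContinuousLinearMap (b.coord α)).smulRight
    ((LinearMap.toContinuousLinearMap (b.coord β)).smulRight
      ((trivializationAt F E c).continuousLinearMapAt ℝ x
        (𝔄.bracket (frameSection B E c x (b α)) (frameSection B E c x (b β)) x)))

/-! ### The `E`-tangent `𝒯^E E^k`

The fibre of `𝒯^E E^k` at `A` consists of the pairs `(b, v)` with `b ∈ E_x`, `x = base A`,
`v ∈ T_A E^k` and `ρ(b) = Tτ_{k,0}(v)`. In the coordinates given by `e_c` these are the vectors
`z^α X_α + ∑_r z_r^α V^r_α` of the local basis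
`X_α = (A, e_α(x), ρ^i_α ∂/∂x^i)`, `V^r_α = (A, 0, ∂/∂y^α_r)`, `r = 1, …, k`, with components
`z = (z_0, z_1, …, z_k) ∈ F^(k+1)`. As for Mathlib's tangent spaces, an element of the fibre at
`A` is represented by its components with respect to the preferred choice `c = base A`. -/

/-- The components `(z_0, …, z_k)` of an element of the fibre of `𝒯^E E^k`. -/
abbrev ETangent (F : Type*) (k : ℕ) : Type _ := Fin (k + 1) → F

/-- For `z` with components `z` with respect to `e_c`, the derivative of `Φ : E^k → V` along the
vector `v = ρ(z)` tangent to `E^k` at `A`, as a function of `z`. -/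
def along {k : ℕ} {V : Type*} [NormedAddCommGroup V] [NormedSpace ℝ V] (c : M)
    (Φ : 𝔄.Jet k → V) (A : 𝔄.Jet k) : ETangent F k →L[ℝ] V :=
  let D : B × (Fin k → F) →L[ℝ] V :=
    mfderiv (𝓘(ℝ, B).prod 𝓘(ℝ, Fin k → F)) 𝓘(ℝ, V) (localRep c Φ) (base A, coord c A)
  let ρ : F →L[ℝ] B := 𝔄.localAnchor c (base A)
  D.comp ((ρ.comp (ContinuousLinearMap.proj 0)).prod
    (ContinuousLinearMap.pi fun r : Fin k => ContinuousLinearMap.proj r.succ))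

/-- The change of components in the fibre of `𝒯^E E^k` at `A`, from `e_c` to `e_c'`. -/
def changeFrame {k : ℕ} (c c' : M) (A : 𝔄.Jet k) : ETangent F k →L[ℝ] ETangent F k :=
  ContinuousLinearMap.pi (Fin.cons
    ((((trivializationAt F E c').continuousLinearMapAt ℝ (base A)).comp
      ((trivializationAt F E c).symmL ℝ (base A))).comp (ContinuousLinearMap.proj 0))
    (fun r : Fin k => (ContinuousLinearMap.proj (φ := fun _ : Fin k => F) r).comp (along c (coord c') A)))

/-- `1`-forms on `𝒯^E E^k`, i.e. sections (not necessarily smooth) of `(𝒯^E E^k)^*`. -/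
abbrev OneForm (𝔄 : LieAlgebroid B F E) (k : ℕ) : Type _ := 𝔄.Jet k → (ETangent F k →L[ℝ] ℝ)

/-- The components of a `1`-form with respect to the local basis given by `e_c`. -/
def OneForm.inFrame {k : ℕ} (c : M) (lam : OneForm 𝔄 k) : 𝔄.Jet k → (ETangent F k →L[ℝ] ℝ) :=
  fun A => (lam A).comp (changeFrame c (base A) A)

/-- The pullback of a `1`-form by `𝒯τ_{k,l} : 𝒯^E E^k → 𝒯^E E^l`. -/
def OneForm.pull {k l : ℕ} (h : l ≤ k) (lam : OneForm 𝔄 l) : OneForm 𝔄 k :=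
  fun A => (lam (proj h A)).comp
    (ContinuousLinearMap.pi fun r : Fin (l + 1) =>
      ContinuousLinearMap.proj (Fin.castLE (Nat.succ_le_succ h) r))

/-- The exterior differential of the Lie algebroid `𝒯^E E^k` on functions, `⟨dΦ, Z⟩ = ρ(Z)Φ`. -/
def dFun {k : ℕ} {V : Type*} [NormedAddCommGroup V] [NormedSpace ℝ V] (Φ : 𝔄.Jet k → V)
    (A : 𝔄.Jet k) : ETangent F k →L[ℝ] V :=
  along (base A) Φ A

/-- The exterior differential of the Lie algebroid `𝒯^E E^k` on `1`-forms,
`dλ(Z, W) = ρ(Z)⟨λ, W⟩ - ρ(W)⟨λ, Z⟩ - ⟨λ, [Z, W]⟩`, at the point `A`. The formula is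
applied to the sections `Z`, `W` with constant components `z`, `w` in the local basis given by
`e_c`, `c = base A`, whose only non-zero brackets are `[X_α, X_β] = C^γ_{αβ} X_γ`. -/
def dForm {k : ℕ} (lam : OneForm 𝔄 k) (A : 𝔄.Jet k) (z : ETangent F k) :
    ETangent F k →L[ℝ] ℝ :=
  let D : ETangent F k →L[ℝ] ETangent F k →L[ℝ] ℝ := along (base A) (lam.inFrame (base A)) A
  D z - D.flip z -
    (lam A).comp ((ContinuousLinearMap.single ℝ (fun _ : Fin (k + 1) => F) 0).comp
      ((𝔄.structureMap (base A) (base A) (z 0)).comp (ContinuousLinearMap.proj 0)))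

/-! ### The total time derivative -/

/-- The canonical section `𝖳 = ∑_{j=0}^k y^α_{j+1} V^j_α` (`V^0_α = X_α`) of `𝒯^E E^k` along
`τ_{k+1,k} : E^(k+1) → E^k`. -/
def canonicalT {k : ℕ} (A : 𝔄.Jet (k + 1)) : ETangent F k := coord (base A) A

/-- The total time derivative `d_𝖳 Φ = ⟨dΦ, 𝖳⟩` of a function on `E^k`. -/
def totalDeriv {k : ℕ} {V : Type*} [NormedAddCommGroup V] [NormedSpace ℝ V] (Φ : 𝔄.Jet k → V) :
    𝔄.Jet (k + 1) → V :=
  fun A => dFun Φ (proj (Nat.le_succ k) A) (canonicalT A)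

/-- The iterated total time derivative `d_𝖳^r Φ`. -/
def totalDerivIter {k : ℕ} {V : Type*} [NormedAddCommGroup V] [NormedSpace ℝ V]
    (Φ : 𝔄.Jet k → V) : (r : ℕ) → 𝔄.Jet (k + r) → V
  | 0 => Φ
  | r + 1 => totalDeriv (totalDerivIter Φ r)

/-- The contraction `i_𝖳 λ`, a function on `E^(k+1)`. -/
def contractT {k : ℕ} (lam : OneForm 𝔄 k) : 𝔄.Jet (k + 1) → ℝ :=
  fun A => lam (proj (Nat.le_succ k) A) (canonicalT A)

/-- The contraction `i_𝖳 dλ`, a `1`-form on `E^(k+1)`. -/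
def contractTd {k : ℕ} (lam : OneForm 𝔄 k) : OneForm 𝔄 (k + 1) :=
  fun A => (dForm lam (proj (Nat.le_succ k) A) (canonicalT A)).comp
    (ContinuousLinearMap.pi fun r : Fin (k + 1) => ContinuousLinearMap.proj r.castSucc)

/-- The total time derivative of `1`-forms, `d_𝖳 = d ∘ i_𝖳 + i_𝖳 ∘ d`. -/
def OneForm.totalDeriv {k : ℕ} (lam : OneForm 𝔄 k) : OneForm 𝔄 (k + 1) :=
  fun A => dFun (contractT lam) A + contractTd lam A

/-- The iterated total time derivative `d_𝖳^r λ`. -/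
def OneForm.totalDerivIter {k : ℕ} (lam : OneForm 𝔄 k) : (r : ℕ) → OneForm 𝔄 (k + r)
  | 0 => lam
  | r + 1 => (OneForm.totalDerivIter lam r).totalDeriv

/-! ### Complete lifts -/

/-- The components of a section of `E` in the trivialization `e_c`, as a function on `E^0 = M`. -/
def sectionCoord (𝔄 : LieAlgebroid B F E) (c : M) (η : Cₛ^∞⟮𝓘(ℝ, B); F, E⟯) : 𝔄.Jet 0 → F :=
  fun A => (trivializationAt F E c ⟨base A, η (base A)⟩).2

/-- The function `d_𝖳 η^α + C^α_{βγ} y_1^β η^γ` on `E^1`, in the trivialization `e_c`. -/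
def liftCoord (𝔄 : LieAlgebroid B F E) (c : M) (η : Cₛ^∞⟮𝓘(ℝ, B); F, E⟯) : 𝔄.Jet 1 → F :=
  fun A => totalDeriv (sectionCoord 𝔄 c η) A +
    𝔄.structureMap c (base A) (coord c A 0) (sectionCoord 𝔄 c η (proj (Nat.zero_le 1) A))

/-- The `k`-th order complete lift of a section `η` of `E`, the section
`η^k = η^α X_α + ∑_{r=1}^k d_𝖳^(r-1) [d_𝖳 η^α + C^α_{βγ} y_1^β η^γ] V^r_α` of `𝒯^E E^k`. -/
def completeLift (η : Cₛ^∞⟮𝓘(ℝ, B); F, E⟯) {k : ℕ} (A : 𝔄.Jet k) : ETangent F k :=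
  Fin.cons (sectionCoord 𝔄 (base A) η (proj (Nat.zero_le k) A))
    (fun r : Fin k => totalDerivIter (liftCoord 𝔄 (base A) η) r
      (proj (show 1 + (r : ℕ) ≤ k by omega) A))

/-! ### The vertical endomorphism, the variational operator and the Cartan operator -/

/-- A section `θ` of `E^*`, as a `1`-form on `𝒯^E E^0 = E`. -/
def basicForm (𝔄 : LieAlgebroid B F E) (θ : ∀ x : M, E x →L[ℝ] ℝ) : OneForm 𝔄 0 :=
  fun A => ((θ (base A)).comp ((trivializationAt F E (base A)).symmL ℝ (base A))).comp
    (ContinuousLinearMap.proj 0)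

open Classical in
/-- The vertical endomorphism `S` (acting on the dual of `𝒯^E E^k`) at the point `A`: the linear
map with `S(d_𝖳^r θ) = r d_𝖳^(r-1) θ` for all smooth sections `θ` of `E^*` and `0 ≤ r ≤ k`, where
the pullbacks to `E^k` are explicit. -/
def vertEndoAt {k : ℕ} (A : 𝔄.Jet k) : (ETangent F k →L[ℝ] ℝ) →ₗ[ℝ] (ETangent F k →L[ℝ] ℝ) :=
  if h : ∃ S : (ETangent F k →L[ℝ] ℝ) →ₗ[ℝ] (ETangent F k →L[ℝ] ℝ),
      ∀ θ : ∀ x : M, E x →L[ℝ] ℝ,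
        ContMDiff (𝓘(ℝ, B).prod 𝓘(ℝ, F)) 𝓘(ℝ, ℝ) ∞ (fun v : TotalSpace F E => θ v.1 v.2) →
        ∀ (r : ℕ) (hr : r ≤ k),
          S (((basicForm 𝔄 θ).totalDerivIter r).pull (show 0 + r ≤ k by omega) A) =
            (r : ℝ) • ((basicForm 𝔄 θ).totalDerivIter (r - 1)).pull
              (show 0 + (r - 1) ≤ k by omega) A
  then h.choose else 0

/-- The vertical endomorphism on `1`-forms. -/
def vertEndo {k : ℕ} (lam : OneForm 𝔄 k) : OneForm 𝔄 k := fun A => vertEndoAt A (lam A)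

/-- The variational operator `𝔼(λ) = ∑_{j=0}^k (-1)^j / j! d_𝖳^j (S^j λ)`. -/
def variationalOp {k : ℕ} (lam : OneForm 𝔄 k) : OneForm 𝔄 (2 * k) := fun A =>
  ∑ j : Fin (k + 1), ((-1 : ℝ) ^ (j : ℕ) / (Nat.factorial (j : ℕ) : ℝ)) •
    (OneForm.totalDerivIter (vertEndo^[(j : ℕ)] lam) j).pull
      (show k + (j : ℕ) ≤ 2 * k by omega) A

/-- The Cartan operator `𝕊(λ) = ∑_{j=1}^k (-1)^(j-1) / j! d_𝖳^(j-1) (S^j λ)` (here `j = i + 1`). -/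
def cartanOp {k : ℕ} (lam : OneForm 𝔄 k) : OneForm 𝔄 (2 * k - 1) := fun A =>
  ∑ i : Fin k, ((-1 : ℝ) ^ (i : ℕ) / (Nat.factorial ((i : ℕ) + 1) : ℝ)) •
    (OneForm.totalDerivIter (vertEndo^[(i : ℕ) + 1] lam) i).pull
      (show k + (i : ℕ) ≤ 2 * k - 1 by omega) A

/-! ### The Euler-Lagrange equations -/

/-- The Cartan form `θ_L = 𝕊(dL)`. -/
def cartanForm {k : ℕ} (L : 𝔄.Jet k → ℝ) : OneForm 𝔄 (2 * k - 1) := cartanOp (dFun L)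

/-- The map `δL : E^(2k) → E^*` associated with the `τ_{2k,0}`-semibasic form `𝔼(dL)`, in
components: since `⟨𝔼(dL), Z⟩ = ⟨δL, b⟩` for every `Z = (b, v)`, one has `δL_α = ⟨𝔼(dL), X_α⟩`. -/
def deltaL {k : ℕ} (L : 𝔄.Jet k → ℝ) (A : 𝔄.Jet (2 * k)) : F →L[ℝ] ℝ :=
  (variationalOp (dFun L) A).comp (ContinuousLinearMap.single ℝ (fun _ : Fin (2 * k + 1) => F) 0)

/-- The curve `a` is a solution on the interval `J` of the Euler-Lagrange equations of `L`: it is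
admissible, of class `C^(2k-1)` and `δL(a^(2k)(t)) = 0` for `t ∈ J`. -/
structure IsSolution {k : ℕ} (L : 𝔄.Jet k → ℝ) (J : Set ℝ) (a : ℝ → TotalSpace F E) : Prop where
  ordConnected : J.OrdConnected
  admissible : ∀ t ∈ J, 𝔄.AdmissibleAt (2 * k - 1) a t
  eulerLagrange : ∀ (t : ℝ) (ht : t ∈ J), deltaL L (𝔄.jet (2 * k) a t (admissible t ht)) = 0

/-- The function `G` on `E^(2k-1)` is a first integral of the Euler-Lagrange equations of `L`: it is
smooth, and `t ↦ G(a^(2k-1)(t))` is constant for every solution `a`. -/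
def IsFirstIntegral {k : ℕ} (L : 𝔄.Jet k → ℝ) (G : 𝔄.Jet (2 * k - 1) → ℝ) : Prop :=
  IsSmooth G ∧ ∀ (J : Set ℝ) (a : ℝ → TotalSpace F E) (h : IsSolution L J a),
    ∀ (t₁ : ℝ) (ht₁ : t₁ ∈ J) (t₂ : ℝ) (ht₂ : t₂ ∈ J),
      G (𝔄.jet (2 * k - 1) a t₁ ((h.admissible t₁ ht₁).of_le (Nat.sub_le _ 1))) =
        G (𝔄.jet (2 * k - 1) a t₂ ((h.admissible t₂ ht₂).of_le (Nat.sub_le _ 1)))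

end LieAlgebroid

end

open Set Filter Topology Bundle
open scoped Manifold ContDiff

noncomputable section

namespace LieAlgebroid

/-! ### Curves and their derivatives -/

section Curves

variable {V W : Type*} [NormedAddCommGroup V] [NormedSpace ℝ V]
  [NormedAddCommGroup W] [NormedSpace ℝ W]

/-! All operators in the statement are read off from curves. In a chart and a trivialization, a
`CurvePair` is an admissible curve `(x, y)` with a variation: its component `w` along `E` and the
induced variation `ζ = w' + C(y, w)` of the fibre component. The jets of the pair give a point `ξ`
of `E^k` and a vector `Z` of the fibre of `𝒯^E E^k`, and every point and vector arises in this way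
(`CurvePair.exists_through`). A 1-form thus becomes a function of time, its `pairing` with the
variation. Three facts translate the theory.

The total time derivative of a form becomes the time derivative of its pairings
(`CurvePair.hasDerivAt_pairing`). The vertical endomorphism at time `t` is transposed to replacing
`w` by `(s - t) w` (`CurvePair.pairing_vertEndo`), since the `r`-th derivative of `(s - t) f` at `t`
is `r` times the derivative of order `r - 1` of `f`. The complete lift of `η` is the variation with
`w = η` along the curve (`CurvePair.pairing_lift`).

Pairing `𝔼(λ)` with `(s - t) w` at `t` gives a telescoping sum that ends in `S^(k+1) λ = 0`. Every
vector with zero component along `E` comes from such a variation, so `𝔼(λ)` is semibasic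
(`variationalOp_eq_zero`).

For Noether's theorem put `g_j = ⟨S^j dL, η^k⟩` along a curve. The symmetry condition says that `F`
has derivative `g_0`. The derivative of `⟨θ_L, η^(2k-1)⟩` is the sum over `j ≥ 1` of `(-1)^(j-1)/j!`
times the `j`-th derivative of `g_j`. Hence the derivative of `G` is `⟨𝔼(dL), η^(2k)⟩`, which is
`⟨δL, η⟩` by semibasicity and vanishes where `δL = 0` (`totD_noether`). Since a solution is only of
class `C^(2k-1)`, this is proved as an identity at single points of `E^(2k)`, by means of smooth
curves through them, and only then evaluated on the jets of the solution.

Two consequences of the Lie algebroid axioms enter: the anchor is a bracket homomorphism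
(`rho_locStr`), which makes time derivative and variation commute, and the structure functions have
a definite transformation law (`locStr_gauge`), which makes the notion of variation independent of
the trivialization. -/

theorem iteratedDeriv_comp_congr {n : ℕ} {h : V → W} {f₁ f₂ : ℝ → V} {t : ℝ}
    (hh : ContDiffAt ℝ n h (f₁ t)) (h₁ : ContDiffAt ℝ n f₁ t) (h₂ : ContDiffAt ℝ n f₂ t)
    (heq : ∀ j ≤ n, iteratedDeriv j f₁ t = iteratedDeriv j f₂ t) {j : ℕ} (hj : j ≤ n) :
    iteratedDeriv j (fun s => h (f₁ s)) t = iteratedDeriv j (fun s => h (f₂ s)) t := by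
  have h0 : f₁ t = f₂ t := by simpa using heq 0 (Nat.zero_le _)
  have hj' : ((j : ℕ) : WithTop ℕ∞) ≤ (n : WithTop ℕ∞) := by exact_mod_cast hj
  -- Faà di Bruno's formula: the derivative of order `j` of the composite only involves derivatives
  -- of `h` at the common value and derivatives of the inner curve of order at most `j`.
  have e₁ := iteratedDeriv_vcomp_eq_sum_orderedFinpartition hh h₁ hj'
  have e₂ := iteratedDeriv_vcomp_eq_sum_orderedFinpartition (h0 ▸ hh) h₂ hj'
  refine e₁.trans (Eq.trans ?_ e₂.symm)
  rw [h0]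
  refine Finset.sum_congr rfl fun c _ => ?_
  congr 1
  funext m
  exact heq _ ((c.partSize_le m).trans hj)

theorem iteratedDeriv_prodMk {n : ℕ} {f : ℝ → V} {g : ℝ → W} {t : ℝ} (hf : ContDiffAt ℝ n f t)
    (hg : ContDiffAt ℝ n g t) {j : ℕ} (hj : j ≤ n) :
    iteratedDeriv j (fun s => (f s, g s)) t = (iteratedDeriv j f t, iteratedDeriv j g t) := by
  have hj' : ((j : ℕ) : WithTop ℕ∞) ≤ (n : WithTop ℕ∞) := by exact_mod_cast hj
  simp only [iteratedDeriv]
  rw [show (fun s => (f s, g s)) = fun s => (f s, g s) from rfl,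
    iteratedFDeriv_prodMk (hf.of_le hj') (hg.of_le hj') le_rfl]
  rfl

variable {I : Set ℝ}

theorem contDiffOn_iteratedDeriv (hI : IsOpen I) {f : ℝ → V} (hf : ContDiffOn ℝ ∞ f I) (n : ℕ) :
    ContDiffOn ℝ ∞ (iteratedDeriv n f) I := by
  induction n with
  | zero => simpa using hf
  | succ n ih =>
    rw [iteratedDeriv_succ]
    exact ((contDiffOn_infty_iff_deriv_of_isOpen hI).1 ih).2

theorem hasDerivAt_iteratedDeriv (hI : IsOpen I) {f : ℝ → V} (hf : ContDiffOn ℝ ∞ f I) (n : ℕ)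
    {t : ℝ} (ht : t ∈ I) : HasDerivAt (iteratedDeriv n f) (iteratedDeriv (n + 1) f t) t := by
  rw [iteratedDeriv_succ]
  exact (((contDiffOn_iteratedDeriv hI hf n).contDiffAt (hI.mem_nhds ht)).differentiableAt
    (by simp)).hasDerivAt

theorem hasDerivAt_iteratedDeriv_of_contDiffAt {f : ℝ → V} {n j : ℕ} {t : ℝ}
    (hf : ContDiffAt ℝ n f t) (hj : j < n) :
    HasDerivAt (iteratedDeriv j f) (iteratedDeriv (j + 1) f t) t := by
  rw [iteratedDeriv_succ]
  refine DifferentiableAt.hasDerivAt ?_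
  have := ContDiffWithinAt.differentiableWithinAt_iteratedDerivWithin (m := j) (s := univ)
    (contDiffWithinAt_univ.2 hf) (by exact_mod_cast hj) (by simp)
  simpa [iteratedDerivWithin_univ, differentiableWithinAt_univ] using this

/-- The derivatives of a curve multiplied by `s ↦ s - t₀`. -/
theorem iteratedDeriv_sub_smul (hI : IsOpen I) {f : ℝ → V} (hf : ContDiffOn ℝ ∞ f I) (t₀ : ℝ)
    (n : ℕ) {t : ℝ} (ht : t ∈ I) :
    iteratedDeriv n (fun s => (s - t₀) • f s) t =
      (t - t₀) • iteratedDeriv n f t + (n : ℝ) • iteratedDeriv (n - 1) f t := by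
  induction n generalizing t with
  | zero => simp
  | succ n ih =>
    rw [iteratedDeriv_succ]
    have he : iteratedDeriv n (fun s => (s - t₀) • f s) =ᶠ[𝓝 t] fun t =>
        (t - t₀) • iteratedDeriv n f t + (n : ℝ) • iteratedDeriv (n - 1) f t := by
      filter_upwards [hI.mem_nhds ht] with s hs using ih hs
    rw [he.deriv_eq]
    have h1 := ((hasDerivAt_id t).sub_const t₀).smul (hasDerivAt_iteratedDeriv hI hf n ht)
    have h2 : HasDerivAt (fun t => (n : ℝ) • iteratedDeriv (n - 1) f t)
        ((n : ℝ) • iteratedDeriv n f t) t := by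
      rcases n with _ | n
      · simpa using hasDerivAt_const t (0 : V)
      · exact (hasDerivAt_iteratedDeriv hI hf n ht).const_smul _
    have := (h1.add h2).deriv
    refine Eq.trans this ?_
    push_cast
    simp only [id]
    module

/-- The Taylor polynomial with the prescribed derivatives works. -/
theorem exists_iteratedDeriv_eq (n : ℕ) (v : ℕ → V) :
    ∃ f : ℝ → V, ContDiff ℝ ∞ f ∧ ∀ j < n, iteratedDeriv j f 0 = v j := by
  refine ⟨fun t => ∑ m ∈ Finset.range n, (t ^ m) • ((m.factorial : ℝ)⁻¹ • v m), by fun_prop, ?_⟩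
  intro j hj
  rw [iteratedDeriv_fun_sum (fun i _ => by fun_prop)]
  have : ∀ m ∈ Finset.range n, iteratedDeriv j
      (fun t : ℝ => (t ^ m) • ((m.factorial : ℝ)⁻¹ • v m)) 0 = if j = m then v m else 0 := by
    intro m _
    rw [iteratedDeriv_smul_const (f := fun t : ℝ => t ^ m) (by fun_prop),
      iteratedDeriv_fun_pow_zero]
    split_ifs with h
    · rw [smul_smul, mul_inv_cancel₀ (by positivity), one_smul]
    · simp
  rw [Finset.sum_congr rfl this]
  simp [hj]

/-- Existence and regularity of integral curves of a smooth vector field. -/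
theorem exists_smooth_integralCurve [CompleteSpace V] {O : Set V} (hO : IsOpen O) {X : V → V}
    (hX : ContDiffOn ℝ ∞ X O) {p : V} (hp : p ∈ O) :
    ∃ α : ℝ → V, ∃ ε > 0, α 0 = p ∧ ContDiffOn ℝ ∞ α (Ioo (-ε) ε) ∧
      ∀ t ∈ Ioo (-ε) ε, α t ∈ O ∧ HasDerivAt α (X (α t)) t := by
  obtain ⟨α, hα0, ε, hε, hα⟩ :=
    ContDiffAt.exists_forall_mem_closedBall_exists_eq_forall_mem_Ioo_hasDerivAt₀
      ((hX.contDiffAt (hO.mem_nhds hp)).of_le (by simp)) 0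
  simp only [zero_sub, zero_add] at hα
  have hc : ContinuousAt α 0 := (hα 0 ⟨by linarith, hε⟩).continuousAt
  obtain ⟨δ, hδ, hδO⟩ := Metric.mem_nhds_iff.1 (hc.preimage_mem_nhds (by
    rw [hα0]; exact hO.mem_nhds hp))
  have hm : 0 < min ε δ := lt_min hε hδ
  have key : ∀ t ∈ Ioo (-(min ε δ)) (min ε δ), α t ∈ O ∧ HasDerivAt α (X (α t)) t := by
    intro t ht
    refine ⟨hδO ?_, hα t ⟨by linarith [ht.1, min_le_left ε δ], ht.2.trans_le (min_le_left _ _)⟩⟩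
    rw [Real.ball_eq_Ioo]
    exact ⟨by linarith [ht.1, min_le_right ε δ], by linarith [ht.2, min_le_right ε δ]⟩
  refine ⟨α, min ε δ, hm, hα0, ?_, key⟩
  -- Bootstrapping: `α' = X ∘ α`, so a solution of class `C^n` is of class `C^(n+1)`.
  rw [contDiffOn_infty]
  intro n
  induction n with
  | zero =>
    exact contDiffOn_zero.2 fun t ht => (key t ht).2.continuousAt.continuousWithinAt
  | succ n ih =>
    have := (contDiffOn_succ_iff_deriv_of_isOpen (n := n) (f := α) (𝕜 := ℝ)
      (isOpen_Ioo (a := -(min ε δ)) (b := min ε δ))).2 ⟨fun t ht =>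
        (key t ht).2.differentiableAt.differentiableWithinAt, by simp, ?_⟩
    · exact_mod_cast this
    · refine ContDiffOn.congr ?_ fun t ht => (key t ht).2.deriv
      exact (hX.of_le (by exact_mod_cast le_top)).comp ih fun t ht => (key t ht).1

end Curves

end LieAlgebroid
set_option linter.unusedSectionVars false

namespace LieAlgebroid

variable {B F : Type*} [NormedAddCommGroup B] [NormedSpace ℝ B]
  [NormedAddCommGroup F] [NormedSpace ℝ F]
  {M : Type*} [TopologicalSpace M] [ChartedSpace B M] [IsManifold 𝓘(ℝ, B) ∞ M]
  {E : M → Type*} [TopologicalSpace (TotalSpace F E)] [∀ x, TopologicalSpace (E x)]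
  [∀ x, AddCommGroup (E x)] [∀ x, Module ℝ (E x)] [FiberBundle F E] [VectorBundle ℝ F E]
  [ContMDiffVectorBundle ∞ F E 𝓘(ℝ, B)]
  (𝔄 : LieAlgebroid B F E)

/-! ### Local expressions in a chart of the base -/

/-- The part of the chart domain at `x₀` lying over `O` and over the domain of the trivialization
`e_c`. -/
def dom (_ : LieAlgebroid B F E) (c x₀ : M) (O : Set M) : Set B :=
  (extChartAt 𝓘(ℝ, B) x₀).target ∩
    (extChartAt 𝓘(ℝ, B) x₀).symm ⁻¹' ((trivializationAt F E c).baseSet ∩ O)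

/-- The derivative of the chart at `x₀`. -/
def chartDeriv (x₀ x : M) : TangentSpace 𝓘(ℝ, B) x →L[ℝ] B :=
  mfderiv 𝓘(ℝ, B) 𝓘(ℝ, B) (extChartAt 𝓘(ℝ, B) x₀) x

/-- The anchor in the trivialization `e_c` and the chart at `x₀`. -/
def rho (c x₀ : M) (u : B) : F →L[ℝ] B :=
  (chartDeriv x₀ ((extChartAt 𝓘(ℝ, B) x₀).symm u)).comp
    (𝔄.localAnchor c ((extChartAt 𝓘(ℝ, B) x₀).symm u))

/-- The change of trivialization from `e_c` to `e_c'` in the chart at `x₀`. -/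
def gauge (_ : LieAlgebroid B F E) (c c' x₀ : M) (u : B) : F →L[ℝ] F :=
  ((trivializationAt F E c').continuousLinearMapAt ℝ ((extChartAt 𝓘(ℝ, B) x₀).symm u)).comp
    ((trivializationAt F E c).symmL ℝ ((extChartAt 𝓘(ℝ, B) x₀).symm u))

/-- The component of a section in the trivialization `e_c` and the chart at `x₀`. -/
def locSec (_ : LieAlgebroid B F E) (c x₀ : M) (s : Cₛ^∞⟮𝓘(ℝ, B); F, E⟯) (u : B) : F :=
  (trivializationAt F E c
    ⟨(extChartAt 𝓘(ℝ, B) x₀).symm u, s ((extChartAt 𝓘(ℝ, B) x₀).symm u)⟩).2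

section Domain

variable {𝔄} {c c' x₀ : M} {O O' : Set M} {u : B}

theorem isOpen_dom (hO : IsOpen O) : IsOpen (𝔄.dom c x₀ O) :=
  (continuousOn_extChartAt_symm x₀).isOpen_inter_preimage (isOpen_extChartAt_target x₀)
    ((trivializationAt F E c).open_baseSet.inter hO)

theorem dom_mono (h : O ⊆ O') : 𝔄.dom c x₀ O ⊆ 𝔄.dom c x₀ O' :=
  fun _ hu => ⟨hu.1, hu.2.1, h hu.2.2⟩

theorem dom_subset_univ : 𝔄.dom c x₀ O ⊆ 𝔄.dom c x₀ univ := dom_mono (subset_univ _)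

theorem mem_dom_of_mem {x : M} (hx : x ∈ (extChartAt 𝓘(ℝ, B) x₀).source)
    (hc : x ∈ (trivializationAt F E c).baseSet) (hO : x ∈ O) :
    extChartAt 𝓘(ℝ, B) x₀ x ∈ 𝔄.dom c x₀ O := by
  refine ⟨(extChartAt 𝓘(ℝ, B) x₀).map_source hx, ?_⟩
  rw [mem_preimage, (extChartAt 𝓘(ℝ, B) x₀).left_inv hx]
  exact ⟨hc, hO⟩

theorem dom_nhds (hu : u ∈ 𝔄.dom c x₀ univ) : 𝔄.dom c x₀ univ ∈ 𝓝 u :=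
  (isOpen_dom isOpen_univ).mem_nhds hu

end Domain

section ChartCalculus

variable {x₀ : M} {V : Type*} [NormedAddCommGroup V] [NormedSpace ℝ V]

theorem contDiffOn_comp_extChartAt_symm {f : M → V} {O : Set M}
    (hf : ContMDiffOn 𝓘(ℝ, B) 𝓘(ℝ, V) ∞ f O) :
    ContDiffOn ℝ ∞ (fun u => f ((extChartAt 𝓘(ℝ, B) x₀).symm u))
      ((extChartAt 𝓘(ℝ, B) x₀).target ∩ (extChartAt 𝓘(ℝ, B) x₀).symm ⁻¹' O) := by
  rw [← contMDiffOn_iff_contDiffOn]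
  exact hf.comp ((contMDiffOn_extChartAt_symm x₀).mono inter_subset_left) fun u hu => hu.2

theorem mfderiv_eq_fderiv_chart {f : M → V} {x : M} (hx : x ∈ (extChartAt 𝓘(ℝ, B) x₀).source)
    (hf : DifferentiableAt ℝ (fun u => f ((extChartAt 𝓘(ℝ, B) x₀).symm u))
      (extChartAt 𝓘(ℝ, B) x₀ x)) (v : TangentSpace 𝓘(ℝ, B) x) :
    mfderiv 𝓘(ℝ, B) 𝓘(ℝ, V) f x v =
      fderiv ℝ (fun u => f ((extChartAt 𝓘(ℝ, B) x₀).symm u)) (extChartAt 𝓘(ℝ, B) x₀ x)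
        (chartDeriv x₀ x v) := by
  have h1 : MDifferentiableAt 𝓘(ℝ, B) 𝓘(ℝ, B) (extChartAt 𝓘(ℝ, B) x₀) x :=
    mdifferentiableAt_extChartAt (by simpa using hx)
  have he : f =ᶠ[𝓝 x] (fun u => f ((extChartAt 𝓘(ℝ, B) x₀).symm u)) ∘ extChartAt 𝓘(ℝ, B) x₀ := by
    filter_upwards [(isOpen_extChartAt_source x₀).mem_nhds hx] with y hy
    simp only [Function.comp_apply, (extChartAt 𝓘(ℝ, B) x₀).left_inv hy]
  rw [he.mfderiv_eq]
  rw [mfderiv_comp x hf.mdifferentiableAt h1, mfderiv_eq_fderiv]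
  rfl

end ChartCalculus

/-! ### Smoothness of anchor, transition maps and sections in a chart -/

section Smoothness

variable {𝔄} {c c' x₀ : M}

theorem contDiffOn_gauge :
    ContDiffOn ℝ ∞ (𝔄.gauge c c' x₀) (𝔄.dom c x₀ (trivializationAt F E c').baseSet) := by
  have h := contDiffOn_comp_extChartAt_symm (x₀ := x₀) (contMDiffOn_coordChangeL (n := ∞)
    (IB := 𝓘(ℝ, B)) (trivializationAt F E c) (trivializationAt F E c'))
  refine h.congr fun u hu => ?_
  ext f
  erw [Trivialization.coordChangeL_apply _ _ hu.2]
  rw [gauge, ContinuousLinearMap.comp_apply, Trivialization.symmL_apply _ hu.2.1,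
    Trivialization.continuousLinearMapAt_apply_of_mem ℝ _ hu.2.2]

theorem contDiffOn_locSec (s : Cₛ^∞⟮𝓘(ℝ, B); F, E⟯) :
    ContDiffOn ℝ ∞ (𝔄.locSec c x₀ s) (𝔄.dom c x₀ univ) := by
  have h := (Trivialization.contMDiffOn_section_baseSet_iff (IB := 𝓘(ℝ, B)) (n := ∞)
    (trivializationAt F E c)).1 s.contMDiff.contMDiffOn
  exact (contDiffOn_comp_extChartAt_symm (x₀ := x₀) h).mono fun u hu => ⟨hu.1, hu.2.1⟩

theorem symmL_locSec {u : B} (hu : u ∈ 𝔄.dom c x₀ univ) (s : Cₛ^∞⟮𝓘(ℝ, B); F, E⟯) :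
    (trivializationAt F E c).symmL ℝ ((extChartAt 𝓘(ℝ, B) x₀).symm u) (𝔄.locSec c x₀ s u) =
      s ((extChartAt 𝓘(ℝ, B) x₀).symm u) := by
  rw [Trivialization.symmL_apply _ hu.2.1]
  exact Trivialization.symm_apply_apply_mk _ hu.2.1 _

theorem rho_locSec {u : B} (hu : u ∈ 𝔄.dom c x₀ univ) (s : Cₛ^∞⟮𝓘(ℝ, B); F, E⟯) :
    𝔄.rho c x₀ u (𝔄.locSec c x₀ s u) = chartDeriv x₀ ((extChartAt 𝓘(ℝ, B) x₀).symm u)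
        (𝔄.anchor _ (s ((extChartAt 𝓘(ℝ, B) x₀).symm u))) := by
  rw [← symmL_locSec hu s]; rfl

theorem gauge_locSec {u : B} (hu : u ∈ 𝔄.dom c x₀ (trivializationAt F E c').baseSet)
    (s : Cₛ^∞⟮𝓘(ℝ, B); F, E⟯) :
    𝔄.gauge c c' x₀ u (𝔄.locSec c x₀ s u) = 𝔄.locSec c' x₀ s u := by
  rw [gauge, ContinuousLinearMap.comp_apply, symmL_locSec (dom_subset_univ hu),
    Trivialization.continuousLinearMapAt_apply_of_mem ℝ _ hu.2.2]
  rfl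

theorem symmL_gauge {u : B} (hu : u ∈ 𝔄.dom c x₀ (trivializationAt F E c').baseSet) (f : F) :
    (trivializationAt F E c').symmL ℝ ((extChartAt 𝓘(ℝ, B) x₀).symm u) (𝔄.gauge c c' x₀ u f) =
      (trivializationAt F E c).symmL ℝ ((extChartAt 𝓘(ℝ, B) x₀).symm u) f :=
  Trivialization.symmL_continuousLinearMapAt _ hu.2.2 _

theorem rho_gauge {u : B} (hu : u ∈ 𝔄.dom c x₀ (trivializationAt F E c').baseSet) (f : F) :
    𝔄.rho c' x₀ u (𝔄.gauge c c' x₀ u f) = 𝔄.rho c x₀ u f := by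
  have := symmL_gauge hu f
  simp only [rho, localAnchor, ContinuousLinearMap.comp_apply]
  rw [this]

theorem chartDeriv_apply {x : M} (hx : x ∈ (chartAt B x₀).source)
    (v : TangentSpace 𝓘(ℝ, B) x) :
    chartDeriv x₀ x v = (trivializationAt B (TangentSpace 𝓘(ℝ, B)) x₀ ⟨x, v⟩).2 := by
  rw [chartDeriv, ← TangentBundle.continuousLinearMapAt_trivializationAt hx]
  exact Trivialization.continuousLinearMapAt_apply_of_mem ℝ _ (by simpa using hx) _

theorem contDiffOn_rho [FiniteDimensional ℝ F] :
    ContDiffOn ℝ ∞ (𝔄.rho c x₀) (𝔄.dom c x₀ univ) := by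
  rw [contDiffOn_clm_apply]
  intro f
  have h1 : ContMDiffOn 𝓘(ℝ, B) (𝓘(ℝ, B).prod 𝓘(ℝ, F)) ∞
      (fun x => (trivializationAt F E c).toOpenPartialHomeomorph.symm (x, f))
      (trivializationAt F E c).baseSet := by
    refine ((trivializationAt F E c).contMDiffOn_symm (IB := 𝓘(ℝ, B)) (n := ∞)).comp
      (contMDiffOn_id.prodMk contMDiffOn_const) fun x hx => ?_
    rw [(trivializationAt F E c).target_eq]
    exact ⟨hx, trivial⟩
  have h2 := (𝔄.contMDiff_anchor).comp_contMDiffOn h1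
  have h3 : ContMDiffOn 𝓘(ℝ, B) (𝓘(ℝ, B).prod 𝓘(ℝ, B)) ∞
      (fun x => (trivializationAt B (TangentSpace 𝓘(ℝ, B)) x₀) ((fun v : TotalSpace F E =>
        (⟨v.1, 𝔄.anchor v.1 v.2⟩ : TangentBundle 𝓘(ℝ, B) M))
        ((trivializationAt F E c).toOpenPartialHomeomorph.symm (x, f))))
      ((trivializationAt F E c).baseSet ∩ (chartAt B x₀).source) := by
    refine ((trivializationAt B (TangentSpace 𝓘(ℝ, B)) x₀).contMDiffOn (IB := 𝓘(ℝ, B))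
      (n := ∞)).comp (h2.mono inter_subset_left) fun x hx => ?_
    rw [mem_preimage, Trivialization.mem_source]
    have : ((trivializationAt F E c).toOpenPartialHomeomorph.symm (x, f)).proj = x :=
      Trivialization.proj_symm_apply' _ hx.1
    change ((trivializationAt F E c).toOpenPartialHomeomorph.symm (x, f)).proj ∈ _
    rw [this]
    exact hx.2
  have h4 := contDiffOn_comp_extChartAt_symm (x₀ := x₀) (contMDiff_snd.comp_contMDiffOn h3)
  refine (h4.mono fun u hu => ⟨hu.1, hu.2.1, ?_⟩).congr fun u hu => ?_
  · simpa using (extChartAt 𝓘(ℝ, B) x₀).map_target hu.1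
  · have hx : (extChartAt 𝓘(ℝ, B) x₀).symm u ∈ (chartAt B x₀).source := by
      simpa using (extChartAt 𝓘(ℝ, B) x₀).map_target hu.1
    change chartDeriv x₀ _ (𝔄.anchor _ ((trivializationAt F E c).symmL ℝ _ f)) = _
    rw [Trivialization.symmL_apply _ hu.2.1, chartDeriv_apply hx]
    dsimp only [Function.comp_def]
    rw [← Trivialization.mk_symm _ hu.2.1]

end Smoothness

/-! ### The local form of the bracket -/

section Bracket

variable {𝔄}

theorem exists_bump [FiniteDimensional ℝ B] [T2Space M] {x : M} {O : Set M} (hO : O ∈ 𝓝 x) :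
    ∃ ψ : M → ℝ, ContMDiff 𝓘(ℝ, B) 𝓘(ℝ, ℝ) ∞ ψ ∧ (∀ᶠ y in 𝓝 x, ψ y = 1) ∧ tsupport ψ ⊆ O := by
  obtain ⟨f, -, hf⟩ := (SmoothBumpFunction.nhds_basis_tsupport (I := 𝓘(ℝ, B)) x).mem_iff.1 hO
  exact ⟨f, f.contMDiff, f.eventuallyEq_one, hf⟩

/-- The product of a smooth function and a smooth section. -/
def smulSection (f : M → ℝ) (hf : ContMDiff 𝓘(ℝ, B) 𝓘(ℝ, ℝ) ∞ f) (s : Cₛ^∞⟮𝓘(ℝ, B); F, E⟯) :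
    Cₛ^∞⟮𝓘(ℝ, B); F, E⟯ :=
  ⟨fun x => f x • s x, hf.smul_section s.contMDiff⟩

theorem smulSection_apply (f : M → ℝ) (hf : ContMDiff 𝓘(ℝ, B) 𝓘(ℝ, ℝ) ∞ f)
    (s : Cₛ^∞⟮𝓘(ℝ, B); F, E⟯) (x : M) : smulSection f hf s x = f x • s x := rfl

theorem bracket_smulSection (s t : Cₛ^∞⟮𝓘(ℝ, B); F, E⟯) (f : M → ℝ)
    (hf : ContMDiff 𝓘(ℝ, B) 𝓘(ℝ, ℝ) ∞ f) (x : M) :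
    𝔄.bracket s (smulSection f hf t) x =
      f x • 𝔄.bracket s t x + dirDeriv f x (𝔄.anchor x (s x)) • t x :=
  𝔄.leibniz f hf s t _ (fun _ => rfl) x

theorem bracket_anticomm (s t : Cₛ^∞⟮𝓘(ℝ, B); F, E⟯) : 𝔄.bracket s t = -𝔄.bracket t s := by
  have h := 𝔄.bracket_self (s + t)
  simp only [map_add, LinearMap.add_apply, 𝔄.bracket_self, zero_add, add_zero] at h
  exact eq_neg_of_add_eq_zero_right h

variable [FiniteDimensional ℝ B] [T2Space M]

/-- Locality of the bracket. With a bump function `ψ` equal to `1` near `x` and supported where `t`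
vanishes, `t = (1 - ψ) t`; both terms of the Leibniz rule then vanish at `x`. -/
theorem bracket_eq_zero_of_eventually (s : Cₛ^∞⟮𝓘(ℝ, B); F, E⟯) {t : Cₛ^∞⟮𝓘(ℝ, B); F, E⟯} {x : M}
    (h : ∀ᶠ y in 𝓝 x, t y = 0) : 𝔄.bracket s t x = 0 := by
  obtain ⟨ψ, hψ, hψ1, hψt⟩ := exists_bump (B := B) h
  have hf : ContMDiff 𝓘(ℝ, B) 𝓘(ℝ, ℝ) ∞ (fun y => 1 - ψ y) := contMDiff_const.sub hψ
  have he : t = smulSection (fun y => 1 - ψ y) hf t := by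
    ext y
    rw [smulSection_apply]
    by_cases hy : ψ y = 0
    · simp [hy]
    · have : t y = 0 := hψt (subset_tsupport _ hy)
      simp [this]
  rw [he, bracket_smulSection]
  simp [hψ1.self_of_nhds, h.self_of_nhds]

theorem bracket_congr_right (s : Cₛ^∞⟮𝓘(ℝ, B); F, E⟯) {t t' : Cₛ^∞⟮𝓘(ℝ, B); F, E⟯} {x : M}
    (h : ∀ᶠ y in 𝓝 x, t y = t' y) : 𝔄.bracket s t x = 𝔄.bracket s t' x := by
  have : 𝔄.bracket s (t - t') x = 0 := bracket_eq_zero_of_eventually s (by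
    filter_upwards [h] with y hy
    simp [hy])
  rw [map_sub] at this
  simpa [sub_eq_zero] using this

theorem bracket_congr {s s' t t' : Cₛ^∞⟮𝓘(ℝ, B); F, E⟯} {x : M}
    (hs : ∀ᶠ y in 𝓝 x, s y = s' y) (ht : ∀ᶠ y in 𝓝 x, t y = t' y) :
    𝔄.bracket s t x = 𝔄.bracket s' t' x := by
  rw [bracket_congr_right s ht, bracket_anticomm s, bracket_anticomm s']
  simp [bracket_congr_right t' hs]

/-- Over the domain of `e_c` the default value `0` of `frameSection` does not occur: a bump function
extends the constant local section to a global one. -/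
theorem frameSection_spec {c x : M} (hx : x ∈ (trivializationAt F E c).baseSet) (f : F) :
    ∀ᶠ y in 𝓝 x, frameSection B E c x f y = (trivializationAt F E c).symmL ℝ y f := by
  have hO := (trivializationAt F E c).open_baseSet.mem_nhds hx
  have hex : ∃ s : Cₛ^∞⟮𝓘(ℝ, B); F, E⟯,
      ∀ᶠ x' in 𝓝 x, s x' = (trivializationAt F E c).symm x' f := by
    obtain ⟨ψ, hψ, hψ1, hψt⟩ := exists_bump (B := B) hO
    have h1 : ContMDiffOn 𝓘(ℝ, B) (𝓘(ℝ, B).prod 𝓘(ℝ, F)) ∞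
        (fun y => TotalSpace.mk' F y ((trivializationAt F E c).symm y f))
        (trivializationAt F E c).baseSet := by
      rw [Trivialization.contMDiffOn_section_baseSet_iff]
      refine (contMDiffOn_const (c := f)).congr fun y hy => ?_
      rw [Trivialization.apply_mk_symm _ hy]
    refine ⟨⟨fun y => ψ y • (trivializationAt F E c).symm y f,
      ContMDiffOn.smul_section_of_tsupport hψ.contMDiffOn
        (trivializationAt F E c).open_baseSet hψt h1⟩, ?_⟩
    filter_upwards [hψ1] with y hy
    change ψ y • (trivializationAt F E c).symm y f = _
    rw [hy, one_smul]
  rw [frameSection, dif_pos hex]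
  filter_upwards [hex.choose_spec, hO] with y hy hyO
  rw [hy, Trivialization.symmL_apply _ hyO]

end Bracket

/-! ### The bracket of sections in components -/

section BracketFormula

variable {𝔄} {c c' x₀ : M} {u : B}

theorem locSec_eq (hu : u ∈ 𝔄.dom c x₀ univ) (s : Cₛ^∞⟮𝓘(ℝ, B); F, E⟯) :
    𝔄.locSec c x₀ s u = (trivializationAt F E c).continuousLinearMapAt ℝ
      ((extChartAt 𝓘(ℝ, B) x₀).symm u) (s ((extChartAt 𝓘(ℝ, B) x₀).symm u)) := by
  rw [Trivialization.continuousLinearMapAt_apply_of_mem ℝ _ hu.2.1]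
  rfl

/-- The component of sections at a point, as a linear map. -/
def locSecHom (hu : u ∈ 𝔄.dom c x₀ univ) : Cₛ^∞⟮𝓘(ℝ, B); F, E⟯ →ₗ[ℝ] F where
  toFun s := 𝔄.locSec c x₀ s u
  map_add' s t := by
    simp only [locSec_eq hu]
    exact map_add _ (s _) (t _)
  map_smul' r s := by
    simp only [locSec_eq hu]
    exact map_smul _ r (s _)

theorem locSecHom_apply (hu : u ∈ 𝔄.dom c x₀ univ) (s : Cₛ^∞⟮𝓘(ℝ, B); F, E⟯) :
    locSecHom hu s = 𝔄.locSec c x₀ s u := rfl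

theorem mem_source_of_mem_dom {O : Set M} (hu : u ∈ 𝔄.dom c x₀ O) :
    (extChartAt 𝓘(ℝ, B) x₀).symm u ∈ (extChartAt 𝓘(ℝ, B) x₀).source :=
  (extChartAt 𝓘(ℝ, B) x₀).map_target hu.1

theorem dirDeriv_eq {f : M → ℝ} (hu : u ∈ 𝔄.dom c x₀ univ)
    (hf : DifferentiableAt ℝ (fun v => f ((extChartAt 𝓘(ℝ, B) x₀).symm v)) u)
    (s : Cₛ^∞⟮𝓘(ℝ, B); F, E⟯) :
    dirDeriv f ((extChartAt 𝓘(ℝ, B) x₀).symm u)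
      (𝔄.anchor _ (s ((extChartAt 𝓘(ℝ, B) x₀).symm u))) =
    fderiv ℝ (fun v => f ((extChartAt 𝓘(ℝ, B) x₀).symm v)) u
      (𝔄.rho c x₀ u (𝔄.locSec c x₀ s u)) := by
  have hr := (extChartAt 𝓘(ℝ, B) x₀).right_inv hu.1
  rw [dirDeriv, mfderiv_eq_fderiv_chart (x₀ := x₀) (mem_source_of_mem_dom hu)
    (by rw [hr]; exact hf), rho_locSec hu, hr]

theorem eventually_symm_nhds {p : M → Prop} (hu : u ∈ 𝔄.dom c x₀ univ)
    (h : ∀ᶠ y in 𝓝 ((extChartAt 𝓘(ℝ, B) x₀).symm u), p y) :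
    ∀ᶠ v in 𝓝 u, p ((extChartAt 𝓘(ℝ, B) x₀).symm v) :=
  ((continuousOn_extChartAt_symm x₀).continuousAt
    ((isOpen_extChartAt_target x₀).mem_nhds hu.1)).eventually h

variable [FiniteDimensional ℝ B] [T2Space M]

theorem exists_smooth_extension {V : Type*} [NormedAddCommGroup V] [NormedSpace ℝ V] {g : M → V}
    {O : Set M} (hO : IsOpen O) (hg : ContMDiffOn 𝓘(ℝ, B) 𝓘(ℝ, V) ∞ g O) {x : M} (hx : x ∈ O) :
    ∃ f : M → V, ContMDiff 𝓘(ℝ, B) 𝓘(ℝ, V) ∞ f ∧ ∀ᶠ y in 𝓝 x, f y = g y := by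
  obtain ⟨ψ, hψ, hψ1, hψt⟩ := exists_bump (B := B) (hO.mem_nhds hx)
  refine ⟨fun y => ψ y • g y, ?_, ?_⟩
  · refine contMDiff_of_tsupport fun y hy => ?_
    have hyO : y ∈ O := hψt ((tsupport_smul_subset_left ψ g) hy)
    exact (hψ y).smul (hg.contMDiffAt (hO.mem_nhds hyO))
  · filter_upwards [hψ1] with y hy
    simp [hy]

variable [FiniteDimensional ℝ F]

/-- Near the point, `t` is a combination of frame sections whose coefficients extend to global
smooth functions. By locality `t` may be replaced by that combination; the Leibniz rule then expands
the bracket, and the derivatives of the coefficients reassemble into the derivative of the component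
of `t`. -/
theorem locSec_bracket_right (hu : u ∈ 𝔄.dom c x₀ univ) (s t : Cₛ^∞⟮𝓘(ℝ, B); F, E⟯) :
    𝔄.locSec c x₀ (𝔄.bracket s t) u =
      ∑ α, (Module.finBasis ℝ F).coord α (𝔄.locSec c x₀ t u) • 𝔄.locSec c x₀ (𝔄.bracket s
        (frameSection B E c ((extChartAt 𝓘(ℝ, B) x₀).symm u) (Module.finBasis ℝ F α))) u
      + fderiv ℝ (𝔄.locSec c x₀ t) u (𝔄.rho c x₀ u (𝔄.locSec c x₀ s u)) := by
  set b := Module.finBasis ℝ F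
  set x := (extChartAt 𝓘(ℝ, B) x₀).symm u with hxdef
  have hsec : ContMDiffOn 𝓘(ℝ, B) 𝓘(ℝ, F) ∞ (fun y => (trivializationAt F E c ⟨y, t y⟩).2)
      (trivializationAt F E c).baseSet := (Trivialization.contMDiffOn_section_baseSet_iff
        (IB := 𝓘(ℝ, B)) (n := ∞) (trivializationAt F E c)).1 t.contMDiff.contMDiffOn
  have hf : ∀ α, ∃ f : M → ℝ, ContMDiff 𝓘(ℝ, B) 𝓘(ℝ, ℝ) ∞ f ∧ ∀ᶠ y in 𝓝 x,
      f y = b.coord α (trivializationAt F E c ⟨y, t y⟩).2 := fun α =>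
    exists_smooth_extension (trivializationAt F E c).open_baseSet
      ((LinearMap.toContinuousLinearMap (b.coord α)).contMDiff.comp_contMDiffOn hsec) hu.2.1
  choose f hfs hfe using hf
  set e := fun α => frameSection B E c x (b α)
  have he : ∀ α, ∀ᶠ y in 𝓝 x, e α y = (trivializationAt F E c).symmL ℝ y (b α) :=
    fun α => frameSection_spec hu.2.1 _
  have hev : ∀ (σ : Fin (Module.finrank ℝ F) → Cₛ^∞⟮𝓘(ℝ, B); F, E⟯) (y : M),
      (∑ α, σ α) y = ∑ α, σ α y := fun σ y => by
    have := map_sum (ContMDiffSection.coeAddHom 𝓘(ℝ, B) F ∞ E) σ Finset.univ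
    exact (congrFun this y).trans (Finset.sum_apply _ _ _)
  have ht : ∀ᶠ y in 𝓝 x, t y = (∑ α, smulSection (f α) (hfs α) (e α)) y := by
    filter_upwards [eventually_all.2 hfe, eventually_all.2 he,
      (trivializationAt F E c).open_baseSet.mem_nhds hu.2.1] with y h1 h2 h3
    rw [hev]
    simp only [smulSection_apply, h1, h2]
    simp only [← map_smul, ← map_sum]
    rw [show ∑ α, b.coord α (trivializationAt F E c ⟨y, t y⟩).2 • b α =
      (trivializationAt F E c ⟨y, t y⟩).2 from b.sum_repr _,
      Trivialization.symmL_apply _ h3, Trivialization.symm_apply_apply_mk _ h3]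
  have h0 : 𝔄.bracket s t x = 𝔄.bracket s (∑ α, smulSection (f α) (hfs α) (e α)) x :=
    bracket_congr_right s ht
  have hd : ∀ α, dirDeriv (f α) x (𝔄.anchor x (s x)) =
      b.coord α (fderiv ℝ (𝔄.locSec c x₀ t) u (𝔄.rho c x₀ u (𝔄.locSec c x₀ s u))) := by
    intro α
    have h1 : (fun v => f α ((extChartAt 𝓘(ℝ, B) x₀).symm v)) =ᶠ[𝓝 u]
        fun v => (LinearMap.toContinuousLinearMap (b.coord α)) (𝔄.locSec c x₀ t v) :=
      eventually_symm_nhds hu (hfe α)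
    have h2 : HasFDerivAt (𝔄.locSec c x₀ t) (fderiv ℝ (𝔄.locSec c x₀ t) u) u :=
      (((contDiffOn_locSec t).contDiffAt (dom_nhds hu)).differentiableAt (by simp)).hasFDerivAt
    have h3 := ((LinearMap.toContinuousLinearMap (b.coord α)).hasFDerivAt.comp u
      h2).congr_of_eventuallyEq h1
    rw [dirDeriv_eq hu h3.differentiableAt, h3.fderiv]
    rfl
  rw [locSec_eq hu, ← hxdef, h0, map_sum, hev]
  simp only [bracket_smulSection, map_sum, map_add, map_smul, Finset.sum_add_distrib, hd]
  congr 1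
  · refine Finset.sum_congr rfl fun α _ => ?_
    rw [(hfe α).self_of_nhds, locSec_eq hu (𝔄.bracket s _)]
    rfl
  · conv_rhs => rw [← b.sum_repr (fderiv ℝ (𝔄.locSec c x₀ t) u _)]
    refine Finset.sum_congr rfl fun α _ => ?_
    rw [(he α).self_of_nhds, Trivialization.continuousLinearMapAt_symmL _ hu.2.1]
    rfl

end BracketFormula


/-! ### Structure functions: smoothness and transformation law -/

section StructureFunctions

variable [FiniteDimensional ℝ F]

/-- The structure functions of the bracket in the trivialization `e_c` and the chart at `x₀`. -/
def locStr (c x₀ : M) (u : B) : F →L[ℝ] F →L[ℝ] F :=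
  𝔄.structureMap c ((extChartAt 𝓘(ℝ, B) x₀).symm u)

variable {𝔄} {c c' x₀ : M} {u : B}

theorem locStr_apply (hu : u ∈ 𝔄.dom c x₀ univ) (f g : F) :
    𝔄.locStr c x₀ u f g = ∑ α, ∑ β, (Module.finBasis ℝ F).coord α f •
      (Module.finBasis ℝ F).coord β g • 𝔄.locSec c x₀ (𝔄.bracket
        (frameSection B E c ((extChartAt 𝓘(ℝ, B) x₀).symm u) (Module.finBasis ℝ F α))
        (frameSection B E c ((extChartAt 𝓘(ℝ, B) x₀).symm u) (Module.finBasis ℝ F β))) u := by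
  simp only [locStr, structureMap, locSec_eq hu, sum_apply,
    ContinuousLinearMap.smulRight_apply, smul_apply]
  rfl

variable [FiniteDimensional ℝ B] [T2Space M]

theorem locSec_frameSection (hu : u ∈ 𝔄.dom c x₀ univ) (f : F) :
    ∀ᶠ v in 𝓝 u, 𝔄.locSec c x₀ (frameSection B E c ((extChartAt 𝓘(ℝ, B) x₀).symm u) f) v = f := by
  filter_upwards [eventually_symm_nhds hu (frameSection_spec (B := B) (E := E) hu.2.1 f),
    dom_nhds hu] with v hv hvd
  rw [locSec_eq hvd, hv, Trivialization.continuousLinearMapAt_symmL _ hvd.2.1]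

theorem locStr_anticomm (hu : u ∈ 𝔄.dom c x₀ univ) (f g : F) :
    𝔄.locStr c x₀ u f g = -𝔄.locStr c x₀ u g f := by
  rw [locStr_apply hu, locStr_apply hu, Finset.sum_comm, ← Finset.sum_neg_distrib]
  refine Finset.sum_congr rfl fun β _ => ?_
  rw [← Finset.sum_neg_distrib]
  refine Finset.sum_congr rfl fun α _ => ?_
  rw [bracket_anticomm, ← locSecHom_apply hu, map_neg, locSecHom_apply hu, smul_neg, smul_neg,
    smul_comm]

/-- The bracket of sections in coordinates. -/
theorem locSec_bracket (hu : u ∈ 𝔄.dom c x₀ univ) (s t : Cₛ^∞⟮𝓘(ℝ, B); F, E⟯) :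
    𝔄.locSec c x₀ (𝔄.bracket s t) u =
      𝔄.locStr c x₀ u (𝔄.locSec c x₀ s u) (𝔄.locSec c x₀ t u)
      + fderiv ℝ (𝔄.locSec c x₀ t) u (𝔄.rho c x₀ u (𝔄.locSec c x₀ s u))
      - fderiv ℝ (𝔄.locSec c x₀ s) u (𝔄.rho c x₀ u (𝔄.locSec c x₀ t u)) := by
  -- Antisymmetry moves `s` to the second slot, where `locSec_bracket_right` applies again.
  have h1 : ∀ α, 𝔄.locSec c x₀ (𝔄.bracket s
      (frameSection B E c ((extChartAt 𝓘(ℝ, B) x₀).symm u) (Module.finBasis ℝ F α))) u =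
      -∑ β, (Module.finBasis ℝ F).coord β (𝔄.locSec c x₀ s u) • 𝔄.locSec c x₀ (𝔄.bracket
        (frameSection B E c ((extChartAt 𝓘(ℝ, B) x₀).symm u) (Module.finBasis ℝ F α))
        (frameSection B E c ((extChartAt 𝓘(ℝ, B) x₀).symm u) (Module.finBasis ℝ F β))) u
      - fderiv ℝ (𝔄.locSec c x₀ s) u (𝔄.rho c x₀ u (Module.finBasis ℝ F α)) := by
    intro α
    rw [bracket_anticomm, ← locSecHom_apply hu, map_neg, locSecHom_apply hu,
      locSec_bracket_right hu, (locSec_frameSection hu _).self_of_nhds]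
    abel
  rw [locSec_bracket_right hu]
  simp only [h1, smul_sub, smul_neg, Finset.sum_sub_distrib, Finset.sum_neg_distrib]
  have h2 : ∑ α, (Module.finBasis ℝ F).coord α (𝔄.locSec c x₀ t u) •
      fderiv ℝ (𝔄.locSec c x₀ s) u (𝔄.rho c x₀ u (Module.finBasis ℝ F α)) =
      fderiv ℝ (𝔄.locSec c x₀ s) u (𝔄.rho c x₀ u (𝔄.locSec c x₀ t u)) := by
    conv_rhs => rw [← (Module.finBasis ℝ F).sum_repr (𝔄.locSec c x₀ t u)]
    simp only [map_sum, map_smul]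
    rfl
  have h3 : -∑ α, (Module.finBasis ℝ F).coord α (𝔄.locSec c x₀ t u) •
      ∑ β, (Module.finBasis ℝ F).coord β (𝔄.locSec c x₀ s u) • 𝔄.locSec c x₀ (𝔄.bracket
        (frameSection B E c ((extChartAt 𝓘(ℝ, B) x₀).symm u) (Module.finBasis ℝ F α))
        (frameSection B E c ((extChartAt 𝓘(ℝ, B) x₀).symm u) (Module.finBasis ℝ F β))) u =
      𝔄.locStr c x₀ u (𝔄.locSec c x₀ s u) (𝔄.locSec c x₀ t u) := by
    rw [locStr_anticomm hu, locStr_apply hu]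
    simp only [Finset.smul_sum]
  rw [h2, h3]
  abel

/-- The frame sections in `structureMap` are chosen anew at every point. By locality those chosen at
`u` give the same brackets at all nearby points, and the components of these fixed brackets are
smooth. -/
theorem contDiffOn_locStr : ContDiffOn ℝ ∞ (𝔄.locStr c x₀) (𝔄.dom c x₀ univ) := by
  rw [contDiffOn_clm_apply]
  intro f
  rw [contDiffOn_clm_apply]
  intro g u hu
  set e := fun α => frameSection B E c ((extChartAt 𝓘(ℝ, B) x₀).symm u) (Module.finBasis ℝ F α)
    with he
  have h1 : ContDiffAt ℝ ∞ (fun v => ∑ α, ∑ β, (Module.finBasis ℝ F).coord α f •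
      (Module.finBasis ℝ F).coord β g • 𝔄.locSec c x₀ (𝔄.bracket (e α) (e β)) v) u := by
    refine ContDiffAt.sum fun α _ => ContDiffAt.sum fun β _ => ?_
    exact (((contDiffOn_locSec _).contDiffAt (dom_nhds hu)).const_smul _).const_smul _
  refine (h1.congr_of_eventuallyEq ?_).contDiffWithinAt
  have hs := fun α => eventually_symm_nhds hu
    (frameSection_spec (B := B) (E := E) hu.2.1 (Module.finBasis ℝ F α)).eventually_nhds
  filter_upwards [eventually_all.2 hs, dom_nhds hu] with v hv hvd
  rw [locStr_apply hvd]
  refine Finset.sum_congr rfl fun α _ => Finset.sum_congr rfl fun β _ => ?_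
  have key : ∀ α, ∀ᶠ y in 𝓝 ((extChartAt 𝓘(ℝ, B) x₀).symm v),
      frameSection B E c ((extChartAt 𝓘(ℝ, B) x₀).symm v) (Module.finBasis ℝ F α) y = e α y := by
    intro α
    filter_upwards [frameSection_spec (B := B) (E := E) hvd.2.1 (Module.finBasis ℝ F α), hv α]
      with y h2 h3
    rw [h2, he, h3]
  rw [locSec_eq hvd, locSec_eq hvd, bracket_congr (key α) (key β)]

/-- The change of the structure functions under a change of trivialization. -/
theorem locStr_gauge (hu : u ∈ 𝔄.dom c x₀ (trivializationAt F E c').baseSet) (f h : F) :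
    𝔄.locStr c' x₀ u (𝔄.gauge c c' x₀ u f) (𝔄.gauge c c' x₀ u h) =
      𝔄.gauge c c' x₀ u (𝔄.locStr c x₀ u f h)
      - fderiv ℝ (𝔄.gauge c c' x₀) u (𝔄.rho c x₀ u f) h
      + fderiv ℝ (𝔄.gauge c c' x₀) u (𝔄.rho c x₀ u h) f := by
  have hu0 : u ∈ 𝔄.dom c x₀ univ := dom_subset_univ hu
  have hu' : u ∈ 𝔄.dom c' x₀ univ := ⟨hu.1, hu.2.2, trivial⟩
  have hnh := (isOpen_dom (𝔄 := 𝔄) (c := c) (x₀ := x₀)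
    (trivializationAt F E c').open_baseSet).mem_nhds hu
  set s := fun f : F => frameSection B E c ((extChartAt 𝓘(ℝ, B) x₀).symm u) f
  have h0 : ∀ f, 𝔄.locSec c x₀ (s f) u = f := fun f => (locSec_frameSection hu0 f).self_of_nhds
  have hd : ∀ f, fderiv ℝ (𝔄.locSec c x₀ (s f)) u = 0 := fun f => by
    have : 𝔄.locSec c x₀ (s f) =ᶠ[𝓝 u] fun _ => f := locSec_frameSection hu0 f
    rw [this.fderiv_eq]; simp
  have hd' : ∀ f v, fderiv ℝ (𝔄.locSec c' x₀ (s f)) u v =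
      fderiv ℝ (𝔄.gauge c c' x₀) u v f := fun f v => by
    have : 𝔄.locSec c' x₀ (s f) =ᶠ[𝓝 u] fun v => 𝔄.gauge c c' x₀ v f := by
      filter_upwards [locSec_frameSection hu0 f, hnh] with v hv hvd
      rw [← gauge_locSec hvd, hv]
    rw [this.fderiv_eq]
    have hg : DifferentiableAt ℝ (𝔄.gauge c c' x₀) u :=
      (contDiffOn_gauge.contDiffAt hnh).differentiableAt (by simp)
    rw [(hg.hasFDerivAt.clm_apply (hasFDerivAt_const f u)).fderiv]
    simp
  -- The bracket of the same two sections is computed in both trivializations. Near `u` their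
  -- components are constant in `e_c`; in `e_c'` they vary with `gauge`, whence the non-tensorial
  -- terms.
  have e1 := locSec_bracket hu0 (s f) (s h)
  have e2 := locSec_bracket hu' (s f) (s h)
  rw [← gauge_locSec hu, e1, ← gauge_locSec hu, ← gauge_locSec hu, h0, h0, hd', hd',
    rho_gauge hu, rho_gauge hu, hd, hd] at e2
  simp only [zero_apply, add_zero, sub_zero] at e2
  rw [e2]
  abel

/-- The anchor is a homomorphism of Lie algebras: the action on functions. -/
theorem dirDeriv_anchor_bracket {x : M} {f : M → ℝ} (hf : ContMDiff 𝓘(ℝ, B) 𝓘(ℝ, ℝ) ∞ f)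
    (s t v : Cₛ^∞⟮𝓘(ℝ, B); F, E⟯) (hv : v x ≠ 0)
    (hs : ContMDiff 𝓘(ℝ, B) 𝓘(ℝ, ℝ) ∞ fun y => dirDeriv f y (𝔄.anchor y (s y)))
    (ht : ContMDiff 𝓘(ℝ, B) 𝓘(ℝ, ℝ) ∞ fun y => dirDeriv f y (𝔄.anchor y (t y))) :
    dirDeriv f x (𝔄.anchor x (𝔄.bracket s t x)) =
      dirDeriv (fun y => dirDeriv f y (𝔄.anchor y (t y))) x (𝔄.anchor x (s x)) -
      dirDeriv (fun y => dirDeriv f y (𝔄.anchor y (s y))) x (𝔄.anchor x (t x)) := by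
  have hexp : ∀ r (hr : ContMDiff 𝓘(ℝ, B) 𝓘(ℝ, ℝ) ∞ fun y => dirDeriv f y (𝔄.anchor y (r y))),
      𝔄.bracket r (smulSection f hf v) =
        smulSection f hf (𝔄.bracket r v) + smulSection _ hr v := fun r hr => by
    ext y
    exact bracket_smulSection r v f hf y
  have hadd : ∀ (a b : Cₛ^∞⟮𝓘(ℝ, B); F, E⟯), (a + b) x = a x + b x := fun a b => rfl
  have hneg : ∀ (a : Cₛ^∞⟮𝓘(ℝ, B); F, E⟯), (-a) x = -a x := fun a => rfl
  -- In the Jacobi identity for `(s, t, f v)` the mixed first-order terms cancel. Subtracting `f`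
  -- times the identity for `(s, t, v)` leaves `(ρ([s, t]) f - ρ(s) ρ(t) f + ρ(t) ρ(s) f) v = 0` at
  -- `x`, and `v x ≠ 0`.
  have hj := 𝔄.jacobi s t (smulSection f hf v)
  have hj0 := 𝔄.jacobi s t v
  rw [bracket_anticomm (smulSection f hf v) s, bracket_anticomm (smulSection f hf v), map_neg,
    hexp s hs, hexp t ht, map_add, map_add] at hj
  rw [bracket_anticomm v s, bracket_anticomm v, map_neg] at hj0
  have hj := DFunLike.congr_fun hj x
  have hj0 := DFunLike.congr_fun hj0 x
  simp only [hadd, hneg, bracket_smulSection] at hj hj0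
  change _ = (0 : E x) at hj
  change _ = (0 : E x) at hj0
  have hz : (dirDeriv f x (𝔄.anchor x (𝔄.bracket s t x)) -
      (dirDeriv (fun y => dirDeriv f y (𝔄.anchor y (t y))) x (𝔄.anchor x (s x)) -
      dirDeriv (fun y => dirDeriv f y (𝔄.anchor y (s y))) x (𝔄.anchor x (t x)))) • v x = 0 := by
    have := congrArg (f x • ·) hj0
    simp only [smul_add, smul_neg, smul_zero] at this
    rw [← this] at hj
    rw [sub_smul, sub_smul, ← sub_eq_zero.2 hj.symm]
    abel
  exact sub_eq_zero.1 ((smul_eq_zero.1 hz).resolve_right hv)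

end StructureFunctions

/-! ### The anchor preserves brackets -/

section AnchorHom

variable {𝔄} {c x₀ : M} {u : B}

theorem contMDiffAt_of_chart {V : Type*} [NormedAddCommGroup V] [NormedSpace ℝ V] {f : M → V}
    {x : M} (hx : x ∈ (extChartAt 𝓘(ℝ, B) x₀).source)
    (hf : ContDiffAt ℝ ∞ (fun u => f ((extChartAt 𝓘(ℝ, B) x₀).symm u))
      (extChartAt 𝓘(ℝ, B) x₀ x)) : ContMDiffAt 𝓘(ℝ, B) 𝓘(ℝ, V) ∞ f x := by
  have he : f =ᶠ[𝓝 x] (fun u => f ((extChartAt 𝓘(ℝ, B) x₀).symm u)) ∘ extChartAt 𝓘(ℝ, B) x₀ := by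
    filter_upwards [(isOpen_extChartAt_source x₀).mem_nhds hx] with y hy
    simp only [Function.comp_apply, (extChartAt 𝓘(ℝ, B) x₀).left_inv hy]
  exact (hf.contMDiffAt.comp x (contMDiffAt_extChartAt' (by simpa using hx))).congr_of_eventuallyEq
    he

variable [FiniteDimensional ℝ F]

theorem contMDiff_dirDeriv {f : M → ℝ} (hf : ContMDiff 𝓘(ℝ, B) 𝓘(ℝ, ℝ) ∞ f)
    (s : Cₛ^∞⟮𝓘(ℝ, B); F, E⟯) :
    ContMDiff 𝓘(ℝ, B) 𝓘(ℝ, ℝ) ∞ fun y => dirDeriv f y (𝔄.anchor y (s y)) := by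
  intro x
  have hx := mem_extChartAt_source (I := 𝓘(ℝ, B)) x
  have hu : extChartAt 𝓘(ℝ, B) x x ∈ 𝔄.dom x x univ :=
    mem_dom_of_mem hx (FiberBundle.mem_baseSet_trivializationAt' x) trivial
  have hd := isOpen_dom (𝔄 := 𝔄) (c := x) (x₀ := x) isOpen_univ
  have hfs : ContDiffOn ℝ ∞ (fun u => f ((extChartAt 𝓘(ℝ, B) x).symm u)) (𝔄.dom x x univ) :=
    (contDiffOn_comp_extChartAt_symm (hf.contMDiffOn (s := univ))).mono fun u hu => ⟨hu.1, trivial⟩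
  refine contMDiffAt_of_chart hx ?_
  have h1 : ContDiffOn ℝ ∞ (fun u => fderiv ℝ (fun v => f ((extChartAt 𝓘(ℝ, B) x).symm v)) u
      (𝔄.rho x x u (𝔄.locSec x x s u))) (𝔄.dom x x univ) :=
    (hfs.fderiv_of_isOpen hd (by simp)).clm_apply (contDiffOn_rho.clm_apply (contDiffOn_locSec s))
  refine (h1.contDiffAt (dom_nhds hu)).congr_of_eventuallyEq ?_
  filter_upwards [dom_nhds hu] with v hv
  exact dirDeriv_eq hv ((hfs.contDiffAt (dom_nhds hv)).differentiableAt (by simp)) s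

variable [FiniteDimensional ℝ B] [T2Space M]

/-- The anchor is a homomorphism of Lie algebras, in coordinates. -/
theorem rho_locStr (hu : u ∈ 𝔄.dom c x₀ univ) (f h : F) :
    𝔄.rho c x₀ u (𝔄.locStr c x₀ u f h) =
      fderiv ℝ (𝔄.rho c x₀) u (𝔄.rho c x₀ u f) h - fderiv ℝ (𝔄.rho c x₀) u (𝔄.rho c x₀ u h) f := by
  -- The Jacobi argument needs a section that does not vanish at the point, so rank zero is treated
  -- apart.
  rcases subsingleton_or_nontrivial F with hF | hF
  · rw [Subsingleton.elim f 0, Subsingleton.elim h 0]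
    simp
  obtain ⟨f₀, hf₀⟩ := exists_ne (0 : F)
  set x := (extChartAt 𝓘(ℝ, B) x₀).symm u with hxdef
  have hxs : x ∈ (extChartAt 𝓘(ℝ, B) x₀).source := mem_source_of_mem_dom hu
  set s := fun f : F => frameSection B E c x f
  have hv : s f₀ x ≠ 0 := fun h0 => hf₀ (by
    rw [← (locSec_frameSection hu f₀).self_of_nhds, locSec_eq hu, ← hxdef, h0, map_zero])
  have hl : ∀ f, ∀ᶠ v in 𝓝 u, 𝔄.locSec c x₀ (s f) v = f := fun f => locSec_frameSection hu f
  have hl0 : ∀ f, 𝔄.locSec c x₀ (s f) u = f := fun f => (hl f).self_of_nhds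
  have hd : ∀ f, fderiv ℝ (𝔄.locSec c x₀ (s f)) u = 0 := fun f => by
    have : 𝔄.locSec c x₀ (s f) =ᶠ[𝓝 u] fun _ => f := hl f
    rw [this.fderiv_eq]; simp
  have hrho : DifferentiableAt ℝ (𝔄.rho c x₀) u :=
    (contDiffOn_rho.contDiffAt (dom_nhds hu)).differentiableAt (by simp)
  -- Vectors of `B` are tested by functionals `ℓ`; a global smooth `g` agreeing with `ℓ` composed
  -- with the chart turns the claim into the action of the anchor on functions.
  rw [SeparatingDual.eq_iff_forall_dual_eq (R := ℝ)]
  intro ℓ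
  obtain ⟨g, hg, hge⟩ := exists_smooth_extension (isOpen_extChartAt_source (I := 𝓘(ℝ, B)) x₀)
    (ℓ.contMDiff.comp_contMDiffOn (contMDiffOn_extChartAt (I := 𝓘(ℝ, B)) (n := ∞)
      |>.mono (by rw [extChartAt_source]))) hxs
  have hgl : ∀ᶠ v in 𝓝 u, g ((extChartAt 𝓘(ℝ, B) x₀).symm v) = ℓ v := by
    filter_upwards [eventually_symm_nhds hu hge, dom_nhds hu] with v hv hvd
    rw [hv, Function.comp_apply, (extChartAt 𝓘(ℝ, B) x₀).right_inv hvd.1]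
  have hder : ∀ r : Cₛ^∞⟮𝓘(ℝ, B); F, E⟯, ∀ᶠ v in 𝓝 u,
      dirDeriv g ((extChartAt 𝓘(ℝ, B) x₀).symm v)
        (𝔄.anchor _ (r ((extChartAt 𝓘(ℝ, B) x₀).symm v))) =
      ℓ (𝔄.rho c x₀ v (𝔄.locSec c x₀ r v)) := fun r => by
    filter_upwards [hgl.eventually_nhds, dom_nhds hu] with v hv hvd
    have : (fun w => g ((extChartAt 𝓘(ℝ, B) x₀).symm w)) =ᶠ[𝓝 v] ℓ := hv
    rw [dirDeriv_eq hvd (this.symm.differentiableAt_iff.1 ℓ.differentiableAt), this.fderiv_eq,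
      ContinuousLinearMap.fderiv]
  have hder2 : ∀ a b : F, dirDeriv (fun y => dirDeriv g y (𝔄.anchor y (s b y))) x
      (𝔄.anchor x (s a x)) = ℓ (fderiv ℝ (𝔄.rho c x₀) u (𝔄.rho c x₀ u a) b) := fun a b => by
    have : (fun w => dirDeriv g ((extChartAt 𝓘(ℝ, B) x₀).symm w)
        (𝔄.anchor _ (s b ((extChartAt 𝓘(ℝ, B) x₀).symm w)))) =ᶠ[𝓝 u]
        fun v => ℓ (𝔄.rho c x₀ v b) := by
      filter_upwards [hder (s b), hl b] with v h1 h2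
      rw [h1, h2]
    have h3 := (ℓ.hasFDerivAt.comp u
      (hrho.hasFDerivAt.clm_apply (hasFDerivAt_const b u))).congr_of_eventuallyEq this
    rw [dirDeriv_eq (f := fun y => dirDeriv g y (𝔄.anchor y (s b y))) hu h3.differentiableAt,
      h3.fderiv, hl0]
    simp
  have key := dirDeriv_anchor_bracket (𝔄 := 𝔄) (x := x) hg (s f) (s h) (s f₀) hv
    (contMDiff_dirDeriv hg _) (contMDiff_dirDeriv hg _)
  rw [hder2, hder2, (hder (𝔄.bracket (s f) (s h))).self_of_nhds, locSec_bracket hu, hd, hd, hl0,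
    hl0] at key
  simpa using key

end AnchorHom

/-! ### Admissible curves in coordinates -/

section AdmissibleCurves

/-- The base component of a curve in `E`, in the chart at `x₀`. -/
def basePart (B : Type*) [NormedAddCommGroup B] [NormedSpace ℝ B] [ChartedSpace B M] (x₀ : M)
    (a : ℝ → TotalSpace F E) (t : ℝ) : B := extChartAt 𝓘(ℝ, B) x₀ (a t).proj

/-- The fibre component of a curve in `E`, in the trivialization `e_c`. -/
def fibrePart (c : M) (a : ℝ → TotalSpace F E) (t : ℝ) : F := (trivializationAt F E c (a t)).2

/-- The curve in `E` with given components. -/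
def curveOf (_ : LieAlgebroid B F E) (c x₀ : M) (x : ℝ → B) (y : ℝ → F) (t : ℝ) :
    TotalSpace F E :=
  ⟨(extChartAt 𝓘(ℝ, B) x₀).symm (x t),
    (trivializationAt F E c).symmL ℝ ((extChartAt 𝓘(ℝ, B) x₀).symm (x t)) (y t)⟩

variable {𝔄} {c c' x₀ : M} {n : ℕ} {a : ℝ → TotalSpace F E} {t : ℝ}

theorem AdmissibleAt.contMDiffAt_proj (ha : 𝔄.AdmissibleAt n a t) :
    ContMDiffAt 𝓘(ℝ, ℝ) 𝓘(ℝ, B) n (fun s => (a s).proj) t :=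
  (Bundle.contMDiffAt_totalSpace.1 ha.1).1

theorem AdmissibleAt.contDiffAt_basePart (ha : 𝔄.AdmissibleAt n a t)
    (hx : (a t).proj ∈ (extChartAt 𝓘(ℝ, B) x₀).source) : ContDiffAt ℝ n (basePart B x₀ a) t :=
  (((contMDiffAt_extChartAt' (I := 𝓘(ℝ, B)) (n := ∞) (by simpa using hx)).of_le
    (by exact_mod_cast le_top)).comp t ha.contMDiffAt_proj).contDiffAt

theorem AdmissibleAt.contDiffAt_fibrePart (ha : 𝔄.AdmissibleAt n a t)
    (hc : (a t).proj ∈ (trivializationAt F E c).baseSet) : ContDiffAt ℝ n (fibrePart c a) t := by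
  have : ContMDiffVectorBundle n F E 𝓘(ℝ, B) := ContMDiffVectorBundle.of_le (n := ∞)
    (by exact_mod_cast le_top)
  exact (((trivializationAt F E c).contMDiffAt_iff (by rwa [Trivialization.mem_source])).1
    ha.1).2.contDiffAt

theorem AdmissibleAt.eventually_mem (ha : 𝔄.AdmissibleAt n a t) {O : Set M}
    (hO : O ∈ 𝓝 (a t).proj) : ∀ᶠ s in 𝓝 t, (a s).proj ∈ O :=
  ha.contMDiffAt_proj.continuousAt.preimage_mem_nhds hO

theorem AdmissibleAt.eventually_hasDerivAt (ha : 𝔄.AdmissibleAt n a t)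
    (hx : (a t).proj ∈ (extChartAt 𝓘(ℝ, B) x₀).source)
    (hc : (a t).proj ∈ (trivializationAt F E c).baseSet) :
    ∀ᶠ s in 𝓝 t, HasDerivAt (basePart B x₀ a)
      (𝔄.rho c x₀ (basePart B x₀ a s) (fibrePart c a s)) s := by
  filter_upwards [ha.2, ha.eventually_mem ((isOpen_extChartAt_source x₀).mem_nhds hx),
    ha.eventually_mem ((trivializationAt F E c).open_baseSet.mem_nhds hc)] with s h1 h2 h3
  have h4 := (mdifferentiableAt_extChartAt (I := 𝓘(ℝ, B)) (x := x₀) (y := (a s).proj)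
    (by simpa using h2)).hasMFDerivAt
  have h5 : HasFDerivAt (basePart B x₀ a) ((chartDeriv x₀ (a s).proj).comp
      ((1 : ℝ →L[ℝ] ℝ).smulRight (𝔄.anchor (a s).proj (a s).2)) : ℝ →L[ℝ] B) s :=
    (h4.comp s h1).hasFDerivAt
  refine h5.hasDerivAt.congr_deriv ?_
  have hl : (extChartAt 𝓘(ℝ, B) x₀).symm (basePart B x₀ a s) = (a s).proj :=
    (extChartAt 𝓘(ℝ, B) x₀).left_inv h2
  have h6 : (trivializationAt F E c).symmL ℝ (a s).proj (fibrePart c a s) = (a s).2 := by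
    rw [Trivialization.symmL_apply _ h3]
    exact Trivialization.symm_proj_apply _ _ h3
  rw [rho, hl]
  simp only [localAnchor]
  change chartDeriv x₀ (a s).proj ((1 : ℝ) • (𝔄.anchor (a s).proj (a s).2)) = chartDeriv x₀
    (a s).proj (𝔄.anchor (a s).proj ((trivializationAt F E c).symmL ℝ (a s).proj (fibrePart c a s)))
  rw [h6, one_smul]

theorem admissibleAt_curveOf {x : ℝ → B} {y : ℝ → F} (hxt : x t ∈ 𝔄.dom c x₀ univ)
    (hx : ContDiffAt ℝ n x t) (hy : ContDiffAt ℝ n y t)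
    (hd : ∀ᶠ s in 𝓝 t, HasDerivAt x (𝔄.rho c x₀ (x s) (y s)) s) :
    𝔄.AdmissibleAt n (𝔄.curveOf c x₀ x y) t := by
  have hmem : ∀ᶠ s in 𝓝 t, x s ∈ 𝔄.dom c x₀ univ := hx.continuousAt.eventually (dom_nhds hxt)
  have hsymm : ∀ {u : B}, u ∈ (extChartAt 𝓘(ℝ, B) x₀).target →
      ContMDiffAt 𝓘(ℝ, B) 𝓘(ℝ, B) ∞ (extChartAt 𝓘(ℝ, B) x₀).symm u := fun hu =>
    (contMDiffOn_extChartAt_symm x₀).contMDiffAt ((isOpen_extChartAt_target x₀).mem_nhds hu)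
  refine ⟨?_, ?_⟩
  · have : ContMDiffVectorBundle n F E 𝓘(ℝ, B) := ContMDiffVectorBundle.of_le (n := ∞)
      (by exact_mod_cast le_top)
    refine ((trivializationAt F E c).contMDiffAt_iff (by
      rw [Trivialization.mem_source]; exact hxt.2.1)).2 ⟨?_, ?_⟩
    · exact ((hsymm hxt.1).of_le (by exact_mod_cast le_top)).comp t hx.contMDiffAt
    · refine hy.contMDiffAt.congr_of_eventuallyEq ?_
      filter_upwards [hmem] with s hs
      rw [curveOf, ← Trivialization.continuousLinearMapAt_apply_of_mem ℝ _ hs.2.1,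
        Trivialization.continuousLinearMapAt_symmL _ hs.2.1]
  · filter_upwards [hmem, hd] with s hs hds
    have h1 := ((hsymm hs.1).mdifferentiableAt (by simp)).hasMFDerivAt
    have h2 := h1.comp s hds.hasFDerivAt.hasMFDerivAt
    set D : B →L[ℝ] TangentSpace 𝓘(ℝ, B) ((extChartAt 𝓘(ℝ, B) x₀).symm (x s)) :=
      mfderiv 𝓘(ℝ, B) 𝓘(ℝ, B) (extChartAt 𝓘(ℝ, B) x₀).symm (x s) with hD
    have h3 : ∀ v : TangentSpace 𝓘(ℝ, B) ((extChartAt 𝓘(ℝ, B) x₀).symm (x s)),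
        D (chartDeriv x₀ ((extChartAt 𝓘(ℝ, B) x₀).symm (x s)) v) = v := fun v => by
      have h := DFunLike.congr_fun
        (mfderivWithin_extChartAt_symm_comp_mfderiv_extChartAt (I := 𝓘(ℝ, B)) hs.1) v
      rw [ModelWithCorners.range_eq_univ, mfderivWithin_univ] at h
      exact h
    refine h2.congr_mfderiv ?_
    ext
    change D ((1 : ℝ) • (𝔄.rho c x₀ (x s) (y s))) = (1 : ℝ) • 𝔄.anchor
      ((extChartAt 𝓘(ℝ, B) x₀).symm (x s)) ((trivializationAt F E c).symmL ℝ
        ((extChartAt 𝓘(ℝ, B) x₀).symm (x s)) (y s))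
    rw [one_smul, one_smul]
    exact h3 _

end AdmissibleCurves


/-! ### Jets in coordinates -/

section JetCoordinates

variable {𝔄} {c c' x₀ : M} {a : ℝ → TotalSpace F E} {t : ℝ} {k l : ℕ} {u : B}

theorem fibrePart_gauge (hx : (a t).proj ∈ (extChartAt 𝓘(ℝ, B) x₀).source)
    (hc : (a t).proj ∈ (trivializationAt F E c).baseSet)
    (hc' : (a t).proj ∈ (trivializationAt F E c').baseSet) :
    fibrePart c' a t = 𝔄.gauge c c' x₀ (basePart B x₀ a t) (fibrePart c a t) := by
  have hl : (extChartAt 𝓘(ℝ, B) x₀).symm (basePart B x₀ a t) = (a t).proj :=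
    (extChartAt 𝓘(ℝ, B) x₀).left_inv hx
  rw [gauge, hl, ContinuousLinearMap.comp_apply,
    Trivialization.continuousLinearMapAt_apply_of_mem ℝ _ hc', Trivialization.symmL_apply _ hc]
  have h6 : (trivializationAt F E c).symm (a t).proj (fibrePart c a t) = (a t).2 :=
    Trivialization.symm_proj_apply _ _ hc
  rw [h6]
  rfl

theorem mem_dom_basePart (hx : (a t).proj ∈ (extChartAt 𝓘(ℝ, B) x₀).source)
    (hc : (a t).proj ∈ (trivializationAt F E c).baseSet)
    (hc' : (a t).proj ∈ (trivializationAt F E c').baseSet) :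
    basePart B x₀ a t ∈ 𝔄.dom c x₀ (trivializationAt F E c').baseSet :=
  mem_dom_of_mem hx hc hc'

theorem contDiffAt_gauge_apply {O : Set M} (hO : IsOpen O)
    (hOc : O ⊆ (trivializationAt F E c').baseSet) (hu : u ∈ 𝔄.dom c x₀ O) (f : F) :
    ContDiffAt ℝ ∞ (fun q : B × F => 𝔄.gauge c c' x₀ q.1 q.2) (u, f) := by
  have h : ContDiffAt ℝ ∞ (𝔄.gauge c c' x₀) u :=
    (contDiffOn_gauge.mono (dom_mono hOc)).contDiffAt ((isOpen_dom hO).mem_nhds hu)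
  exact (h.comp (u, f) contDiffAt_fst).clm_apply contDiffAt_snd

/-- The expression of a curve in the chart of `E` at a point. -/
theorem eventually_extChartAt_eq {n : ℕ} (ha : 𝔄.AdmissibleAt n a 0) :
    (fun t => extChartAt (𝓘(ℝ, B).prod 𝓘(ℝ, F)) (a 0) (a t)) =ᶠ[𝓝 0]
      fun t => (basePart B (a 0).proj a t, fibrePart (a 0).proj a t) := by
  filter_upwards [ha.eventually_mem ((trivializationAt F E (a 0).proj).open_baseSet.mem_nhds
    (mem_baseSet_trivializationAt F E _))] with t ht
  rw [FiberBundle.extChartAt]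
  change (extChartAt 𝓘(ℝ, B) (a 0).proj (trivializationAt F E (a 0).proj (a t)).1, _) = _
  rw [Trivialization.coe_fst' _ ht]
  rfl

theorem jetData_snd (a : 𝔄.AdmCurve k) (j : Fin k) :
    (𝔄.jetData k a).2 j = (iteratedDeriv j (basePart B (a.1 0).proj a.1) 0,
      iteratedDeriv j (fibrePart (a.1 0).proj a.1) 0) := by
  have hj : (j : ℕ) ≤ k - 1 := by omega
  refine ((eventually_extChartAt_eq a.2).iteratedDeriv_eq j).trans ?_
  exact iteratedDeriv_prodMk (a.2.contDiffAt_basePart (mem_extChartAt_source _))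
    (a.2.contDiffAt_fibrePart (mem_baseSet_trivializationAt F E _)) hj

/-- The fibre part in `e_c'` is a fixed smooth function of the base part and the fibre part in
`e_c`, so its derivatives are determined by theirs. -/
theorem iteratedDeriv_fibrePart_congr {a b : ℝ → TotalSpace F E} {n : ℕ}
    (ha : 𝔄.AdmissibleAt n a 0) (hb : 𝔄.AdmissibleAt n b 0) (h0 : (a 0).proj = (b 0).proj)
    (hx : (a 0).proj ∈ (extChartAt 𝓘(ℝ, B) x₀).source)
    (hc : (a 0).proj ∈ (trivializationAt F E c).baseSet)
    (hc' : (a 0).proj ∈ (trivializationAt F E c').baseSet)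
    (hbase : ∀ j ≤ n, iteratedDeriv j (basePart B x₀ a) 0 = iteratedDeriv j (basePart B x₀ b) 0)
    (hfib : ∀ j ≤ n, iteratedDeriv j (fibrePart c a) 0 = iteratedDeriv j (fibrePart c b) 0)
    {j : ℕ} (hj : j ≤ n) :
    iteratedDeriv j (fibrePart c' a) 0 = iteratedDeriv j (fibrePart c' b) 0 := by
  have key : ∀ {a : ℝ → TotalSpace F E} (_ : 𝔄.AdmissibleAt n a 0)
      (_ : (a 0).proj ∈ (extChartAt 𝓘(ℝ, B) x₀).source)
      (_ : (a 0).proj ∈ (trivializationAt F E c).baseSet)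
      (_ : (a 0).proj ∈ (trivializationAt F E c').baseSet),
      fibrePart c' a =ᶠ[𝓝 0] fun t =>
        𝔄.gauge c c' x₀ (basePart B x₀ a t, fibrePart c a t).1
          (basePart B x₀ a t, fibrePart c a t).2 := by
    intro a ha hx hc hc'
    filter_upwards [ha.eventually_mem ((isOpen_extChartAt_source x₀).mem_nhds hx),
      ha.eventually_mem ((trivializationAt F E c).open_baseSet.mem_nhds hc),
      ha.eventually_mem ((trivializationAt F E c').open_baseSet.mem_nhds hc')] with t h1 h2 h3
    exact fibrePart_gauge h1 h2 h3
  rw [(key ha hx hc hc').iteratedDeriv_eq j,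
    (key hb (h0 ▸ hx) (h0 ▸ hc) (h0 ▸ hc')).iteratedDeriv_eq j]
  have ca := ha.contDiffAt_basePart hx
  have cb := hb.contDiffAt_basePart (h0 ▸ hx)
  have fa := ha.contDiffAt_fibrePart hc
  have fb := hb.contDiffAt_fibrePart (h0 ▸ hc)
  refine iteratedDeriv_comp_congr (n := n) (h := fun q : B × F => 𝔄.gauge c c' x₀ q.1 q.2)
    ((contDiffAt_gauge_apply (trivializationAt F E c').open_baseSet subset_rfl
      (mem_dom_basePart hx hc hc') _).of_le (by exact_mod_cast le_top))
    (ca.prodMk fa) (cb.prodMk fb) (fun i hi => ?_) hj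
  rw [iteratedDeriv_prodMk ca fa hi, iteratedDeriv_prodMk cb fb hi, hbase i hi, hfib i hi]

theorem iteratedDeriv_fibrePart_eq_of_jetData {a b : 𝔄.AdmCurve k}
    (h : 𝔄.jetData k a = 𝔄.jetData k b) (hc : (a.1 0).proj ∈ (trivializationAt F E c).baseSet)
    (j : Fin k) : iteratedDeriv j (fibrePart c a.1) 0 = iteratedDeriv j (fibrePart c b.1) 0 := by
  have h0 : (a.1 0).proj = (b.1 0).proj := congrArg Prod.fst h
  have hd : ∀ i ≤ k - 1, (iteratedDeriv i (basePart B (a.1 0).proj a.1) 0,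
      iteratedDeriv i (fibrePart (a.1 0).proj a.1) 0) =
      (iteratedDeriv i (basePart B (a.1 0).proj b.1) 0,
      iteratedDeriv i (fibrePart (a.1 0).proj b.1) 0) := fun i hi => by
    have h1 := congrFun (congrArg Prod.snd h) ⟨i, by have := j.pos; omega⟩
    rw [jetData_snd, jetData_snd, ← h0] at h1
    exact h1
  exact iteratedDeriv_fibrePart_congr a.2 b.2 h0 (mem_extChartAt_source _)
    (mem_baseSet_trivializationAt F E _) hc (fun i hi => (Prod.ext_iff.1 (hd i hi)).1)
    (fun i hi => (Prod.ext_iff.1 (hd i hi)).2) (Nat.le_sub_one_of_lt j.2)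

/-- The jet at `0` of an admissible curve. -/
def jetMk (a : 𝔄.AdmCurve k) : 𝔄.Jet k := Quotient.mk (𝔄.jetSetoid k) a

theorem jetMk_surjective (A : 𝔄.Jet k) : ∃ a, jetMk a = A := Quotient.exists_rep A

/-- Since `coord` is defined through a chosen representative, this independence of the choice is
what makes it computable. -/
theorem coord_jetMk (a : 𝔄.AdmCurve k) (hc : (a.1 0).proj ∈ (trivializationAt F E c).baseSet)
    (j : Fin k) : coord c (jetMk a) j = iteratedDeriv j (fibrePart c a.1) 0 := by
  have h : 𝔄.jetData k (Quotient.out (s := 𝔄.jetSetoid k) (jetMk a)) = 𝔄.jetData k a :=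
    Quotient.mk_out (s := 𝔄.jetSetoid k) a
  refine iteratedDeriv_fibrePart_eq_of_jetData h ?_ j
  rwa [show ((Quotient.out (s := 𝔄.jetSetoid k) (jetMk a)).1 0).proj = (a.1 0).proj from
    congrArg Prod.fst h]

theorem proj_jetMk (h : l ≤ k) (a : 𝔄.AdmCurve k) :
    proj h (jetMk a) = jetMk ⟨a.1, a.2.of_le (Nat.sub_le_sub_right h 1)⟩ := rfl

theorem base_proj (h : l ≤ k) (A : 𝔄.Jet k) : base (proj h A) = base A := by
  obtain ⟨a, rfl⟩ := jetMk_surjective A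
  rfl

theorem coord_proj (h : l ≤ k) (A : 𝔄.Jet k) (hc : base A ∈ (trivializationAt F E c).baseSet)
    (j : Fin l) : coord c (proj h A) j = coord c A (Fin.castLE h j) := by
  obtain ⟨a, rfl⟩ := jetMk_surjective A
  rw [coord_jetMk a hc, proj_jetMk]
  exact coord_jetMk (k := l) _ hc j

variable [FiniteDimensional ℝ F]

theorem contDiffAt_rho_apply (hu : u ∈ 𝔄.dom c x₀ univ) (f : F) :
    ContDiffAt ℝ ∞ (fun q : B × F => 𝔄.rho c x₀ q.1 q.2) (u, f) := by
  have h : ContDiffAt ℝ ∞ (𝔄.rho c x₀) u := contDiffOn_rho.contDiffAt (dom_nhds hu)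
  exact (h.comp (u, f) contDiffAt_fst).clm_apply contDiffAt_snd

/-- Admissibility reads `x' = ρ(x) y`, so the derivatives of `x` are determined recursively by
`x(0)` and the derivatives of `y`. -/
theorem iteratedDeriv_basePart_congr {a b : ℝ → TotalSpace F E} {n : ℕ}
    (ha : 𝔄.AdmissibleAt n a 0) (hb : 𝔄.AdmissibleAt n b 0) (h0 : (a 0).proj = (b 0).proj)
    (hx : (a 0).proj ∈ (extChartAt 𝓘(ℝ, B) x₀).source)
    (hc : (a 0).proj ∈ (trivializationAt F E c).baseSet)
    (hfib : ∀ j ≤ n, iteratedDeriv j (fibrePart c a) 0 = iteratedDeriv j (fibrePart c b) 0)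
    {j : ℕ} (hj : j ≤ n) :
    iteratedDeriv j (basePart B x₀ a) 0 = iteratedDeriv j (basePart B x₀ b) 0 := by
  have key : ∀ {a : ℝ → TotalSpace F E} (_ : 𝔄.AdmissibleAt n a 0)
      (_ : (a 0).proj ∈ (extChartAt 𝓘(ℝ, B) x₀).source)
      (_ : (a 0).proj ∈ (trivializationAt F E c).baseSet),
      deriv (basePart B x₀ a) =ᶠ[𝓝 0] fun t => 𝔄.rho c x₀ (basePart B x₀ a t, fibrePart c a t).1
          (basePart B x₀ a t, fibrePart c a t).2 := by
    intro a ha hx hc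
    filter_upwards [ha.eventually_hasDerivAt hx hc] with t h1
    exact h1.deriv
  have ca := ha.contDiffAt_basePart hx
  have cb := hb.contDiffAt_basePart (h0 ▸ hx)
  have fa := ha.contDiffAt_fibrePart hc
  have fb := hb.contDiffAt_fibrePart (h0 ▸ hc)
  induction j using Nat.strong_induction_on with
  | _ j ih =>
    cases j with
    | zero => simp [basePart, h0]
    | succ j =>
      rw [iteratedDeriv_succ', iteratedDeriv_succ', (key ha hx hc).iteratedDeriv_eq j,
        (key hb (h0 ▸ hx) (h0 ▸ hc)).iteratedDeriv_eq j]
      have hle : ((j : ℕ) : WithTop ℕ∞) ≤ n := by exact_mod_cast (Nat.le_of_succ_le hj)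
      refine iteratedDeriv_comp_congr (n := j) (h := fun q : B × F => 𝔄.rho c x₀ q.1 q.2)
        ((contDiffAt_rho_apply (dom_subset_univ (mem_dom_basePart hx hc hc)) _).of_le
          (by exact_mod_cast le_top))
        ((ca.prodMk fa).of_le hle) ((cb.prodMk fb).of_le hle) (fun i hi => ?_) le_rfl
      rw [iteratedDeriv_prodMk ca fa (by omega), iteratedDeriv_prodMk cb fb (by omega),
        ih i (by omega) (by omega), hfib i (by omega)]

/-- The derivatives of the base part add no information for admissible curves; thus base point and
fibre coordinates are injective on jets. -/
theorem jet_ext {A A' : 𝔄.Jet k} (hb : base A = base A')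
    (hc : base A ∈ (trivializationAt F E c).baseSet) (h : coord c A = coord c A') : A = A' := by
  obtain ⟨a, rfl⟩ := jetMk_surjective A
  obtain ⟨b, rfl⟩ := jetMk_surjective A'
  have hb' : (a.1 0).proj = (b.1 0).proj := hb
  refine Quotient.sound (s := 𝔄.jetSetoid k) (?_ : 𝔄.jetData k a = 𝔄.jetData k b)
  refine Prod.ext hb' (funext fun j => ?_)
  have hfib : ∀ i ≤ (j : ℕ),
      iteratedDeriv i (fibrePart c a.1) 0 = iteratedDeriv i (fibrePart c b.1) 0 := fun i hi => by
    have h1 := congrFun h ⟨i, by omega⟩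
    rwa [coord_jetMk a hc, coord_jetMk b (hb' ▸ hc)] at h1
  have ha := a.2.of_le (show (j : ℕ) ≤ k - 1 by omega)
  have hb := b.2.of_le (show (j : ℕ) ≤ k - 1 by omega)
  have hbase : ∀ i ≤ (j : ℕ), iteratedDeriv i (basePart B (a.1 0).proj a.1) 0 =
      iteratedDeriv i (basePart B (a.1 0).proj b.1) 0 := fun i hi =>
    iteratedDeriv_basePart_congr ha hb hb' (mem_extChartAt_source _) hc hfib hi
  rw [jetData_snd, jetData_snd, ← hb', hbase j le_rfl,
    iteratedDeriv_fibrePart_congr ha hb hb' (mem_extChartAt_source _) hc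
    (mem_baseSet_trivializationAt F E _) hbase hfib le_rfl]

end JetCoordinates

/-! ### Curves of elements of the prolongation -/

/-- Time is adjoined as a coordinate with derivative `1`, which makes the equation autonomous; that
coordinate is then identified with `t`. -/
theorem exists_timeDependent_integralCurve {V : Type*} [NormedAddCommGroup V] [NormedSpace ℝ V]
    [CompleteSpace V] {O : Set V} (hO : IsOpen O) {X : ℝ × V → V}
    (hX : ContDiffOn ℝ ∞ X (univ ×ˢ O)) {p : V} (hp : p ∈ O) :
    ∃ α : ℝ → V, ∃ ε > 0, α 0 = p ∧ ContDiffOn ℝ ∞ α (Ioo (-ε) ε) ∧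
      ∀ t ∈ Ioo (-ε) ε, α t ∈ O ∧ HasDerivAt α (X (t, α t)) t := by
  obtain ⟨β, ε, hε, hβ0, hβs, hβ⟩ := exists_smooth_integralCurve (V := ℝ × V)
    (isOpen_univ.prod hO) (X := fun q => (1, X q)) (contDiffOn_const.prodMk hX)
    (p := (0, p)) ⟨trivial, hp⟩
  have h1 : ∀ t ∈ Ioo (-ε) ε, (β t).1 = t := by
    have hd : ∀ t ∈ Ioo (-ε) ε, HasDerivAt (fun t => (β t).1 - t) 0 t := fun t ht => by
      have h2 : HasDerivAt (fun t => (β t).1) 1 t := (hβ t ht).2.fst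
      have h3 := h2.sub (hasDerivAt_id' t)
      rwa [sub_self] at h3
    intro t ht
    have h0 : (0 : ℝ) ∈ Ioo (-ε) ε := ⟨by linarith, hε⟩
    have := isOpen_Ioo.is_const_of_deriv_eq_zero isPreconnected_Ioo
      (fun s hs => (hd s hs).differentiableAt.differentiableWithinAt)
      (fun s hs => (hd s hs).deriv) ht h0
    simp only [hβ0] at this
    linarith
  refine ⟨fun t => (β t).2, ε, hε, by simp [hβ0], contDiff_snd.comp_contDiffOn hβs,
    fun t ht => ⟨(hβ t ht).1.2, ?_⟩⟩
  have := (hβ t ht).2.snd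
  rwa [show β t = (t, (β t).2) from Prod.ext (h1 t ht) rfl] at this

/-- In the trivialization `e_c` and the chart at `x₀`: a smooth admissible curve `(x, y)`, and a
smooth curve `(w, ζ)` of components of a variation of it which is induced by a variation in `E`. -/
structure CurvePair (𝔄 : LieAlgebroid B F E) [FiniteDimensional ℝ F] (c x₀ : M) where
  I : Set ℝ
  isOpen : IsOpen I
  x : ℝ → B
  y : ℝ → F
  w : ℝ → F
  ζ : ℝ → F
  x_smooth : ContDiffOn ℝ ∞ x I
  y_smooth : ContDiffOn ℝ ∞ y I
  w_smooth : ContDiffOn ℝ ∞ w I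
  ζ_smooth : ContDiffOn ℝ ∞ ζ I
  mem : ∀ t ∈ I, x t ∈ 𝔄.dom c x₀ univ
  x_deriv : ∀ t ∈ I, HasDerivAt x (𝔄.rho c x₀ (x t) (y t)) t
  w_deriv : ∀ t ∈ I, HasDerivAt w (ζ t - 𝔄.locStr c x₀ (x t) (y t) (w t)) t

namespace CurvePair

variable {𝔄} [FiniteDimensional ℝ F] {c x₀ : M} (P : CurvePair 𝔄 c x₀) {t : ℝ} {k : ℕ}

/-- The coordinates of the jets of the curve. -/
def ξ (k : ℕ) (t : ℝ) : B × (Fin k → F) := (P.x t, fun j => iteratedDeriv j P.y t)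

/-- The components of the variation of the jets of the curve. -/
def Z (k : ℕ) (t : ℝ) : ETangent F k := Fin.cons (P.w t) (fun j => iteratedDeriv j P.ζ t)

/-- The underlying admissible curve. -/
def curve : ℝ → TotalSpace F E := 𝔄.curveOf c x₀ P.x P.y

theorem admissible (ht : t ∈ P.I) (n : ℕ) : 𝔄.AdmissibleAt n P.curve t := by
  have hI := P.isOpen.mem_nhds ht
  refine admissibleAt_curveOf (P.mem t ht) ((P.x_smooth.contDiffAt hI).of_le ?_)
    ((P.y_smooth.contDiffAt hI).of_le ?_) ?_
  · exact_mod_cast le_top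
  · exact_mod_cast le_top
  · filter_upwards [hI] with s hs using P.x_deriv s hs

theorem base_curve (t : ℝ) : (P.curve t).proj = (extChartAt 𝓘(ℝ, B) x₀).symm (P.x t) := rfl

theorem fibrePart_curve (ht : t ∈ P.I) : fibrePart c P.curve t = P.y t := by
  rw [fibrePart, curve, curveOf, ← Trivialization.continuousLinearMapAt_apply_of_mem ℝ _
    (P.mem t ht).2.1, Trivialization.continuousLinearMapAt_symmL _ (P.mem t ht).2.1]

theorem basePart_curve (ht : t ∈ P.I) : basePart B x₀ P.curve t = P.x t :=
  (extChartAt 𝓘(ℝ, B) x₀).right_inv (P.mem t ht).1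

/-- Curve pairs pass through every point and every vector. -/
theorem exists_through [FiniteDimensional ℝ B] [T2Space M] {c x₀ : M}
    (k : ℕ) {p : B × (Fin k → F)} (hp : p.1 ∈ 𝔄.dom c x₀ univ) (z : ETangent F k) :
    ∃ P : CurvePair 𝔄 c x₀, 0 ∈ P.I ∧ P.ξ k 0 = p ∧ P.Z k 0 = z := by
  have := FiniteDimensional.complete ℝ B
  have := FiniteDimensional.complete ℝ F
  obtain ⟨f, hf, hfv⟩ := exists_iteratedDeriv_eq k
    (fun j => if h : j < k then p.2 ⟨j, h⟩ else 0)
  obtain ⟨g, hg, hgv⟩ := exists_iteratedDeriv_eq k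
    (fun j => if h : j < k then z (Fin.succ ⟨j, h⟩) else 0)
  -- The curves `y = f` and `ζ = g` are prescribed by their jets; the pair `(x, w)` solves the
  -- resulting differential equation with the given initial values.
  obtain ⟨α, ε, hε, h0, hαs, hα⟩ := exists_timeDependent_integralCurve (V := B × F)
    (O := 𝔄.dom c x₀ univ ×ˢ univ) ((isOpen_dom isOpen_univ).prod isOpen_univ)
    (X := fun q => (𝔄.rho c x₀ q.2.1 (f q.1),
      g q.1 - 𝔄.locStr c x₀ q.2.1 (f q.1) q.2.2)) (by
      have h1 : ContDiffOn ℝ ∞ (fun q : ℝ × (B × F) => q.2.1)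
        (univ ×ˢ (𝔄.dom c x₀ univ ×ˢ (univ : Set F))) := by fun_prop
      have hm : MapsTo (fun q : ℝ × (B × F) => q.2.1)
        (univ ×ˢ (𝔄.dom c x₀ univ ×ˢ (univ : Set F))) (𝔄.dom c x₀ univ) := fun q hq => hq.2.1
      have hr := contDiffOn_rho.comp h1 hm
      have hl := contDiffOn_locStr.comp h1 hm
      have hf' : ContDiffOn ℝ ∞ (fun q : ℝ × (B × F) => f q.1)
        (univ ×ˢ (𝔄.dom c x₀ univ ×ˢ (univ : Set F))) := (hf.comp contDiff_fst).contDiffOn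
      have hg' : ContDiffOn ℝ ∞ (fun q : ℝ × (B × F) => g q.1)
        (univ ×ˢ (𝔄.dom c x₀ univ ×ˢ (univ : Set F))) := (hg.comp contDiff_fst).contDiffOn
      exact (hr.clm_apply hf').prodMk (hg'.sub ((hl.clm_apply hf').clm_apply
        (contDiff_snd.comp contDiff_snd).contDiffOn)))
    (p := (p.1, z 0)) ⟨hp, trivial⟩
  refine ⟨⟨Ioo (-ε) ε, isOpen_Ioo, fun t => (α t).1, f, fun t => (α t).2, g,
    contDiff_fst.comp_contDiffOn hαs, hf.contDiffOn, contDiff_snd.comp_contDiffOn hαs,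
    hg.contDiffOn, fun t ht => (hα t ht).1.1, fun t ht => (hα t ht).2.fst,
    fun t ht => (hα t ht).2.snd⟩, ⟨by simpa using hε, hε⟩, ?_, ?_⟩
  · refine Prod.ext ?_ (funext fun j => ?_)
    · simp [ξ, h0]
    · simp [ξ, hfv j j.2]
  · refine funext fun j => Fin.cases ?_ (fun j => ?_) j
    · simp [Z, h0]
    · simp [Z, hgv j j.2]

end CurvePair

/-! ### Jets with prescribed coordinates -/

section JetOfCoordinates

variable {𝔄} [FiniteDimensional ℝ F] {c c' x₀ : M} {k l : ℕ}

theorem nonempty_jet (𝔄 : LieAlgebroid B F E) (x₀ : M) (k : ℕ) : Nonempty (𝔄.Jet k) := by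
  have hx : extChartAt 𝓘(ℝ, B) x₀ x₀ ∈ 𝔄.dom x₀ x₀ univ :=
    mem_dom_of_mem (mem_extChartAt_source _) (mem_baseSet_trivializationAt F E _) trivial
  exact ⟨jetMk ⟨_, admissibleAt_curveOf (n := k - 1) (c := x₀) (x₀ := x₀) (t := 0)
    (x := fun _ => extChartAt 𝓘(ℝ, B) x₀ x₀) (y := fun _ => 0) hx contDiffAt_const contDiffAt_const
    (Eventually.of_forall fun s => by simpa using hasDerivAt_const s _)⟩⟩

/-- The jet with given coordinates in the trivialization `e_c` and the chart at `x₀`. -/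
def jetOf (𝔄 : LieAlgebroid B F E) {k : ℕ} (c x₀ : M) (p : B × (Fin k → F)) : 𝔄.Jet k :=
  @Classical.epsilon _ (nonempty_jet 𝔄 x₀ k)
    fun A => base A = (extChartAt 𝓘(ℝ, B) x₀).symm p.1 ∧ coord c A = p.2

theorem CurvePair.exists_jet_eq (P : CurvePair 𝔄 c x₀) {t : ℝ} (ht : t ∈ P.I) (k : ℕ) :
    base (𝔄.jet k P.curve t (P.admissible ht _)) = (extChartAt 𝓘(ℝ, B) x₀).symm (P.ξ k t).1 ∧
      coord c (𝔄.jet k P.curve t (P.admissible ht _)) = (P.ξ k t).2 := by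
  have hb : (P.curve (t + 0)).proj = (extChartAt 𝓘(ℝ, B) x₀).symm (P.x t) := by
    rw [add_zero, base_curve]
  refine ⟨hb, funext fun j => ?_⟩
  refine (coord_jetMk (c := c) ⟨fun s => P.curve (t + s), (P.admissible ht _).translate⟩
    (by rw [hb]; exact (P.mem t ht).2.1) j).trans ?_
  have h1 : fibrePart c (fun s => P.curve (t + s)) = fun s => fibrePart c P.curve (t + s) := rfl
  rw [h1, iteratedDeriv_comp_const_add]
  simp only [add_zero]
  have he : fibrePart c P.curve =ᶠ[𝓝 t] P.y := by
    filter_upwards [P.isOpen.mem_nhds ht] with s hs using P.fibrePart_curve hs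
  exact he.iteratedDeriv_eq j

variable [FiniteDimensional ℝ B] [T2Space M]

theorem jetOf_spec {p : B × (Fin k → F)} (hp : p.1 ∈ 𝔄.dom c x₀ univ) :
    base (𝔄.jetOf c x₀ p) = (extChartAt 𝓘(ℝ, B) x₀).symm p.1 ∧ coord c (𝔄.jetOf c x₀ p) = p.2 := by
  obtain ⟨P, h0, hξ, -⟩ := CurvePair.exists_through k hp 0
  exact @Classical.epsilon_spec _ (fun A : 𝔄.Jet k => base A = (extChartAt 𝓘(ℝ, B) x₀).symm p.1 ∧
    coord c A = p.2) ⟨_, hξ ▸ P.exists_jet_eq h0 k⟩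

theorem base_jetOf {p : B × (Fin k → F)} (hp : p.1 ∈ 𝔄.dom c x₀ univ) :
    base (𝔄.jetOf c x₀ p) = (extChartAt 𝓘(ℝ, B) x₀).symm p.1 := (jetOf_spec hp).1

theorem coord_jetOf {p : B × (Fin k → F)} (hp : p.1 ∈ 𝔄.dom c x₀ univ) :
    coord c (𝔄.jetOf c x₀ p) = p.2 := (jetOf_spec hp).2

theorem eq_jetOf {p : B × (Fin k → F)} (hp : p.1 ∈ 𝔄.dom c x₀ univ) {A : 𝔄.Jet k}
    (hb : base A = (extChartAt 𝓘(ℝ, B) x₀).symm p.1) (hA : coord c A = p.2) :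
    A = 𝔄.jetOf c x₀ p :=
  jet_ext (c := c) (by rw [hb, base_jetOf hp]) (by rw [hb]; exact hp.2.1) (by rw [hA, coord_jetOf hp])

theorem jetOf_coord {A : 𝔄.Jet k} (hx : base A ∈ (extChartAt 𝓘(ℝ, B) x₀).source)
    (hc : base A ∈ (trivializationAt F E c).baseSet) :
    𝔄.jetOf c x₀ (extChartAt 𝓘(ℝ, B) x₀ (base A), coord c A) = A :=
  (eq_jetOf (mem_dom_of_mem hx hc (mem_univ _)) ((extChartAt 𝓘(ℝ, B) x₀).left_inv hx).symm rfl).symm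

theorem proj_jetOf (h : l ≤ k) {p : B × (Fin k → F)} (hp : p.1 ∈ 𝔄.dom c x₀ univ) :
    proj h (𝔄.jetOf c x₀ p) = 𝔄.jetOf c x₀ (p.1, fun j => p.2 (Fin.castLE h j)) := by
  refine eq_jetOf (p := (p.1, fun j => p.2 (Fin.castLE h j))) hp
    (by rw [base_proj, base_jetOf hp]) (funext fun j => ?_)
  rw [coord_proj h _ (by rw [base_jetOf hp]; exact hp.2.1), coord_jetOf hp]

/-- Jets of an admissible curve in coordinates. -/
theorem jet_eq_jetOf {a : ℝ → TotalSpace F E} {t : ℝ} (ha : 𝔄.AdmissibleAt (k - 1) a t)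
    (hx : (a t).proj ∈ (extChartAt 𝓘(ℝ, B) x₀).source)
    (hc : (a t).proj ∈ (trivializationAt F E c).baseSet) :
    𝔄.jet k a t ha = 𝔄.jetOf c x₀ (basePart B x₀ a t, fun j => iteratedDeriv j (fibrePart c a) t) := by
  have hb : base (𝔄.jet k a t ha) = (a t).proj := by
    change (a (t + 0)).proj = _
    rw [add_zero]
  refine eq_jetOf (mem_dom_of_mem hx hc (mem_univ _)) ?_ (funext fun j => ?_)
  · rw [hb]
    exact ((extChartAt 𝓘(ℝ, B) x₀).left_inv hx).symm
  · refine (coord_jetMk (c := c) ⟨fun s => a (t + s), ha.translate⟩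
      (by simpa using hc) j).trans ?_
    have h1 : fibrePart c (fun s => a (t + s)) = fun s => fibrePart c a (t + s) := rfl
    rw [h1, iteratedDeriv_comp_const_add]
    simp

theorem CurvePair.jet_eq (P : CurvePair 𝔄 c x₀) {t : ℝ} (ht : t ∈ P.I) (k : ℕ) :
    𝔄.jet k P.curve t (P.admissible ht _) = 𝔄.jetOf c x₀ (P.ξ k t) :=
  eq_jetOf (P.mem t ht) (P.exists_jet_eq ht k).1 (P.exists_jet_eq ht k).2

theorem exists_jetOf_eq (A : 𝔄.Jet k) :
    ∃ p : B × (Fin k → F), p.1 ∈ 𝔄.dom (base A) (base A) univ ∧ 𝔄.jetOf (base A) (base A) p = A :=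
  ⟨_, mem_dom_of_mem (mem_extChartAt_source _) (mem_baseSet_trivializationAt F E _) (mem_univ _),
    jetOf_coord (mem_extChartAt_source _) (mem_baseSet_trivializationAt F E _)⟩

end JetOfCoordinates


/-! ### Functions on jet spaces in coordinates -/

section Functions

variable {𝔄} {c c' x₀ : M} {k l : ℕ} {O O' : Set M} {u : B}
  {V : Type*} [NormedAddCommGroup V] [NormedSpace ℝ V]

/-- The projection `τ_{k,l}` in coordinates. -/
def trunc (B F : Type*) [NormedAddCommGroup B] [NormedSpace ℝ B] [NormedAddCommGroup F]
    [NormedSpace ℝ F] {k l : ℕ} (h : l ≤ k) : B × (Fin k → F) →L[ℝ] B × (Fin l → F) :=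
  (ContinuousLinearMap.fst ℝ B (Fin k → F)).prod (ContinuousLinearMap.pi fun j : Fin l =>
    (ContinuousLinearMap.proj (φ := fun _ : Fin k => F) (Fin.castLE h j)).comp
      (ContinuousLinearMap.snd ℝ B (Fin k → F)))

/-- The projection `𝒯τ_{k,l}` in components. -/
def cut (F : Type*) [NormedAddCommGroup F] [NormedSpace ℝ F] {k l : ℕ} (h : l ≤ k) :
    ETangent F k →L[ℝ] ETangent F l :=
  ContinuousLinearMap.pi fun r : Fin (l + 1) =>
    ContinuousLinearMap.proj (φ := fun _ : Fin (k + 1) => F) (Fin.castLE (Nat.succ_le_succ h) r)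

variable (𝔄) in
/-- The anchor of `𝒯^E E^k` in coordinates. -/
def vvec (c x₀ : M) (u : B) : ETangent F k →L[ℝ] B × (Fin k → F) :=
  ((𝔄.rho c x₀ u).comp (ContinuousLinearMap.proj 0)).prod
    (ContinuousLinearMap.pi fun r : Fin k => ContinuousLinearMap.proj r.succ)

theorem trunc_vvec (h : l ≤ k) (z : ETangent F k) :
    trunc B F h (𝔄.vvec c x₀ u z) = 𝔄.vvec c x₀ u (cut F h z) := rfl

/-- The total time derivative in coordinates. -/
def totD (𝔄 : LieAlgebroid B F E) (c x₀ : M) (Ψ : B × (Fin k → F) → V)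
    (p : B × (Fin (k + 1) → F)) : V :=
  fderiv ℝ Ψ (trunc B F (Nat.le_succ k) p) (𝔄.vvec c x₀ p.1 p.2)

variable [FiniteDimensional ℝ F]

/-- Smoothness, over the part `O` of the base, of a function on `E^k`. -/
def SmOn (O : Set M) (Φ : 𝔄.Jet k → V) : Prop :=
  ∀ c x₀ : M, ContDiffOn ℝ ∞ (fun p => Φ (𝔄.jetOf c x₀ p)) (𝔄.dom c x₀ O ×ˢ univ)

theorem SmOn.contDiffAt {Φ : 𝔄.Jet k → V} (h : SmOn O Φ) (hO : IsOpen O) {p : B × (Fin k → F)}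
    (hp : p.1 ∈ 𝔄.dom c x₀ O) : ContDiffAt ℝ ∞ (fun p => Φ (𝔄.jetOf c x₀ p)) p :=
  (h c x₀).contDiffAt (((isOpen_dom hO).prod isOpen_univ).mem_nhds ⟨hp, trivial⟩)

theorem SmOn.differentiableAt {Φ : 𝔄.Jet k → V} (h : SmOn O Φ) (hO : IsOpen O)
    {p : B × (Fin k → F)} (hp : p.1 ∈ 𝔄.dom c x₀ O) :
    DifferentiableAt ℝ (fun p => Φ (𝔄.jetOf c x₀ p)) p :=
  (h.contDiffAt hO hp).differentiableAt (by simp)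

/-- `Function.extend` returns the expected value because the coordinates are injective, by
`jet_ext`. -/
theorem localRep_coord (Φ : 𝔄.Jet k → V) {A : 𝔄.Jet k}
    (hA : base A ∈ (trivializationAt F E c).baseSet) :
    localRep c Φ (base A, coord c A) = Φ A := by
  have hinj : Function.Injective
      (fun A : {A : 𝔄.Jet k // base A ∈ (trivializationAt F E c).baseSet} =>
        (base A.1, coord c A.1)) := fun A A' h =>
    Subtype.ext (jet_ext (congrArg Prod.fst h) A.2 (congrArg Prod.snd h))
  exact hinj.extend_apply (fun A => Φ A.1) 0 ⟨A, hA⟩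

theorem contDiffOn_vvec : ContDiffOn ℝ ∞ (𝔄.vvec (k := k) c x₀) (𝔄.dom c x₀ univ) := by
  rw [contDiffOn_clm_apply]
  intro z
  exact (contDiffOn_rho.clm_apply contDiffOn_const).prodMk contDiffOn_const

theorem contDiffOn_totD (hO : IsOpen O) {Ψ : B × (Fin k → F) → V}
    (hΨ : ContDiffOn ℝ ∞ Ψ (𝔄.dom c x₀ O ×ˢ univ)) :
    ContDiffOn ℝ ∞ (𝔄.totD c x₀ Ψ) (𝔄.dom c x₀ O ×ˢ univ) := by
  have h1 := hΨ.fderiv_of_isOpen (m := ∞) ((isOpen_dom hO).prod isOpen_univ) (by simp)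
  refine (h1.comp (trunc B F (Nat.le_succ k)).contDiff.contDiffOn
    (fun p hp => ⟨hp.1, trivial⟩)).clm_apply ?_
  exact (contDiffOn_vvec.comp contDiff_fst.contDiffOn
    (fun p hp => dom_subset_univ hp.1)).clm_apply contDiff_snd.contDiffOn

variable [FiniteDimensional ℝ B] [T2Space M]

theorem localRep_jetOf (Φ : 𝔄.Jet k → V) {p : B × (Fin k → F)} (hp : p.1 ∈ 𝔄.dom c x₀ univ) :
    localRep c Φ ((extChartAt 𝓘(ℝ, B) x₀).symm p.1, p.2) = Φ (𝔄.jetOf c x₀ p) := by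
  rw [← localRep_coord (c := c) Φ (by rw [base_jetOf hp]; exact hp.2.1), base_jetOf hp,
    coord_jetOf hp]

theorem IsSmooth.smOn {Φ : 𝔄.Jet k → ℝ} (h : IsSmooth Φ) : SmOn univ Φ := fun c x₀ => by
  rw [← contMDiffOn_iff_contDiffOn]
  have hs : ContMDiffOn 𝓘(ℝ, B × (Fin k → F)) (𝓘(ℝ, B).prod 𝓘(ℝ, Fin k → F)) ∞
      (fun p : B × (Fin k → F) => ((extChartAt 𝓘(ℝ, B) x₀).symm p.1, p.2))
      (𝔄.dom c x₀ univ ×ˢ univ) := by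
    refine ContMDiffOn.prodMk ((contMDiffOn_extChartAt_symm x₀).comp
      contDiff_fst.contMDiff.contMDiffOn fun p hp => hp.1.1) contDiff_snd.contMDiff.contMDiffOn
  refine ((h c).comp hs fun p hp => ⟨hp.1.2.1, trivial⟩).congr fun p hp => ?_
  exact (localRep_jetOf Φ hp.1).symm

theorem eventually_localRep_eq (Φ : 𝔄.Jet k → V) {q : M × (Fin k → F)}
    (hx : q.1 ∈ (extChartAt 𝓘(ℝ, B) x₀).source)
    (hc : q.1 ∈ (trivializationAt F E c).baseSet) :
    localRep c Φ =ᶠ[𝓝 q] fun q => Φ (𝔄.jetOf c x₀ (extChartAt 𝓘(ℝ, B) x₀ q.1, q.2)) := by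
  filter_upwards [continuousAt_fst.preimage_mem_nhds ((isOpen_extChartAt_source x₀).mem_nhds hx),
    continuousAt_fst.preimage_mem_nhds ((trivializationAt F E c).open_baseSet.mem_nhds hc)]
    with r h1 h2
  rw [← localRep_jetOf Φ (mem_dom_of_mem h1 h2 (mem_univ _)),
    (extChartAt 𝓘(ℝ, B) x₀).left_inv h1]

theorem SmOn.isSmooth {Φ : 𝔄.Jet k → ℝ} (h : SmOn univ Φ) : IsSmooth Φ := by
  intro c q hq
  have hs : ContMDiffAt (𝓘(ℝ, B).prod 𝓘(ℝ, Fin k → F)) 𝓘(ℝ, B × (Fin k → F)) ∞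
      (fun r : M × (Fin k → F) => (extChartAt 𝓘(ℝ, B) q.1 r.1, r.2)) q :=
    (contMDiffAt_extChartAt.comp q contMDiffAt_fst).prodMk_space contMDiffAt_snd
  have hd := h.contDiffAt isOpen_univ (c := c) (x₀ := q.1) (p := (extChartAt 𝓘(ℝ, B) q.1 q.1, q.2))
    (mem_dom_of_mem (mem_extChartAt_source _) hq.1 (mem_univ _))
  exact ((hd.contMDiffAt.comp q hs).congr_of_eventuallyEq (eventually_localRep_eq Φ
    (mem_extChartAt_source _) hq.1)).contMDiffWithinAt

/-- The bridge from manifold derivatives to `fderiv`: all later computations take place in a chart.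
-/
theorem along_jetOf {Φ : 𝔄.Jet k → V} {p : B × (Fin k → F)} (hp : p.1 ∈ 𝔄.dom c x₀ univ)
    (hΦ : DifferentiableAt ℝ (fun p => Φ (𝔄.jetOf c x₀ p)) p) (z : ETangent F k) :
    along c Φ (𝔄.jetOf c x₀ p) z =
      fderiv ℝ (fun p => Φ (𝔄.jetOf c x₀ p)) p (𝔄.vvec c x₀ p.1 z) := by
  set x := (extChartAt 𝓘(ℝ, B) x₀).symm p.1 with hxd
  have hx : x ∈ (extChartAt 𝓘(ℝ, B) x₀).source := (extChartAt 𝓘(ℝ, B) x₀).map_target hp.1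
  have hr : extChartAt 𝓘(ℝ, B) x₀ x = p.1 := (extChartAt 𝓘(ℝ, B) x₀).right_inv hp.1
  have h1 : HasMFDerivAt (𝓘(ℝ, B).prod 𝓘(ℝ, Fin k → F)) 𝓘(ℝ, B × (Fin k → F))
      (fun q : M × (Fin k → F) => (extChartAt 𝓘(ℝ, B) x₀ q.1, q.2)) (x, p.2)
      (((chartDeriv x₀ x).comp (ContinuousLinearMap.fst ℝ _ _)).prod
        (ContinuousLinearMap.snd ℝ (TangentSpace 𝓘(ℝ, B) x) (Fin k → F))) := by
    have hf := ((mdifferentiableAt_extChartAt (I := 𝓘(ℝ, B)) (x := x₀) (y := x)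
      (by simpa using hx)).hasMFDerivAt).comp (x, p.2) (hasMFDerivAt_fst (I' := 𝓘(ℝ, Fin k → F))
        ((x, p.2) : M × (Fin k → F)))
    have hg := hasMFDerivAt_snd (I := 𝓘(ℝ, B)) (I' := 𝓘(ℝ, Fin k → F))
      ((x, p.2) : M × (Fin k → F))
    exact ⟨hf.1.prodMk hg.1, hf.2.prodMk hg.2⟩
  have h2 : HasFDerivAt (fun p => Φ (𝔄.jetOf c x₀ p))
      (fderiv ℝ (fun p => Φ (𝔄.jetOf c x₀ p)) p) (extChartAt 𝓘(ℝ, B) x₀ x, p.2) := by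
    rw [hr]; exact hΦ.hasFDerivAt
  have h3 := (HasMFDerivAt.comp (x, p.2) h2.hasMFDerivAt h1).congr_of_eventuallyEq
    (eventually_localRep_eq Φ (q := (x, p.2)) hx hp.2.1)
  have h4 := h3.mfderiv
  simp only [along]
  rw [base_jetOf hp, coord_jetOf hp]
  erw [h4]
  rfl

end Functions


/-! ### Total derivatives of functions and change of trivialization of curves -/

section TotalDerivative

variable {𝔄} [FiniteDimensional ℝ F] {c c' x₀ : M} {k l : ℕ} {O O' : Set M} {u : B} {t : ℝ}
  {V : Type*} [NormedAddCommGroup V] [NormedSpace ℝ V]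

namespace CurvePair

variable (P : CurvePair 𝔄 c x₀)

theorem trunc_ξ (h : l ≤ k) (t : ℝ) : trunc B F h (P.ξ k t) = P.ξ l t := rfl

theorem cut_Z (h : l ≤ k) (t : ℝ) : cut F h (P.Z k t) = P.Z l t := by
  funext r
  refine Fin.cases rfl (fun j => rfl) r

theorem hasDerivAt_ξ (ht : t ∈ P.I) (k : ℕ) :
    HasDerivAt (P.ξ k) (𝔄.vvec c x₀ (P.ξ (k + 1) t).1 (P.ξ (k + 1) t).2) t := by
  refine (P.x_deriv t ht).prodMk (hasDerivAt_pi.2 fun j => ?_)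
  exact hasDerivAt_iteratedDeriv P.isOpen P.y_smooth j ht

theorem contDiffOn_ξ (k : ℕ) : ContDiffOn ℝ ∞ (P.ξ k) P.I :=
  P.x_smooth.prodMk (contDiffOn_pi.2 fun j => contDiffOn_iteratedDeriv P.isOpen P.y_smooth j)

theorem contDiffOn_Z (k : ℕ) : ContDiffOn ℝ ∞ (P.Z k) P.I :=
  contDiffOn_pi.2 fun j => Fin.cases P.w_smooth
    (fun j => contDiffOn_iteratedDeriv P.isOpen P.ζ_smooth j) j

theorem hasDerivAt_comp_ξ {Ψ : B × (Fin k → F) → V} (ht : t ∈ P.I)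
    (hΨ : DifferentiableAt ℝ Ψ (P.ξ k t)) :
    HasDerivAt (fun s => Ψ (P.ξ k s)) (𝔄.totD c x₀ Ψ (P.ξ (k + 1) t)) t :=
  hΨ.hasFDerivAt.comp_hasDerivAt t (P.hasDerivAt_ξ ht k)

variable [FiniteDimensional ℝ B] [T2Space M]

/-- The commutation of the total time derivative with the derivative along the variation. -/
theorem hasDerivAt_fderiv (hO : IsOpen O) {Ψ : B × (Fin k → F) → V} (ht : t ∈ P.I)
    (hP : P.x t ∈ 𝔄.dom c x₀ O) (hΨ : ContDiffOn ℝ ∞ Ψ (𝔄.dom c x₀ O ×ˢ univ)) :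
    HasDerivAt (fun s => fderiv ℝ Ψ (P.ξ k s) (𝔄.vvec c x₀ (P.x s) (P.Z k s)))
      (fderiv ℝ (𝔄.totD c x₀ Ψ) (P.ξ (k + 1) t) (𝔄.vvec c x₀ (P.x t) (P.Z (k + 1) t))) t := by
  have hu : P.x t ∈ 𝔄.dom c x₀ univ := P.mem t ht
  have hopen := (isOpen_dom (c := c) (x₀ := x₀) (𝔄 := 𝔄) hO).prod (isOpen_univ (X := Fin k → F))
  have hΨt : ContDiffAt ℝ ∞ Ψ (P.ξ k t) := hΨ.contDiffAt (hopen.mem_nhds ⟨hP, trivial⟩)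
  have hD : HasFDerivAt (fderiv ℝ Ψ) (fderiv ℝ (fderiv ℝ Ψ) (P.ξ k t)) (P.ξ k t) :=
    ((hΨt.fderiv_right (m := ∞) (by simp)).differentiableAt (by simp)).hasFDerivAt
  -- Both orders of differentiation produce the second derivative of `Ψ` in the directions of the
  -- curve and of the variation; symmetry identifies the two.
  have hsymm : IsSymmSndFDerivAt ℝ Ψ (P.ξ k t) :=
    hΨt.isSymmSndFDerivAt (by
      rw [minSmoothness_of_isRCLikeNormedField]
      exact WithTop.coe_le_coe.2 (le_top : (2 : ℕ∞) ≤ ⊤))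
  have hρ : HasFDerivAt (𝔄.rho c x₀) (fderiv ℝ (𝔄.rho c x₀) (P.x t)) (P.x t) :=
    ((contDiffOn_rho.contDiffAt (dom_nhds hu)).differentiableAt (by simp)).hasFDerivAt
  have hV : HasDerivAt (fun s => 𝔄.vvec c x₀ (P.x s) (P.Z k s))
      (fderiv ℝ (𝔄.rho c x₀) (P.x t) (𝔄.rho c x₀ (P.x t) (P.y t)) (P.w t) +
        𝔄.rho c x₀ (P.x t) (P.ζ t - 𝔄.locStr c x₀ (P.x t) (P.y t) (P.w t)),
        fun r : Fin k => iteratedDeriv (r + 1) P.ζ t) t := by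
    refine HasDerivAt.prodMk ?_ (hasDerivAt_pi.2 fun j => ?_)
    · exact (hρ.comp_hasDerivAt t (P.x_deriv t ht)).clm_apply (P.w_deriv t ht)
    · exact hasDerivAt_iteratedDeriv P.isOpen P.ζ_smooth j ht
  have hL := (hD.comp_hasDerivAt t (P.hasDerivAt_ξ ht k)).clm_apply hV
  refine hL.congr_deriv ?_
  have hT : HasFDerivAt (trunc B F (Nat.le_succ k)) (trunc B F (Nat.le_succ k))
    (P.ξ (k + 1) t) := ContinuousLinearMap.hasFDerivAt _
  have h1 : HasFDerivAt (fun p : B × (Fin (k + 1) → F) => fderiv ℝ Ψ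
      (trunc B F (Nat.le_succ k) p)) ((fderiv ℝ (fderiv ℝ Ψ) (P.ξ k t)).comp
        (trunc B F (Nat.le_succ k))) (P.ξ (k + 1) t) :=
    HasFDerivAt.comp (P.ξ (k + 1) t) hD hT
  have h2 : HasFDerivAt (fun p : B × (Fin (k + 1) → F) => 𝔄.vvec (k := k) c x₀ p.1 p.2)
      (((fderiv ℝ (𝔄.rho c x₀) (P.x t)).flip (P.y t) ∘L (ContinuousLinearMap.fst ℝ _ _) +
        𝔄.rho c x₀ (P.x t) ∘L ((ContinuousLinearMap.proj 0 : (Fin (k + 1) → F) →L[ℝ] F) ∘L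
          ContinuousLinearMap.snd ℝ _ _)).prod (ContinuousLinearMap.pi fun r : Fin k =>
        (ContinuousLinearMap.proj r.succ : (Fin (k + 1) → F) →L[ℝ] F) ∘L
          ContinuousLinearMap.snd ℝ B _)) (P.ξ (k + 1) t) := by
    refine HasFDerivAt.prodMk ?_ (ContinuousLinearMap.hasFDerivAt
      (ContinuousLinearMap.pi fun r : Fin k =>
        (ContinuousLinearMap.proj r.succ : (Fin (k + 1) → F) →L[ℝ] F) ∘L
          ContinuousLinearMap.snd ℝ B _))
    have h3 : HasFDerivAt (fun p : B × (Fin (k + 1) → F) => 𝔄.rho c x₀ p.1)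
        ((fderiv ℝ (𝔄.rho c x₀) (P.x t)).comp (ContinuousLinearMap.fst ℝ _ _)) (P.ξ (k + 1) t) :=
      HasFDerivAt.comp (g := 𝔄.rho c x₀) (f := Prod.fst) (P.ξ (k + 1) t) hρ hasFDerivAt_fst
    refine (h3.clm_apply (ContinuousLinearMap.hasFDerivAt ((ContinuousLinearMap.proj 0 :
      (Fin (k + 1) → F) →L[ℝ] F) ∘L ContinuousLinearMap.snd ℝ B _))).congr_fderiv ?_
    ext q <;> simp [ξ]
  have h4 : fderiv ℝ (𝔄.totD c x₀ Ψ) (P.ξ (k + 1) t) = _ := (h1.clm_apply h2).fderiv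
  rw [h4]
  have h5 := hsymm (𝔄.vvec c x₀ (P.x t) (P.Z k t))
    (𝔄.vvec c x₀ (P.ξ (k + 1) t).1 (P.ξ (k + 1) t).2)
  have h6 : trunc B F (Nat.le_succ k) (𝔄.vvec c x₀ (P.x t) (P.Z (k + 1) t)) =
    𝔄.vvec c x₀ (P.x t) (P.Z k t) := by rw [trunc_vvec, cut_Z]
  simp only [add_apply, ContinuousLinearMap.comp_apply,
    ContinuousLinearMap.flip_apply, h6, h5, trunc_ξ]
  rw [add_comm]
  congr 1
  congr 1
  refine Prod.ext ?_ rfl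
  simp only [ContinuousLinearMap.prod_apply, add_apply,
    ContinuousLinearMap.comp_apply, ContinuousLinearMap.flip_apply]
  change fderiv ℝ (𝔄.rho c x₀) (P.x t) (𝔄.rho c x₀ (P.x t) (P.y t)) (P.w t) +
    𝔄.rho c x₀ (P.x t) (P.ζ t - 𝔄.locStr c x₀ (P.x t) (P.y t) (P.w t)) =
    fderiv ℝ (𝔄.rho c x₀) (P.x t) (𝔄.rho c x₀ (P.x t) (P.w t)) (P.y t) +
    𝔄.rho c x₀ (P.x t) (iteratedDeriv 0 P.ζ t)
  -- The remaining first-order terms differ only in the base component. The bracket term in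
  -- `w_deriv` is exactly what the homomorphism property of the anchor cancels.
  rw [map_sub, rho_locStr hu, iteratedDeriv_zero]
  abel

/-- The expression of a curve pair in another trivialization. -/
def gaugeChange (c' : M) : CurvePair 𝔄 c' x₀ where
  I := P.I ∩ P.x ⁻¹' 𝔄.dom c x₀ (trivializationAt F E c').baseSet
  isOpen := P.x_smooth.continuousOn.isOpen_inter_preimage P.isOpen
    (isOpen_dom (trivializationAt F E c').open_baseSet)
  x := P.x
  y := fun t => 𝔄.gauge c c' x₀ (P.x t) (P.y t)
  w := fun t => 𝔄.gauge c c' x₀ (P.x t) (P.w t)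
  -- The derivative of `(x, y) ↦ gauge x y` along the variation `(ρ(w), ζ)`.
  ζ := fun t => 𝔄.gauge c c' x₀ (P.x t) (P.ζ t) +
    fderiv ℝ (𝔄.gauge c c' x₀) (P.x t) (𝔄.rho c x₀ (P.x t) (P.w t)) (P.y t)
  x_smooth := P.x_smooth.mono inter_subset_left
  y_smooth := (contDiffOn_gauge.comp (P.x_smooth.mono inter_subset_left)
    fun t ht => ht.2).clm_apply (P.y_smooth.mono inter_subset_left)
  w_smooth := (contDiffOn_gauge.comp (P.x_smooth.mono inter_subset_left)
    fun t ht => ht.2).clm_apply (P.w_smooth.mono inter_subset_left)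
  ζ_smooth := by
    have hx := P.x_smooth.mono (inter_subset_left
      (t := P.x ⁻¹' 𝔄.dom c x₀ (trivializationAt F E c').baseSet))
    have hw := P.w_smooth.mono (inter_subset_left
      (t := P.x ⁻¹' 𝔄.dom c x₀ (trivializationAt F E c').baseSet))
    have hy := P.y_smooth.mono (inter_subset_left
      (t := P.x ⁻¹' 𝔄.dom c x₀ (trivializationAt F E c').baseSet))
    have hζ := P.ζ_smooth.mono (inter_subset_left
      (t := P.x ⁻¹' 𝔄.dom c x₀ (trivializationAt F E c').baseSet))
    have h1 := (contDiffOn_gauge (𝔄 := 𝔄) (c := c) (c' := c') (x₀ := x₀)).fderiv_of_isOpen (m := ∞)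
      (isOpen_dom (trivializationAt F E c').open_baseSet) (by simp)
    exact ((contDiffOn_gauge.comp hx fun t ht => ht.2).clm_apply hζ).add
      (((h1.comp hx fun t ht => ht.2).clm_apply ((contDiffOn_rho.comp hx
        fun t ht => P.mem t ht.1).clm_apply hw)).clm_apply hy)
  mem := fun t ht => ⟨ht.2.1, ht.2.2.2, trivial⟩
  x_deriv := fun t ht => by
    rw [rho_gauge ht.2]
    exact P.x_deriv t ht.1
  w_deriv := fun t ht => by
    have hg : HasFDerivAt (𝔄.gauge c c' x₀) (fderiv ℝ (𝔄.gauge c c' x₀) (P.x t)) (P.x t) :=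
      ((contDiffOn_gauge.contDiffAt ((isOpen_dom
        (trivializationAt F E c').open_baseSet).mem_nhds ht.2)).differentiableAt
        (by simp)).hasFDerivAt
    refine ((hg.comp_hasDerivAt t (P.x_deriv t ht.1)).clm_apply (P.w_deriv t ht.1)).congr_deriv ?_
    -- The non-tensorial terms of the structure functions absorb both derivatives of `gauge`, that
    -- of `w` along the curve and that in the new `ζ`.
    rw [locStr_gauge ht.2, map_sub]
    simp only [Function.comp_apply]
    abel

theorem mem_gaugeChange (ht : t ∈ P.I)
    (hc : P.x t ∈ 𝔄.dom c x₀ (trivializationAt F E c').baseSet) : t ∈ (P.gaugeChange c').I :=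
  ⟨ht, hc⟩

theorem jetOf_gaugeChange (ht : t ∈ (P.gaugeChange c').I) (k : ℕ) :
    𝔄.jetOf c' x₀ ((P.gaugeChange c').ξ k t) = 𝔄.jetOf c x₀ (P.ξ k t) := by
  have hsrc : (P.curve t).proj ∈ (extChartAt 𝓘(ℝ, B) x₀).source :=
    (extChartAt 𝓘(ℝ, B) x₀).map_target (P.mem t ht.1).1
  rw [← P.jet_eq ht.1 k, jet_eq_jetOf (c := c') _ hsrc ht.2.2.2]
  congr 1
  refine Prod.ext (P.basePart_curve ht.1).symm (funext fun j => ?_)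
  have he : (P.gaugeChange c').y =ᶠ[𝓝 t] fibrePart c' P.curve := by
    filter_upwards [(P.gaugeChange c').isOpen.mem_nhds ht] with s hs
    rw [fibrePart_gauge (𝔄 := 𝔄) (x₀ := x₀) (c := c)
      ((extChartAt 𝓘(ℝ, B) x₀).map_target (P.mem s hs.1).1) (P.mem s hs.1).2.1 hs.2.2.2,
      P.basePart_curve hs.1, P.fibrePart_curve hs.1]
    rfl
  exact he.iteratedDeriv_eq j

end CurvePair

variable [FiniteDimensional ℝ B] [T2Space M]

/-- Both sides are the time derivative of `Φ` along the same curve of jets. -/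
theorem totD_gauge {Φ : 𝔄.Jet k → V} (hO : IsOpen O) (hΦ : SmOn O Φ) (P : CurvePair 𝔄 c x₀)
    (ht : t ∈ (P.gaugeChange c').I) (hP : P.x t ∈ 𝔄.dom c x₀ O) :
    𝔄.totD c' x₀ (fun p => Φ (𝔄.jetOf c' x₀ p)) ((P.gaugeChange c').ξ (k + 1) t) =
      𝔄.totD c x₀ (fun p => Φ (𝔄.jetOf c x₀ p)) (P.ξ (k + 1) t) := by
  have h1 := P.hasDerivAt_comp_ξ (k := k) ht.1 (hΦ.differentiableAt hO (c := c) (x₀ := x₀) hP)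
  have h2 := (P.gaugeChange c').hasDerivAt_comp_ξ (k := k) ht (hΦ.differentiableAt hO (c := c')
    (x₀ := x₀) ⟨hP.1, ht.2.2.2, hP.2.2⟩)
  refine h2.unique (h1.congr_of_eventuallyEq ?_)
  filter_upwards [(P.gaugeChange c').isOpen.mem_nhds ht] with s hs
  rw [P.jetOf_gaugeChange hs]

/-- `totalDeriv` is defined in the preferred trivialization at the base point of the jet. A curve
through the jet, rewritten there by `gaugeChange`, carries the formula to an arbitrary `c`. -/
theorem totalDeriv_jetOf {Φ : 𝔄.Jet k → V} (hO : IsOpen O) (hΦ : SmOn O Φ)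
    {p : B × (Fin (k + 1) → F)} (hp : p.1 ∈ 𝔄.dom c x₀ O) :
    totalDeriv Φ (𝔄.jetOf c x₀ p) = 𝔄.totD c x₀ (fun p => Φ (𝔄.jetOf c x₀ p)) p := by
  have hpu := dom_subset_univ hp
  obtain ⟨P, h0, hξ, -⟩ := CurvePair.exists_through (k + 1) hpu 0
  have hx0 : P.x 0 = p.1 := congrArg Prod.fst hξ
  set A := 𝔄.jetOf c x₀ p with hA
  set c' := base A with hc'
  have hbase : c' = (extChartAt 𝓘(ℝ, B) x₀).symm p.1 := base_jetOf hpu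
  have ht : (0 : ℝ) ∈ (P.gaugeChange c').I := P.mem_gaugeChange h0 (by
    rw [hx0]
    exact ⟨hp.1, hp.2.1, hbase ▸ mem_baseSet_trivializationAt F E _⟩)
  have hp' : p.1 ∈ 𝔄.dom c' x₀ univ := hx0 ▸ (P.gaugeChange c').mem 0 ht
  have hA' : A = 𝔄.jetOf c' x₀ ((P.gaugeChange c').ξ (k + 1) 0) := by
    rw [P.jetOf_gaugeChange ht, hξ]
  have hx0' : ((P.gaugeChange c').ξ (k + 1) 0).1 = p.1 := hx0
  rw [← hξ, ← totD_gauge hO hΦ P ht (by rwa [hx0])]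
  have hb : base (proj (Nat.le_succ k) A) = c' := base_proj _ _
  rw [totalDeriv, dFun, hb, canonicalT, ← hc']
  rw [hA', proj_jetOf _ (by rwa [hx0']), coord_jetOf (by rwa [hx0'])]
  exact along_jetOf (by rwa [← hx0'] at hp') (hΦ.differentiableAt hO (by
    rw [hx0']; exact ⟨hp.1, hp'.2.1, hp.2.2⟩)) _

theorem SmOn.totalDeriv {Φ : 𝔄.Jet k → V} (hO : IsOpen O) (hΦ : SmOn O Φ) :
    SmOn O (LieAlgebroid.totalDeriv Φ) := fun c x₀ =>
  (contDiffOn_totD hO (hΦ c x₀)).congr fun _ hp => totalDeriv_jetOf hO hΦ hp.1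

theorem SmOn.totalDerivIter {Φ : 𝔄.Jet k → V} (hO : IsOpen O) (hΦ : SmOn O Φ) (r : ℕ) :
    SmOn O (LieAlgebroid.totalDerivIter Φ r) := by
  induction r with
  | zero => exact hΦ
  | succ r ih => exact ih.totalDeriv hO

theorem SmOn.comp_proj (h : l ≤ k) {Φ : 𝔄.Jet l → V} (hΦ : SmOn O Φ) :
    SmOn O fun A : 𝔄.Jet k => Φ (proj h A) := fun c x₀ => by
  refine ((hΦ c x₀).comp (trunc B F h).contDiff.contDiffOn
    (fun p hp => ⟨hp.1, trivial⟩)).congr fun p hp => ?_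
  change Φ (proj h _) = _
  rw [proj_jetOf _ (dom_subset_univ hp.1)]
  rfl

theorem CurvePair.hasDerivAt_totalDeriv (P : CurvePair 𝔄 c x₀) {Φ : 𝔄.Jet k → V} (hO : IsOpen O)
    (hΦ : SmOn O Φ) (ht : t ∈ P.I) (hP : P.x t ∈ 𝔄.dom c x₀ O) :
    HasDerivAt (fun s => Φ (𝔄.jetOf c x₀ (P.ξ k s)))
      (LieAlgebroid.totalDeriv Φ (𝔄.jetOf c x₀ (P.ξ (k + 1) t))) t := by
  rw [totalDeriv_jetOf hO hΦ (p := P.ξ (k + 1) t) hP]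
  exact P.hasDerivAt_comp_ξ ht (hΦ.differentiableAt hO hP)

end TotalDerivative


/-! ### Change of trivialization -/

section FrameChange

variable {𝔄} [FiniteDimensional ℝ F] [FiniteDimensional ℝ B] [T2Space M] {c c' c'' x₀ : M}
  {k l : ℕ} {O : Set M} {t : ℝ} {V : Type*} [NormedAddCommGroup V] [NormedSpace ℝ V]

theorem along_smOn {Φ : 𝔄.Jet k → V} (hO : IsOpen O) (hΦ : SmOn O Φ) {p : B × (Fin k → F)}
    (hp : p.1 ∈ 𝔄.dom c x₀ O) (z : ETangent F k) :
    along c Φ (𝔄.jetOf c x₀ p) z =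
      fderiv ℝ (fun p => Φ (𝔄.jetOf c x₀ p)) p (𝔄.vvec c x₀ p.1 z) :=
  along_jetOf (dom_subset_univ hp) (hΦ.differentiableAt hO hp) z

theorem base_jetOf_mem {p : B × (Fin k → F)} (hp : p.1 ∈ 𝔄.dom c x₀ O) :
    base (𝔄.jetOf c x₀ p) ∈ O := by
  rw [base_jetOf (dom_subset_univ hp)]
  exact hp.2.2

theorem exists_curvePair (A : 𝔄.Jet k) (z : ETangent F k) :
    ∃ P : CurvePair 𝔄 (base A) (base A), 0 ∈ P.I ∧ 𝔄.jetOf (base A) (base A) (P.ξ k 0) = A ∧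
      P.Z k 0 = z ∧ (extChartAt 𝓘(ℝ, B) (base A)).symm (P.x 0) = base A := by
  obtain ⟨p, hp, hA⟩ := exists_jetOf_eq A
  obtain ⟨P, h0, hξ, hZ⟩ := CurvePair.exists_through k hp z
  refine ⟨P, h0, by rw [hξ, hA], hZ, ?_⟩
  have h1 := base_jetOf hp
  rw [hA] at h1
  rw [show P.x 0 = p.1 from congrArg Prod.fst hξ]
  exact h1.symm

theorem CurvePair.base_jetOf (P : CurvePair 𝔄 c x₀) (ht : t ∈ P.I) (k : ℕ) :
    base (𝔄.jetOf c x₀ (P.ξ k t)) = (extChartAt 𝓘(ℝ, B) x₀).symm (P.x t) :=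
  LieAlgebroid.base_jetOf (P.mem t ht)

theorem CurvePair.coord_jetOf (P : CurvePair 𝔄 c x₀) (ht : t ∈ (P.gaugeChange c').I)
    (j : Fin k) :
    coord c' (𝔄.jetOf c x₀ (P.ξ k t)) j = iteratedDeriv j (P.gaugeChange c').y t := by
  rw [← P.jetOf_gaugeChange ht, LieAlgebroid.coord_jetOf ((P.gaugeChange c').mem t ht)]
  rfl

/-- The highest coordinate of a jet. -/
def lastCoord (c : M) (j : ℕ) (A : 𝔄.Jet (j + 1)) : F := coord c A (Fin.last j)

theorem lastCoord_proj (A : 𝔄.Jet k) (hc : base A ∈ (trivializationAt F E c).baseSet) (j : Fin k) :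
    lastCoord c j (proj (Nat.succ_le_of_lt j.2) A) = coord c A j := by
  rw [lastCoord, coord_proj _ _ hc]
  rfl

/-- Along a curve the coordinates are successive time derivatives. Smoothness at level `j` is a
hypothesis here because `smOn_lastCoord` obtains level `j + 1` from this identity. -/
theorem lastCoord_succ_of_smOn {j : ℕ}
    (h : SmOn (trivializationAt F E c').baseSet (lastCoord (𝔄 := 𝔄) c' j)) {A : 𝔄.Jet (j + 2)}
    (hA : base A ∈ (trivializationAt F E c').baseSet) :
    lastCoord c' (j + 1) A = totalDeriv (lastCoord c' j) A := by
  obtain ⟨P, h0, hPA, -, hPb⟩ := exists_curvePair A 0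
  have hP : P.x 0 ∈ 𝔄.dom (base A) (base A) (trivializationAt F E c').baseSet :=
    ⟨(P.mem 0 h0).1, (P.mem 0 h0).2.1, by rwa [hPb]⟩
  have ht := P.mem_gaugeChange h0 hP
  have h1 := P.hasDerivAt_totalDeriv (trivializationAt F E c').open_baseSet h h0 hP
  have h2 := hasDerivAt_iteratedDeriv (P.gaugeChange c').isOpen (P.gaugeChange c').y_smooth j ht
  have h3 := h1.unique (h2.congr_of_eventuallyEq (by
    filter_upwards [(P.gaugeChange c').isOpen.mem_nhds ht] with s hs
    exact P.coord_jetOf hs _))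
  rw [hPA] at h3
  have h4 := P.coord_jetOf ht (Fin.last (j + 1))
  rw [hPA] at h4
  rw [h3]
  exact h4

theorem lastCoord_zero_jetOf {p : B × (Fin 1 → F)}
    (hp : p.1 ∈ 𝔄.dom c x₀ (trivializationAt F E c').baseSet) :
    lastCoord c' 0 (𝔄.jetOf c x₀ p) = 𝔄.gauge c c' x₀ p.1 (p.2 0) := by
  obtain ⟨P, h0, hξ, -⟩ := CurvePair.exists_through 1 (dom_subset_univ hp) 0
  have hx : P.x 0 = p.1 := congrArg Prod.fst hξ
  rw [← hξ, lastCoord, P.coord_jetOf (P.mem_gaugeChange h0 (by rwa [hx]))]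
  simp [CurvePair.gaugeChange, CurvePair.ξ]

theorem smOn_lastCoord (c' : M) (j : ℕ) :
    SmOn (trivializationAt F E c').baseSet (lastCoord (𝔄 := 𝔄) c' j) := by
  induction j with
  | zero =>
    intro c x₀
    refine ((contDiffOn_gauge.comp contDiff_fst.contDiffOn fun p hp => hp.1).clm_apply
      (contDiff_apply ℝ F (0 : Fin 1) |>.comp contDiff_snd).contDiffOn).congr fun p hp => ?_
    exact lastCoord_zero_jetOf hp.1
  | succ j ih =>
    intro c x₀
    refine (ih.totalDeriv (trivializationAt F E c').open_baseSet c x₀).congr fun p hp => ?_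
    exact lastCoord_succ_of_smOn ih (base_jetOf_mem hp.1)

theorem lastCoord_succ {j : ℕ} {A : 𝔄.Jet (j + 2)}
    (hA : base A ∈ (trivializationAt F E c').baseSet) :
    lastCoord c' (j + 1) A = totalDeriv (lastCoord c' j) A :=
  lastCoord_succ_of_smOn (smOn_lastCoord c' j) hA

theorem smOn_coord (c' : M) : SmOn (trivializationAt F E c').baseSet (coord (𝔄 := 𝔄) (k := k) c') :=
  fun c x₀ => contDiffOn_pi.2 fun j =>
    ((smOn_lastCoord c' j).comp_proj (Nat.succ_le_of_lt j.2) c x₀).congr fun _ hp =>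
      (lastCoord_proj _ (base_jetOf_mem hp.1) j).symm

theorem along_comp_proj (h : l ≤ k) {Φ : 𝔄.Jet l → V} (hO : IsOpen O) (hΦ : SmOn O Φ)
    {p : B × (Fin k → F)} (hp : p.1 ∈ 𝔄.dom c x₀ O) (z : ETangent F k) :
    along c (fun A => Φ (proj h A)) (𝔄.jetOf c x₀ p) z =
      along c Φ (𝔄.jetOf c x₀ (trunc B F h p)) (cut F h z) := by
  rw [along_jetOf (dom_subset_univ hp) ((hΦ.comp_proj h).differentiableAt hO hp),
    along_jetOf (p := trunc B F h p) (dom_subset_univ hp) (hΦ.differentiableAt hO hp)]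
  have he : (fun p => Φ (proj h (𝔄.jetOf c x₀ p))) =ᶠ[𝓝 p]
      fun p => Φ (𝔄.jetOf c x₀ (trunc B F h p)) := by
    filter_upwards [((isOpen_dom isOpen_univ).prod isOpen_univ).mem_nhds
      (show p ∈ 𝔄.dom c x₀ univ ×ˢ univ from ⟨dom_subset_univ hp, trivial⟩)] with q hq
    rw [proj_jetOf _ hq.1]
    rfl
  rw [he.fderiv_eq]
  have h1 := HasFDerivAt.comp p (hΦ.differentiableAt hO (c := c) (x₀ := x₀)
    (p := trunc B F h p) hp).hasFDerivAt (trunc B F h).hasFDerivAt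
  have h2 : fderiv ℝ (fun p => Φ (𝔄.jetOf c x₀ (trunc B F h p))) p = _ := h1.fderiv
  rw [h2]
  rfl

theorem along_congr {Φ Φ' : 𝔄.Jet k → V} (hO : IsOpen O) (hΦ : SmOn O Φ')
    (h : ∀ A, base A ∈ O → Φ A = Φ' A) {p : B × (Fin k → F)} (hp : p.1 ∈ 𝔄.dom c x₀ O) :
    along c Φ (𝔄.jetOf c x₀ p) = along c Φ' (𝔄.jetOf c x₀ p) := by
  have hs : SmOn O Φ := fun c x₀ => (hΦ c x₀).congr fun q hq => h _ (base_jetOf_mem hq.1)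
  refine ContinuousLinearMap.ext fun z => ?_
  rw [along_jetOf (dom_subset_univ hp) (hs.differentiableAt hO hp),
    along_jetOf (dom_subset_univ hp) (hΦ.differentiableAt hO hp)]
  refine DFunLike.congr_fun (Filter.EventuallyEq.fderiv_eq ?_) _
  filter_upwards [((isOpen_dom hO).prod isOpen_univ).mem_nhds
      (show p ∈ 𝔄.dom c x₀ O ×ˢ univ from ⟨hp, trivial⟩)] with q hq
  exact h _ (base_jetOf_mem hq.1)

theorem changeFrame_apply {p : B × (Fin k → F)}
    (hp : p.1 ∈ 𝔄.dom c x₀ (trivializationAt F E c').baseSet) (z : ETangent F k) :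
    changeFrame c c' (𝔄.jetOf c x₀ p) z = Fin.cons (𝔄.gauge c c' x₀ p.1 (z 0))
      (fderiv ℝ (fun p => coord c' (𝔄.jetOf c x₀ p)) p (𝔄.vvec c x₀ p.1 z)) := by
  rw [← along_jetOf (dom_subset_univ hp) ((smOn_coord c').differentiableAt
    (trivializationAt F E c').open_baseSet hp)]
  funext r
  refine Fin.cases ?_ (fun r => rfl) r
  change (trivializationAt F E c').continuousLinearMapAt ℝ (base (𝔄.jetOf c x₀ p))
    ((trivializationAt F E c).symmL ℝ (base (𝔄.jetOf c x₀ p)) (z 0)) = _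
  rw [base_jetOf (dom_subset_univ hp)]
  rfl

theorem along_coord_eq {p : B × (Fin k → F)}
    (hp : p.1 ∈ 𝔄.dom c x₀ (trivializationAt F E c').baseSet) (z : ETangent F k) (r : Fin k) :
    along c (coord c') (𝔄.jetOf c x₀ p) z r =
      along c (lastCoord c' r) (𝔄.jetOf c x₀ (trunc B F (Nat.succ_le_of_lt r.2) p))
        (cut F (Nat.succ_le_of_lt r.2) z) := by
  have ho := (trivializationAt F E c').open_baseSet
  rw [← along_comp_proj _ ho (smOn_lastCoord c' r) hp, ← along_congr (Φ := fun A => coord c' A r) ho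
    ((smOn_lastCoord c' r).comp_proj (Nat.succ_le_of_lt r.2))
    (fun A hA => (lastCoord_proj A hA r).symm) hp]
  have hd := (smOn_coord (𝔄 := 𝔄) (k := k) c').differentiableAt ho (c := c) (x₀ := x₀) hp
  rw [along_jetOf (dom_subset_univ hp) hd,
    along_jetOf (dom_subset_univ hp) (differentiableAt_pi.1 hd r)]
  rw [fderiv_pi (differentiableAt_pi.1 hd)]
  rfl

/-- The first coordinate is `gauge x y`, whose variation is the `ζ` of `gaugeChange`. Each further
coordinate is a total derivative of the previous one, and `hasDerivAt_fderiv` lets its variation be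
obtained by differentiating in time. -/
theorem fderiv_lastCoord_Z (P : CurvePair 𝔄 c x₀) (j : ℕ) (ht : t ∈ (P.gaugeChange c').I) :
    fderiv ℝ (fun p => lastCoord c' j (𝔄.jetOf c x₀ p)) (P.ξ (j + 1) t)
      (𝔄.vvec c x₀ (P.x t) (P.Z (j + 1) t)) = iteratedDeriv j (P.gaugeChange c').ζ t := by
  have ho := (trivializationAt F E c').open_baseSet
  induction j generalizing t with
  | zero =>
    have hg : HasFDerivAt (𝔄.gauge c c' x₀) (fderiv ℝ (𝔄.gauge c c' x₀) (P.x t)) (P.x t) :=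
      ((contDiffOn_gauge.contDiffAt ((isOpen_dom ho).mem_nhds ht.2)).differentiableAt
        (by simp)).hasFDerivAt
    have h1 : HasFDerivAt (fun p : B × (Fin 1 → F) => 𝔄.gauge c c' x₀ p.1)
        ((fderiv ℝ (𝔄.gauge c c' x₀) (P.x t)).comp (ContinuousLinearMap.fst ℝ _ _))
        (P.ξ 1 t) :=
      HasFDerivAt.comp (g := 𝔄.gauge c c' x₀) (f := Prod.fst) (P.ξ 1 t) hg hasFDerivAt_fst
    have h2 := h1.clm_apply (ContinuousLinearMap.hasFDerivAt ((ContinuousLinearMap.proj 0 :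
      (Fin 1 → F) →L[ℝ] F) ∘L ContinuousLinearMap.snd ℝ B _))
    have h3 : (fun p => lastCoord c' 0 (𝔄.jetOf c x₀ p)) =ᶠ[𝓝 (P.ξ 1 t)]
        fun p => 𝔄.gauge c c' x₀ p.1 (p.2 0) := by
      filter_upwards [((isOpen_dom ho).prod isOpen_univ).mem_nhds
        (show P.ξ 1 t ∈ 𝔄.dom c x₀ (trivializationAt F E c').baseSet ×ˢ univ from ⟨ht.2, trivial⟩)]
        with q hq using lastCoord_zero_jetOf hq.1
    have h4 := (h2.congr_of_eventuallyEq h3).fderiv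
    rw [h4, iteratedDeriv_zero]
    change 𝔄.gauge c c' x₀ (P.x t) (iteratedDeriv 0 P.ζ t) +
      fderiv ℝ (𝔄.gauge c c' x₀) (P.x t) (𝔄.rho c x₀ (P.x t) (P.w t)) (iteratedDeriv 0 P.y t) = _
    rw [iteratedDeriv_zero, iteratedDeriv_zero]
    rfl
  | succ j ih =>
    have h1 := P.hasDerivAt_fderiv ho ht.1 ht.2 (smOn_lastCoord (𝔄 := 𝔄) c' j c x₀)
    have h2 := hasDerivAt_iteratedDeriv (P.gaugeChange c').isOpen (P.gaugeChange c').ζ_smooth j ht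
    have h3 := h1.unique (h2.congr_of_eventuallyEq (by
      filter_upwards [(P.gaugeChange c').isOpen.mem_nhds ht] with s hs using ih hs))
    rw [← h3]
    refine DFunLike.congr_fun (Filter.EventuallyEq.fderiv_eq ?_) _
    filter_upwards [((isOpen_dom ho).prod isOpen_univ).mem_nhds
        (show P.ξ (j + 2) t ∈ 𝔄.dom c x₀ (trivializationAt F E c').baseSet ×ˢ univ from
          ⟨ht.2, trivial⟩)] with q hq
    rw [lastCoord_succ (base_jetOf_mem hq.1),
      totalDeriv_jetOf ho (smOn_lastCoord c' j) hq.1]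

/-- The components of the variation change like the components of an element of `𝒯^E E^k`. -/
theorem changeFrame_Z (P : CurvePair 𝔄 c x₀) (k : ℕ) (ht : t ∈ (P.gaugeChange c').I) :
    changeFrame c c' (𝔄.jetOf c x₀ (P.ξ k t)) (P.Z k t) = (P.gaugeChange c').Z k t := by
  have ho := (trivializationAt F E c').open_baseSet
  rw [changeFrame_apply (p := P.ξ k t) ht.2, ← along_jetOf (P.mem t ht.1)
    ((smOn_coord c').differentiableAt ho (p := P.ξ k t) ht.2)]
  funext r
  refine Fin.cases rfl (fun r => ?_) r
  simp only [Fin.cons_succ, CurvePair.Z]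
  rw [along_coord_eq (p := P.ξ k t) ht.2]
  refine (along_smOn ho (smOn_lastCoord c' r) (p := P.ξ (r + 1) t) ht.2 _).trans ?_
  rw [show (Fin.cons (P.w t) fun j => iteratedDeriv (j : ℕ) P.ζ t : ETangent F k) = P.Z k t from rfl,
    P.cut_Z]
  exact fderiv_lastCoord_Z P r ht

/-- The canonical section `𝖳` does not depend on the trivialization. -/
theorem changeFrame_coord {A : 𝔄.Jet (k + 1)} (hc : base A ∈ (trivializationAt F E c).baseSet)
    (hc' : base A ∈ (trivializationAt F E c').baseSet) :
    changeFrame c c' (proj (Nat.le_succ k) A) (coord c A) = coord c' A := by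
  have ho := (trivializationAt F E c').open_baseSet
  set x₀ := base A
  have hA := jetOf_coord (c := c) (x₀ := x₀) (mem_extChartAt_source _) hc
  set p := (extChartAt 𝓘(ℝ, B) x₀ (base A), coord c A) with hp
  have hpm : p.1 ∈ 𝔄.dom c x₀ (trivializationAt F E c').baseSet :=
    mem_dom_of_mem (mem_extChartAt_source _) hc hc'
  rw [← hA, proj_jetOf _ (dom_subset_univ hpm)]
  change changeFrame c c' (𝔄.jetOf c x₀ (trunc B F (Nat.le_succ k) p)) _ = _
  rw [coord_jetOf (dom_subset_univ hpm)]
  rw [changeFrame_apply (p := trunc B F (Nat.le_succ k) p) hpm,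
    ← along_jetOf (p := trunc B F (Nat.le_succ k) p) (dom_subset_univ hpm)
    ((smOn_coord c').differentiableAt ho (p := trunc B F (Nat.le_succ k) p) hpm)]
  funext r
  have hb : base (𝔄.jetOf c x₀ p) ∈ (trivializationAt F E c').baseSet := by rwa [hA]
  rw [← lastCoord_proj _ hb, proj_jetOf _ (dom_subset_univ hpm)]
  refine Fin.cases ?_ (fun r => ?_) r
  · exact (lastCoord_zero_jetOf (p := trunc B F (by omega) p) hpm).symm
  · change _ = lastCoord c' (r + 1) (𝔄.jetOf c x₀ (trunc B F _ p))
    refine Eq.trans ?_ (lastCoord_succ (base_jetOf_mem (by exact hpm))).symm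
    rw [totalDeriv_jetOf ho (smOn_lastCoord c' r) (p := trunc B F _ p) hpm, Fin.cons_succ,
      along_coord_eq (p := trunc B F (Nat.le_succ k) p) hpm]
    exact along_smOn ho (smOn_lastCoord c' r) (p := trunc B F _ (trunc B F (Nat.le_succ k) p))
      hpm _

end FrameChange


/-! ### Cocycle properties of the change of components -/

section FrameCocycle

variable {𝔄} [FiniteDimensional ℝ F] [FiniteDimensional ℝ B] [T2Space M] {c c' c'' x₀ : M}
  {k l : ℕ} {O : Set M} {t : ℝ} {V : Type*} [NormedAddCommGroup V] [NormedSpace ℝ V]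

theorem jetOf_coord_jetOf {p : B × (Fin k → F)}
    (hp : p.1 ∈ 𝔄.dom c x₀ (trivializationAt F E c').baseSet) :
    𝔄.jetOf c' x₀ (p.1, coord c' (𝔄.jetOf c x₀ p)) = 𝔄.jetOf c x₀ p :=
  (eq_jetOf (p := (p.1, coord c' (𝔄.jetOf c x₀ p))) ⟨hp.1, hp.2.2, trivial⟩
    
    (base_jetOf (p := p) (dom_subset_univ hp)) rfl).symm

theorem along_changeFrame_jetOf {Φ : 𝔄.Jet k → V} (hO : IsOpen O) (hΦ : SmOn O Φ)
    {p : B × (Fin k → F)} (hp : p.1 ∈ 𝔄.dom c x₀ O)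
    (hc' : p.1 ∈ 𝔄.dom c x₀ (trivializationAt F E c').baseSet) (z : ETangent F k) :
    along c' Φ (𝔄.jetOf c x₀ p) (changeFrame c c' (𝔄.jetOf c x₀ p) z) =
      along c Φ (𝔄.jetOf c x₀ p) z := by
  have ho := (trivializationAt F E c').open_baseSet
  set q : B × (Fin k → F) := (p.1, coord c' (𝔄.jetOf c x₀ p)) with hq
  have hqm : q.1 ∈ 𝔄.dom c' x₀ O := ⟨hp.1, hc'.2.2, hp.2.2⟩
  have h1 := along_smOn hO hΦ (p := q) hqm (changeFrame c c' (𝔄.jetOf c x₀ p) z)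
  rw [jetOf_coord_jetOf hc'] at h1
  rw [h1, along_smOn hO hΦ hp, changeFrame_apply hc']
  have hT : HasFDerivAt (fun p : B × (Fin k → F) => (p.1, coord c' (𝔄.jetOf c x₀ p)))
      ((ContinuousLinearMap.fst ℝ _ _).prod (fderiv ℝ (fun p => coord c' (𝔄.jetOf c x₀ p)) p)) p :=
    hasFDerivAt_fst.prodMk ((smOn_coord c').differentiableAt ho hc').hasFDerivAt
  have h2 := HasFDerivAt.comp (g := fun p => Φ (𝔄.jetOf c' x₀ p)) p
    (hΦ.differentiableAt hO (p := q) hqm).hasFDerivAt hT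
  have h3 : (fun p => Φ (𝔄.jetOf c x₀ p)) =ᶠ[𝓝 p] (fun p => Φ (𝔄.jetOf c' x₀ p)) ∘
      fun p : B × (Fin k → F) => (p.1, coord c' (𝔄.jetOf c x₀ p)) := by
    filter_upwards [((isOpen_dom ho).prod isOpen_univ).mem_nhds
      (show p ∈ 𝔄.dom c x₀ (trivializationAt F E c').baseSet ×ˢ univ from ⟨hc', trivial⟩)] with r hr
    simp only [Function.comp_apply, jetOf_coord_jetOf hr.1]
  rw [(h2.congr_of_eventuallyEq h3).fderiv, ContinuousLinearMap.comp_apply]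
  congr 1
  refine Prod.ext ?_ rfl
  exact rho_gauge hc' (z 0)

theorem along_changeFrame {Φ : 𝔄.Jet k → V} (hO : IsOpen O) (hΦ : SmOn O Φ) {A : 𝔄.Jet k}
    (hA : base A ∈ O) (hc : base A ∈ (trivializationAt F E c).baseSet)
    (hc' : base A ∈ (trivializationAt F E c').baseSet) (z : ETangent F k) :
    along c' Φ A (changeFrame c c' A z) = along c Φ A z := by
  have h := jetOf_coord (c := c) (x₀ := base A) (mem_extChartAt_source _) hc
  rw [← h]
  exact along_changeFrame_jetOf hO hΦ (mem_dom_of_mem (mem_extChartAt_source _) hc hA)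
    (mem_dom_of_mem (mem_extChartAt_source _) hc hc') z

/-- The vertical components of `changeFrame` are derivatives of `coord c''`, so the cocycle rule is
the invariance `along_changeFrame` applied to that function. -/
theorem changeFrame_comp {A : 𝔄.Jet k} (hc : base A ∈ (trivializationAt F E c).baseSet)
    (hc' : base A ∈ (trivializationAt F E c').baseSet)
    (hc'' : base A ∈ (trivializationAt F E c'').baseSet) (z : ETangent F k) :
    changeFrame c' c'' A (changeFrame c c' A z) = changeFrame c c'' A z := by
  have h1 := along_changeFrame (trivializationAt F E c'').open_baseSet
    (smOn_coord (𝔄 := 𝔄) (k := k) c'') hc'' hc hc' z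
  funext r
  refine Fin.cases ?_ (fun r => congrFun h1 r) r
  change (trivializationAt F E c'').continuousLinearMapAt ℝ (base A)
    ((trivializationAt F E c').symmL ℝ (base A)
    ((trivializationAt F E c').continuousLinearMapAt ℝ (base A)
    ((trivializationAt F E c).symmL ℝ (base A) (z 0)))) = _
  rw [Trivialization.symmL_continuousLinearMapAt _ hc']
  rfl

theorem gauge_self {u : B} (hu : u ∈ 𝔄.dom c x₀ univ) (f : F) : 𝔄.gauge c c x₀ u f = f :=
  Trivialization.continuousLinearMapAt_symmL _ hu.2.1 _

theorem changeFrame_self {A : 𝔄.Jet k} (hc : base A ∈ (trivializationAt F E c).baseSet)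
    (z : ETangent F k) : changeFrame c c A z = z := by
  have h := jetOf_coord (c := c) (x₀ := base A) (mem_extChartAt_source _) hc
  set p := (extChartAt 𝓘(ℝ, B) (base A) (base A), coord c A)
  have hp : p.1 ∈ 𝔄.dom c (base A) (trivializationAt F E c).baseSet :=
    mem_dom_of_mem (mem_extChartAt_source _) hc hc
  rw [← h, changeFrame_apply hp, gauge_self (dom_subset_univ hp)]
  have h2 : (fun p => coord c (𝔄.jetOf (k := k) c (base A) p)) =ᶠ[𝓝 p] Prod.snd := by
    filter_upwards [((isOpen_dom isOpen_univ).prod isOpen_univ).mem_nhds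
      (show p ∈ 𝔄.dom c (base A) univ ×ˢ univ from ⟨dom_subset_univ hp, trivial⟩)] with r hr
    exact coord_jetOf hr.1
  rw [h2.fderiv_eq, fderiv_snd]
  funext r
  exact Fin.cases rfl (fun r => rfl) r

/-- Represent the vector by a variation: truncation of `Z` only forgets derivatives, and
`changeFrame` acts on `Z` as `gaugeChange` acts on the curve, at every order. -/
theorem cut_changeFrame (h : l ≤ k) {A : 𝔄.Jet k} (hc : base A ∈ (trivializationAt F E c).baseSet)
    (hc' : base A ∈ (trivializationAt F E c').baseSet) (z : ETangent F k) :
    cut F h (changeFrame c c' A z) = changeFrame c c' (proj h A) (cut F h z) := by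
  obtain ⟨x₀, hx₀⟩ : ∃ x₀, base A ∈ (extChartAt 𝓘(ℝ, B) x₀).source :=
    ⟨base A, mem_extChartAt_source _⟩
  obtain ⟨p, hA, hp⟩ : ∃ p : B × (Fin k → F), 𝔄.jetOf c x₀ p = A ∧
      p.1 ∈ 𝔄.dom c x₀ (trivializationAt F E c').baseSet :=
    ⟨_, jetOf_coord hx₀ hc, mem_dom_of_mem hx₀ hc hc'⟩
  obtain ⟨P, h0, hξ, rfl⟩ := CurvePair.exists_through k (dom_subset_univ hp) z
  have ht : (0 : ℝ) ∈ (P.gaugeChange c').I := P.mem_gaugeChange h0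
    (by rwa [show P.x 0 = p.1 from congrArg Prod.fst hξ])
  have h1 : proj h A = 𝔄.jetOf c x₀ (P.ξ l 0) := by
    rw [← hA, proj_jetOf _ (dom_subset_univ hp), ← hξ]
    rfl
  rw [h1, ← hA, ← hξ, changeFrame_Z P k ht, CurvePair.cut_Z, P.cut_Z, changeFrame_Z P l ht]

end FrameCocycle


/-! ### One-forms in coordinates -/

section Forms

variable {𝔄} [FiniteDimensional ℝ F] [FiniteDimensional ℝ B] [T2Space M] {c c' c'' x₀ : M}
  {k l : ℕ} {O : Set M} {t : ℝ}

/-- Smooth `1`-forms. -/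
def SmForm (lam : OneForm 𝔄 k) : Prop := ∀ c x₀ : M,
  ContDiffOn ℝ ∞ (fun p => lam.inFrame c (𝔄.jetOf c x₀ p)) (𝔄.dom c x₀ univ ×ˢ univ)

theorem SmForm.contDiffAt {lam : OneForm 𝔄 k} (h : SmForm lam) {p : B × (Fin k → F)}
    (hp : p.1 ∈ 𝔄.dom c x₀ univ) : ContDiffAt ℝ ∞ (fun p => lam.inFrame c (𝔄.jetOf c x₀ p)) p :=
  (h c x₀).contDiffAt (((isOpen_dom isOpen_univ).prod isOpen_univ).mem_nhds ⟨hp, trivial⟩)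

theorem SmForm.differentiableAt {lam : OneForm 𝔄 k} (h : SmForm lam) {p : B × (Fin k → F)}
    (hp : p.1 ∈ 𝔄.dom c x₀ univ) :
    DifferentiableAt ℝ (fun p => lam.inFrame c (𝔄.jetOf c x₀ p)) p :=
  (h.contDiffAt hp).differentiableAt (by simp)

theorem inFrame_self (lam : OneForm 𝔄 k) (A : 𝔄.Jet k) : lam.inFrame (base A) A = lam A :=
  ContinuousLinearMap.ext fun z => by
    change lam A (changeFrame _ _ A z) = _
    rw [changeFrame_self (mem_baseSet_trivializationAt F E _)]

theorem inFrame_of_base (lam : OneForm 𝔄 k) {A : 𝔄.Jet k} (h : base A = c) :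
    lam.inFrame c A = lam A := by
  subst h
  exact inFrame_self lam A

theorem inFrame_changeFrame (lam : OneForm 𝔄 k) {A : 𝔄.Jet k}
    (hc : base A ∈ (trivializationAt F E c).baseSet)
    (hc' : base A ∈ (trivializationAt F E c').baseSet) (z : ETangent F k) :
    lam.inFrame c' A (changeFrame c c' A z) = lam.inFrame c A z := by
  change lam A (changeFrame _ _ A _) = lam A (changeFrame _ _ A z)
  rw [changeFrame_comp hc hc' (mem_baseSet_trivializationAt F E _)]

theorem base_jetOf_mem_baseSet {p : B × (Fin k → F)} (hp : p.1 ∈ 𝔄.dom c x₀ univ) :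
    base (𝔄.jetOf c x₀ p) ∈ (trivializationAt F E c).baseSet := by
  rw [base_jetOf hp]
  exact hp.2.1

theorem inFrame_dFun {Φ : 𝔄.Jet k → ℝ} (hΦ : SmOn univ Φ) {A : 𝔄.Jet k}
    (hc : base A ∈ (trivializationAt F E c).baseSet) :
    OneForm.inFrame c (dFun Φ) A = along c Φ A :=
  ContinuousLinearMap.ext fun z => along_changeFrame isOpen_univ hΦ (mem_univ _) hc
    (mem_baseSet_trivializationAt F E _) z

theorem SmForm.dFun {Φ : 𝔄.Jet k → ℝ} (hΦ : SmOn univ Φ) :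
    SmForm (LieAlgebroid.dFun Φ : OneForm 𝔄 k) := fun c x₀ => by
  have h1 := (hΦ c x₀).fderiv_of_isOpen (m := ∞) ((isOpen_dom isOpen_univ).prod isOpen_univ)
    (by simp)
  refine (h1.clm_comp (contDiffOn_vvec.comp contDiff_fst.contDiffOn
    (fun p hp => hp.1))).congr fun p hp => ?_
  rw [inFrame_dFun hΦ (base_jetOf_mem_baseSet hp.1)]
  exact ContinuousLinearMap.ext fun z => along_smOn isOpen_univ hΦ hp.1 z

theorem inFrame_pull (h : l ≤ k) (lam : OneForm 𝔄 l) {A : 𝔄.Jet k}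
    (hc : base A ∈ (trivializationAt F E c).baseSet) :
    (lam.pull h).inFrame c A = (lam.inFrame c (proj h A)).comp (cut F h) := by
  refine ContinuousLinearMap.ext fun z => ?_
  change lam (proj h A) (cut F h (changeFrame c (base A) A z)) =
    lam (proj h A) (changeFrame c (base (proj h A)) (proj h A) (cut F h z))
  rw [cut_changeFrame h hc (mem_baseSet_trivializationAt F E _), base_proj]

theorem SmForm.pull (h : l ≤ k) {lam : OneForm 𝔄 l} (hl : SmForm lam) :
    SmForm (lam.pull h) := fun c x₀ => by
  refine (((hl c x₀).comp (trunc B F h).contDiff.contDiffOn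
    (fun p hp => ⟨hp.1, trivial⟩)).clm_comp (contDiffOn_const (c := cut F h))).congr
    fun p hp => ?_
  rw [inFrame_pull h lam (base_jetOf_mem_baseSet hp.1), proj_jetOf _ hp.1]
  rfl

theorem SmForm.smul (r : ℝ) {lam : OneForm 𝔄 k} (hl : SmForm lam) :
    SmForm (fun A => r • lam A : OneForm 𝔄 k) := fun c x₀ => (hl c x₀).const_smul r

theorem inFrame_sum {ι : Type*} (s : Finset ι) (lam : ι → OneForm 𝔄 k) (A : 𝔄.Jet k) :
    OneForm.inFrame c (fun A => ∑ i ∈ s, lam i A : OneForm 𝔄 k) A =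
      ∑ i ∈ s, (lam i).inFrame c A := by
  refine ContinuousLinearMap.ext fun z => ?_
  simp only [OneForm.inFrame, ContinuousLinearMap.comp_apply, sum_apply]

theorem SmForm.sum {ι : Type*} (s : Finset ι) {lam : ι → OneForm 𝔄 k}
    (hl : ∀ i ∈ s, SmForm (lam i)) : SmForm (fun A => ∑ i ∈ s, lam i A : OneForm 𝔄 k) :=
  fun c x₀ => (ContDiffOn.sum fun i hi => hl i hi c x₀).congr fun _ _ => inFrame_sum s lam _

/-- The components of the time derivative of a variation. -/
def shift (𝔄 : LieAlgebroid B F E) (c x₀ : M) (p : B × (Fin (k + 1) → F)) :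
    ETangent F (k + 1) →L[ℝ] ETangent F k :=
  ContinuousLinearMap.pi (fun r : Fin (k + 1) =>
    (ContinuousLinearMap.proj r.succ : ETangent F (k + 1) →L[ℝ] F)) -
  (ContinuousLinearMap.single ℝ (fun _ : Fin (k + 1) => F) 0).comp
    ((𝔄.locStr c x₀ p.1 (p.2 0)).comp (ContinuousLinearMap.proj 0))

theorem shift_apply (p : B × (Fin (k + 1) → F)) (z : ETangent F (k + 1)) :
    𝔄.shift c x₀ p z = Fin.cons (z 1 - 𝔄.locStr c x₀ p.1 (p.2 0) (z 0))
      (fun r : Fin k => z r.succ.succ) := by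
  funext r
  refine Fin.cases ?_ (fun r => ?_) r
  · simp [shift]
  · simp [shift]

namespace CurvePair

variable (P : CurvePair 𝔄 c x₀)

theorem hasDerivAt_Z (ht : t ∈ P.I) (k : ℕ) :
    HasDerivAt (P.Z k) (𝔄.shift c x₀ (P.ξ (k + 1) t) (P.Z (k + 1) t)) t := by
  rw [shift_apply, hasDerivAt_pi]
  refine fun r => Fin.cases ?_ (fun r => ?_) r
  · have h := P.w_deriv t ht
    simpa only [Z, ξ, Fin.cons_zero, Fin.val_zero, iteratedDeriv_zero, ← Fin.succ_zero_eq_one,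
      Fin.cons_succ] using h
  · exact hasDerivAt_iteratedDeriv P.isOpen P.ζ_smooth r ht

/-- The pairing of a `1`-form with the variation. -/
def pairing (lam : OneForm 𝔄 k) (t : ℝ) : ℝ := lam.inFrame c (𝔄.jetOf c x₀ (P.ξ k t)) (P.Z k t)

theorem pairing_gaugeChange (lam : OneForm 𝔄 k) (ht : t ∈ (P.gaugeChange c').I) :
    (P.gaugeChange c').pairing lam t = P.pairing lam t := by
  rw [pairing, pairing, P.jetOf_gaugeChange ht, ← changeFrame_Z P k ht]
  refine inFrame_changeFrame lam (base_jetOf_mem_baseSet (P.mem t ht.1)) ?_ _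
  rw [P.base_jetOf ht.1]
  exact ht.2.2.2

theorem hasDerivAt_pairing_coord {lam : OneForm 𝔄 k} (hl : SmForm lam) (ht : t ∈ P.I) :
    HasDerivAt (P.pairing lam)
      (𝔄.totD c x₀ (fun p => lam.inFrame c (𝔄.jetOf c x₀ p)) (P.ξ (k + 1) t)
          (cut F (Nat.le_succ k) (P.Z (k + 1) t)) +
        lam.inFrame c (𝔄.jetOf c x₀ (trunc B F (Nat.le_succ k) (P.ξ (k + 1) t)))
          (𝔄.shift c x₀ (P.ξ (k + 1) t) (P.Z (k + 1) t))) t := by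
  rw [cut_Z]
  exact (P.hasDerivAt_comp_ξ ht (hl.differentiableAt (P.mem t ht))).clm_apply (P.hasDerivAt_Z ht k)

end CurvePair

theorem contractT_jetOf (lam : OneForm 𝔄 k) {p : B × (Fin (k + 1) → F)}
    (hp : p.1 ∈ 𝔄.dom c x₀ univ) : contractT lam (𝔄.jetOf c x₀ p) =
      lam.inFrame c (𝔄.jetOf c x₀ (trunc B F (Nat.le_succ k) p)) p.2 := by
  have hb := base_jetOf_mem_baseSet hp
  have hq : proj (Nat.le_succ k) (𝔄.jetOf c x₀ p) =
    𝔄.jetOf c x₀ (trunc B F (Nat.le_succ k) p) := proj_jetOf _ hp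
  rw [contractT, canonicalT, ← changeFrame_coord hb (mem_baseSet_trivializationAt F E _), hq,
    coord_jetOf hp]
  rw [show base (𝔄.jetOf c x₀ p) = base (𝔄.jetOf c x₀ (trunc B F (Nat.le_succ k) p)) by
    rw [← hq, base_proj]]
  rfl

theorem SmForm.contractT {lam : OneForm 𝔄 k} (hl : SmForm lam) :
    SmOn univ (LieAlgebroid.contractT lam) := fun c x₀ =>
  (((hl c x₀).comp (trunc B F (Nat.le_succ k)).contDiff.contDiffOn
    (fun _ hp => ⟨hp.1, trivial⟩)).clm_apply contDiff_snd.contDiffOn).congr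
    fun _ hp => contractT_jetOf lam hp.1

/-- Cartan's formula in components. The derivative of the components of `λ` along `z`, evaluated on
`𝖳`, occurs in `d i_𝖳 λ` and with opposite sign in `i_𝖳 dλ`. What is left is the derivative along
`𝖳` and `λ` on the shifted vector corrected by the bracket. The hypothesis `hb` is there because
`dForm` is written in the preferred trivialization. -/
theorem OneForm.totalDeriv_jetOf_base {lam : OneForm 𝔄 k} (hl : SmForm lam)
    {p : B × (Fin (k + 1) → F)} (hp : p.1 ∈ 𝔄.dom c x₀ univ) (hb : base (𝔄.jetOf c x₀ p) = c)
    (z : ETangent F (k + 1)) : lam.totalDeriv (𝔄.jetOf c x₀ p) z =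
      𝔄.totD c x₀ (fun p => lam.inFrame c (𝔄.jetOf c x₀ p)) p (cut F (Nat.le_succ k) z) +
        lam.inFrame c (𝔄.jetOf c x₀ (trunc B F (Nat.le_succ k) p)) (𝔄.shift c x₀ p z) := by
  have hq : proj (Nat.le_succ k) (𝔄.jetOf c x₀ p) =
    𝔄.jetOf c x₀ (trunc B F (Nat.le_succ k) p) := proj_jetOf _ hp
  have hbq : base (𝔄.jetOf c x₀ (trunc B F (Nat.le_succ k) p)) = c := by rw [← hq, base_proj, hb]
  have hd := hl.differentiableAt (c := c) (x₀ := x₀) (p := trunc B F (Nat.le_succ k) p) hp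
  set q := trunc B F (Nat.le_succ k) p with hqd
  set Λ := fun p => lam.inFrame c (𝔄.jetOf c x₀ p) with hΛ
  have h1 : LieAlgebroid.dFun (contractT lam) (𝔄.jetOf c x₀ p) z =
      fderiv ℝ Λ q (𝔄.vvec c x₀ p.1 (cut F (Nat.le_succ k) z)) p.2 +
        Λ q (fun r => z r.succ) := by
    rw [LieAlgebroid.dFun, hb, along_smOn isOpen_univ hl.contractT hp]
    have h2 : (fun p => contractT lam (𝔄.jetOf c x₀ p)) =ᶠ[𝓝 p]
        fun p => Λ (trunc B F (Nat.le_succ k) p) p.2 := by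
      filter_upwards [((isOpen_dom isOpen_univ).prod isOpen_univ).mem_nhds
        (show p ∈ 𝔄.dom c x₀ univ ×ˢ univ from ⟨hp, trivial⟩)] with r hr
      exact contractT_jetOf lam hr.1
    have h3 : HasFDerivAt (fun p => Λ (trunc B F (Nat.le_succ k) p))
        ((fderiv ℝ Λ q).comp (trunc B F (Nat.le_succ k))) p :=
      HasFDerivAt.comp (g := Λ) p hd.hasFDerivAt (trunc B F (Nat.le_succ k)).hasFDerivAt
    have h4 := (h3.clm_apply (hasFDerivAt_snd (p := p))).congr_of_eventuallyEq h2
    rw [h4.fderiv]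
    exact add_comm _ _
  have h5 : ∀ v : ETangent F k, along c (lam.inFrame c) (𝔄.jetOf c x₀ q) v =
      fderiv ℝ Λ q (𝔄.vvec c x₀ p.1 v) := fun v => along_jetOf (p := q) hp hd v
  have h6 : lam (𝔄.jetOf c x₀ q) = Λ q :=
    (inFrame_of_base lam hbq).symm
  have h7 : contractTd lam (𝔄.jetOf c x₀ p) z =
      𝔄.totD c x₀ Λ p (cut F (Nat.le_succ k) z) -
        fderiv ℝ Λ q (𝔄.vvec c x₀ p.1 (cut F (Nat.le_succ k) z)) p.2 -
      Λ q (Pi.single 0 (𝔄.locStr c x₀ p.1 (p.2 0) (z 0))) := by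
    have h8 : canonicalT (𝔄.jetOf c x₀ p) = p.2 := by
      rw [canonicalT, hb, coord_jetOf hp]
    have h9 : contractTd lam (𝔄.jetOf c x₀ p) z =
      dForm lam (𝔄.jetOf c x₀ q) p.2 (cut F (Nat.le_succ k) z) := by
      rw [contractTd, ← hq, h8]
      rfl
    have h10 : 𝔄.structureMap c c (p.2 0) (z 0) = 𝔄.locStr c x₀ p.1 (p.2 0) (z 0) := by
      rw [locStr, ← base_jetOf hp, hb]
    rw [h9, dForm, hbq]
    simp only [sub_apply, ContinuousLinearMap.flip_apply, h5, h6]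
    rw [← h10]
    rfl
  change LieAlgebroid.dFun (contractT lam) (𝔄.jetOf c x₀ p) z +
    contractTd lam (𝔄.jetOf c x₀ p) z = _
  rw [h1, h7, shift, sub_apply, map_sub]
  change _ = 𝔄.totD c x₀ Λ p (cut F (Nat.le_succ k) z) + (Λ q (fun r => z r.succ) -
    Λ q (Pi.single 0 (𝔄.locStr c x₀ p.1 (p.2 0) (z 0))))
  abel

/-- The total time derivative of forms is the time derivative of pairings. -/
theorem CurvePair.hasDerivAt_pairing (P : CurvePair 𝔄 c x₀) {lam : OneForm 𝔄 k} (hl : SmForm lam)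
    (ht : t ∈ P.I) : HasDerivAt (P.pairing lam) (P.pairing lam.totalDeriv t) t := by
  -- At the fixed time `t` the pair is moved to the preferred trivialization, where the component
  -- formula is available. Pairings do not change under `gaugeChange`.
  obtain ⟨c', hc'⟩ : ∃ c', base (𝔄.jetOf c x₀ (P.ξ (k + 1) t)) = c' := ⟨_, rfl⟩
  have ht' : t ∈ (P.gaugeChange c').I := P.mem_gaugeChange ht ⟨(P.mem t ht).1, (P.mem t ht).2.1, by
    rw [← hc', ← P.base_jetOf ht (k + 1)]
    exact mem_baseSet_trivializationAt F E _⟩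
  rw [← P.pairing_gaugeChange _ ht']
  have hb : base (𝔄.jetOf c' x₀ ((P.gaugeChange c').ξ (k + 1) t)) = c' := by
    rw [P.jetOf_gaugeChange ht', hc']
  have h1 := (P.gaugeChange c').hasDerivAt_pairing_coord hl ht'
  rw [← OneForm.totalDeriv_jetOf_base hl ((P.gaugeChange c').mem t ht') hb] at h1
  have h2 : (P.gaugeChange c').pairing lam.totalDeriv t = lam.totalDeriv
      (𝔄.jetOf c' x₀ ((P.gaugeChange c').ξ (k + 1) t)) ((P.gaugeChange c').Z (k + 1) t) := by
    rw [pairing, inFrame_of_base _ hb]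
  rw [h2]
  refine h1.congr_of_eventuallyEq ?_
  filter_upwards [(P.gaugeChange c').isOpen.mem_nhds ht'] with s hs
  exact (P.pairing_gaugeChange lam hs).symm

/-- Removes the restriction on the frame: both sides are the derivative of the same pairing, so
uniqueness of derivatives suffices. -/
theorem OneForm.totalDeriv_jetOf {lam : OneForm 𝔄 k} (hl : SmForm lam)
    {p : B × (Fin (k + 1) → F)} (hp : p.1 ∈ 𝔄.dom c x₀ univ)
    (z : ETangent F (k + 1)) : lam.totalDeriv.inFrame c (𝔄.jetOf c x₀ p) z =
      𝔄.totD c x₀ (fun p => lam.inFrame c (𝔄.jetOf c x₀ p)) p (cut F (Nat.le_succ k) z) +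
        lam.inFrame c (𝔄.jetOf c x₀ (trunc B F (Nat.le_succ k) p)) (𝔄.shift c x₀ p z) := by
  obtain ⟨P, h0, rfl, rfl⟩ := CurvePair.exists_through (k + 1) hp z
  exact (P.hasDerivAt_pairing hl h0).unique (P.hasDerivAt_pairing_coord hl h0)

theorem contDiffOn_shift : ContDiffOn ℝ ∞ (𝔄.shift (k := k) c x₀) (𝔄.dom c x₀ univ ×ˢ univ) := by
  have h1 : ContDiffOn ℝ ∞ (fun p : B × (Fin (k + 1) → F) => 𝔄.locStr c x₀ p.1 (p.2 0))
      (𝔄.dom c x₀ univ ×ˢ univ) := (contDiffOn_locStr.comp contDiff_fst.contDiffOn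
    fun p hp => hp.1).clm_apply ((contDiff_apply ℝ F (0 : Fin (k + 1))).comp
      contDiff_snd).contDiffOn
  exact contDiffOn_const.sub (contDiffOn_const.clm_comp (h1.clm_comp contDiffOn_const))

theorem SmForm.totalDeriv {lam : OneForm 𝔄 k} (hl : SmForm lam) : SmForm lam.totalDeriv :=
  fun c x₀ => by
  refine (((contDiffOn_totD isOpen_univ (hl c x₀)).clm_comp
    (contDiffOn_const (c := cut F (Nat.le_succ k)))).add
    (((hl c x₀).comp (trunc B F (Nat.le_succ k)).contDiff.contDiffOn
    (fun _ hp => ⟨hp.1, trivial⟩)).clm_comp contDiffOn_shift)).congr fun p hp => ?_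
  exact ContinuousLinearMap.ext fun z => OneForm.totalDeriv_jetOf hl hp.1 z

theorem SmForm.totalDerivIter {lam : OneForm 𝔄 k} (hl : SmForm lam) (r : ℕ) :
    SmForm (lam.totalDerivIter r) := by
  induction r with
  | zero => exact hl
  | succ r ih => exact ih.totalDeriv

theorem CurvePair.pairing_totalDerivIter (P : CurvePair 𝔄 c x₀) {lam : OneForm 𝔄 k}
    (hl : SmForm lam) (r : ℕ) (ht : t ∈ P.I) :
    P.pairing (lam.totalDerivIter r) t = iteratedDeriv r (P.pairing lam) t := by
  induction r generalizing t with
  | zero => rfl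
  | succ r ih =>
    rw [iteratedDeriv_succ]
    have he : iteratedDeriv r (P.pairing lam) =ᶠ[𝓝 t] P.pairing (lam.totalDerivIter r) := by
      filter_upwards [P.isOpen.mem_nhds ht] with s hs using (ih hs).symm
    rw [he.deriv_eq]
    exact (P.hasDerivAt_pairing (hl.totalDerivIter r) ht).deriv.symm

theorem CurvePair.pairing_pull (P : CurvePair 𝔄 c x₀) (h : l ≤ k) (lam : OneForm 𝔄 l)
    (ht : t ∈ P.I) : P.pairing (lam.pull h) t = P.pairing lam t := by
  rw [pairing, inFrame_pull h lam (base_jetOf_mem_baseSet (P.mem t ht)), proj_jetOf _ (P.mem t ht),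
    ContinuousLinearMap.comp_apply, cut_Z]
  rfl

theorem CurvePair.contDiffOn_pairing (P : CurvePair 𝔄 c x₀) {lam : OneForm 𝔄 k}
    (hl : SmForm lam) : ContDiffOn ℝ ∞ (P.pairing lam) P.I :=
  ((hl c x₀).comp (P.contDiffOn_ξ k) fun t ht => ⟨P.mem t ht, trivial⟩).clm_apply
    (P.contDiffOn_Z k)

end Forms

/-! ### Variations of a given curve -/

section Variations

variable {𝔄} [FiniteDimensional ℝ F] [FiniteDimensional ℝ B] [T2Space M] {c c' x₀ : M}
  {k l : ℕ} {t : ℝ}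

namespace CurvePair

variable (P : CurvePair 𝔄 c x₀)

/-- The variation of a given admissible curve with prescribed component along `E`. -/
def withW (w : ℝ → F) (hw : ContDiffOn ℝ ∞ w P.I) : CurvePair 𝔄 c x₀ where
  I := P.I
  isOpen := P.isOpen
  x := P.x
  y := P.y
  w := w
  ζ := fun t => deriv w t + 𝔄.locStr c x₀ (P.x t) (P.y t) (w t)
  x_smooth := P.x_smooth
  y_smooth := P.y_smooth
  w_smooth := hw
  ζ_smooth := ((contDiffOn_infty_iff_deriv_of_isOpen P.isOpen).1 hw).2.add
    (((contDiffOn_locStr.comp P.x_smooth P.mem).clm_apply P.y_smooth).clm_apply hw)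
  mem := P.mem
  x_deriv := P.x_deriv
  w_deriv := fun t ht => by
    rw [add_sub_cancel_right]
    exact ((hw.contDiffAt (P.isOpen.mem_nhds ht)).differentiableAt (by simp)).hasDerivAt

/-- The variation multiplied by the function `s - t`. -/
def timesTime (t : ℝ) : CurvePair 𝔄 c x₀ :=
  P.withW (fun s => (s - t) • P.w s) ((contDiff_id.sub contDiff_const).contDiffOn.smul P.w_smooth)

theorem contDiffAt_locStr_apply {u : B} (hu : u ∈ 𝔄.dom c x₀ univ) (f g : F) :
    ContDiffAt ℝ ∞ (fun q : B × F × F => 𝔄.locStr c x₀ q.1 q.2.1 q.2.2) (u, f, g) := by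
  have h : ContDiffAt ℝ ∞ (𝔄.locStr c x₀) u := contDiffOn_locStr.contDiffAt (dom_nhds hu)
  exact ((h.comp (u, f, g) contDiffAt_fst).clm_apply (contDiffAt_fst.comp _ contDiffAt_snd)).clm_apply
    (contDiffAt_snd.comp _ contDiffAt_snd)

theorem ζ_eq (ht : t ∈ P.I) : P.ζ t = deriv P.w t + 𝔄.locStr c x₀ (P.x t) (P.y t) (P.w t) := by
  rw [(P.w_deriv t ht).deriv, sub_add_cancel]

theorem iteratedDeriv_ζ (ht : t ∈ P.I) (j : ℕ) : iteratedDeriv j P.ζ t =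
    iteratedDeriv (j + 1) P.w t +
      iteratedDeriv j (fun s => 𝔄.locStr c x₀ (P.x s) (P.y s) (P.w s)) t := by
  have hI := P.isOpen.mem_nhds ht
  have he : P.ζ =ᶠ[𝓝 t] fun s => deriv P.w s + 𝔄.locStr c x₀ (P.x s) (P.y s) (P.w s) := by
    filter_upwards [hI] with s hs using P.ζ_eq hs
  have h1 := ((contDiffOn_infty_iff_deriv_of_isOpen P.isOpen).1 P.w_smooth).2
  have h2 := ((contDiffOn_locStr.comp P.x_smooth P.mem).clm_apply P.y_smooth).clm_apply P.w_smooth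
  rw [he.iteratedDeriv_eq j, iteratedDeriv_succ']
  exact iteratedDeriv_fun_add ((h1.contDiffAt hI).of_le (by exact_mod_cast le_top))
    ((h2.contDiffAt hI).of_le (by exact_mod_cast le_top))

/-- The components of a variation are determined by the derivatives of its component along `E`. -/
theorem Z_eq_of_w {P Q : CurvePair 𝔄 c x₀} (hP : t ∈ P.I) (hQ : t ∈ Q.I) (hx : P.x = Q.x)
    (hy : P.y = Q.y) (hw : ∀ j ≤ k, iteratedDeriv j P.w t = iteratedDeriv j Q.w t) :
    P.Z k t = Q.Z k t := by
  funext r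
  refine Fin.cases ?_ (fun r => ?_) r
  · simpa [Z] using hw 0 (Nat.zero_le _)
  · have hle : ((r : ℕ) : WithTop ℕ∞) ≤ ∞ := by exact_mod_cast le_top
    have hIP := P.isOpen.mem_nhds hP
    have hIQ := Q.isOpen.mem_nhds hQ
    have hxP := (P.x_smooth.contDiffAt hIP).of_le hle
    have hyP := (P.y_smooth.contDiffAt hIP).of_le hle
    have hwP := (P.w_smooth.contDiffAt hIP).of_le hle
    have hwQ := (Q.w_smooth.contDiffAt hIQ).of_le hle
    change iteratedDeriv r P.ζ t = iteratedDeriv r Q.ζ t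
    rw [P.iteratedDeriv_ζ hP, Q.iteratedDeriv_ζ hQ, hw _ (Nat.succ_le_of_lt r.2), ← hx, ← hy]
    congr 1
    refine iteratedDeriv_comp_congr (n := r)
      (h := fun q : B × F × F => 𝔄.locStr c x₀ q.1 q.2.1 q.2.2)
      (f₁ := fun s => (P.x s, P.y s, P.w s)) (f₂ := fun s => (P.x s, P.y s, Q.w s))
      ((contDiffAt_locStr_apply (P.mem t hP) _ _).of_le hle) (hxP.prodMk (hyP.prodMk hwP))
      (hxP.prodMk (hyP.prodMk hwQ)) (fun j hj => ?_) le_rfl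
    rw [iteratedDeriv_prodMk hxP (hyP.prodMk hwP) hj, iteratedDeriv_prodMk hxP (hyP.prodMk hwQ) hj,
      iteratedDeriv_prodMk hyP hwP hj, iteratedDeriv_prodMk hyP hwQ hj,
      hw j (hj.trans r.2.le)]

end CurvePair

/-- The derivatives of the component of a variation along `E`, as functions of the components of the
variation of the jets. -/
def wJet (𝔄 : LieAlgebroid B F E) (c x₀ : M) :
    (j : ℕ) → B × (Fin j → F) → (ETangent F j →L[ℝ] F)
  | 0 => fun _ => ContinuousLinearMap.proj 0
  | j + 1 => fun p => (𝔄.totD c x₀ (wJet 𝔄 c x₀ j) p).comp (cut F (Nat.le_succ j)) +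
      (wJet 𝔄 c x₀ j (trunc B F (Nat.le_succ j) p)).comp (𝔄.shift c x₀ p)

theorem contDiffOn_wJet (j : ℕ) :
    ContDiffOn ℝ ∞ (𝔄.wJet c x₀ j) (𝔄.dom c x₀ univ ×ˢ univ) := by
  induction j with
  | zero => exact contDiffOn_const
  | succ j ih =>
    exact ((contDiffOn_totD isOpen_univ ih).clm_comp
      (contDiffOn_const (c := cut F (Nat.le_succ j)))).add
      ((ih.comp (trunc B F (Nat.le_succ j)).contDiff.contDiffOn
      (fun _ hp => ⟨hp.1, trivial⟩)).clm_comp contDiffOn_shift)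

/-- The recursion defining `wJet` is the product rule for differentiating `wJet` at `ξ` applied to
`Z`. -/
theorem CurvePair.iteratedDeriv_w (P : CurvePair 𝔄 c x₀) (j : ℕ) (ht : t ∈ P.I) :
    iteratedDeriv j P.w t = 𝔄.wJet c x₀ j (P.ξ j t) (P.Z j t) := by
  induction j generalizing t with
  | zero => rfl
  | succ j ih =>
    rw [iteratedDeriv_succ]
    have he : iteratedDeriv j P.w =ᶠ[𝓝 t] fun s => 𝔄.wJet c x₀ j (P.ξ j s) (P.Z j s) := by
      filter_upwards [P.isOpen.mem_nhds ht] with s hs using ih hs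
    have hd : DifferentiableAt ℝ (𝔄.wJet c x₀ j) (P.ξ j t) :=
      ((contDiffOn_wJet j).contDiffAt (((isOpen_dom isOpen_univ).prod isOpen_univ).mem_nhds
        ⟨P.mem t ht, trivial⟩)).differentiableAt (by simp)
    rw [he.deriv_eq, ((P.hasDerivAt_comp_ξ ht hd).clm_apply (P.hasDerivAt_Z ht j)).deriv, wJet,
      add_apply, ContinuousLinearMap.comp_apply, P.cut_Z]
    rfl

/-- The transpose of the vertical endomorphism in coordinates. -/
def vertMap (𝔄 : LieAlgebroid B F E) (c x₀ : M) (p : B × (Fin k → F)) :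
    ETangent F k →L[ℝ] ETangent F k :=
  ContinuousLinearMap.pi (Fin.cons 0 fun r : Fin k =>
    (𝔄.wJet c x₀ r (trunc B F r.2.le p)).comp (cut F r.2.le) +
      (r : ℝ) • (ContinuousLinearMap.proj r.castSucc : ETangent F k →L[ℝ] F))

theorem contDiffOn_vertMap :
    ContDiffOn ℝ ∞ (𝔄.vertMap (k := k) c x₀) (𝔄.dom c x₀ univ ×ˢ univ) := by
  rw [contDiffOn_clm_apply]
  intro z
  refine contDiffOn_pi.2 fun r => Fin.cases ?_ (fun r => ?_) r
  · exact contDiffOn_const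
  · exact (((contDiffOn_wJet r).comp (trunc B F r.2.le).contDiff.contDiffOn
      (fun _ hp => ⟨hp.1, trivial⟩)).clm_apply contDiffOn_const).add contDiffOn_const

/-- For the component `(s - t₀) w` the induced variation is `w + (s - t₀) ζ`. Its `r`-th derivative
contains the `r`-th derivative of `w` and `r` times the derivative of `ζ` of order `r - 1`, which is
the definition of `vertMap`. -/
theorem CurvePair.Z_timesTime (P : CurvePair 𝔄 c x₀) (t₀ : ℝ) (ht : t ∈ P.I) :
    (P.timesTime t₀).Z k t = 𝔄.vertMap c x₀ (P.ξ k t) (P.Z k t) + (t - t₀) • P.Z k t := by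
  have hI := P.isOpen.mem_nhds ht
  funext r
  refine Fin.cases ?_ (fun r => ?_) r
  · change (t - t₀) • P.w t = 0 + (t - t₀) • P.w t
    rw [zero_add]
  · have he : (P.timesTime t₀).ζ =ᶠ[𝓝 t] fun s => P.w s + (s - t₀) • P.ζ s := by
      filter_upwards [hI] with s hs
      have h1 : HasDerivAt (fun s => (s - t₀) • P.w s) _ s :=
        ((hasDerivAt_id' s).sub_const t₀).smul (P.w_deriv s hs)
      change deriv (fun s => (s - t₀) • P.w s) s +
        𝔄.locStr c x₀ (P.x s) (P.y s) ((s - t₀) • P.w s) = _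
      rw [h1.deriv, map_smul, smul_sub, one_smul]
      abel
    have hs : ContDiffOn ℝ ∞ (fun s => (s - t₀) • P.ζ s) P.I :=
      (contDiff_id.sub contDiff_const).contDiffOn.smul P.ζ_smooth
    change iteratedDeriv r (P.timesTime t₀).ζ t =
      𝔄.wJet c x₀ r (P.ξ r t) (cut F r.2.le (P.Z k t)) + (r : ℝ) • P.Z k t r.castSucc +
        (t - t₀) • iteratedDeriv r P.ζ t
    rw [he.iteratedDeriv_eq, iteratedDeriv_fun_add
      ((P.w_smooth.contDiffAt hI).of_le (by exact_mod_cast le_top))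
      ((hs.contDiffAt hI).of_le (by exact_mod_cast le_top)), P.iteratedDeriv_w r ht, P.cut_Z,
      iteratedDeriv_sub_smul P.isOpen P.ζ_smooth t₀ r ht, add_assoc,
      add_comm (((r : ℕ) : ℝ) • P.Z k t r.castSucc)]
    congr 2
    -- For `r = 0` the entry `r.castSucc` of `Z` is `w` rather than a derivative of `ζ`, but its
    -- coefficient is zero.
    obtain ⟨r, hr⟩ := r
    cases r with
    | zero => simp
    | succ r => rfl

theorem CurvePair.Z_timesTime_self (P : CurvePair 𝔄 c x₀) (ht : t ∈ P.I) :
    (P.timesTime t).Z k t = 𝔄.vertMap c x₀ (P.ξ k t) (P.Z k t) := by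
  rw [P.Z_timesTime t ht, sub_self, zero_smul, add_zero]

/-- The transpose of the vertical endomorphism shifts the components. -/
theorem vertMap_eq_zero {p : B × (Fin k → F)} {z : ETangent F k} {n : ℕ}
    (hz : ∀ r : Fin (k + 1), (r : ℕ) < n → z r = 0) (r : Fin (k + 1)) (hr : (r : ℕ) < n + 1) :
    𝔄.vertMap c x₀ p z r = 0 := by
  revert hr
  refine Fin.cases (fun _ => rfl) (fun r hr => ?_) r
  have hr' : (r : ℕ) < n := by simpa using hr
  have h1 : cut F r.2.le z = 0 := by
    funext i
    exact hz _ (lt_of_le_of_lt (Nat.lt_succ_iff.1 i.2) hr')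
  change 𝔄.wJet c x₀ r _ (cut F r.2.le z) + (r : ℝ) • z r.castSucc = 0
  rw [h1, map_zero, hz r.castSucc (by simpa using hr'), smul_zero, add_zero]

/-- Each application makes one more leading component vanish, and there are `k + 1` components. -/
theorem vertMap_iterate_eq_zero (p : B × (Fin k → F)) (z : ETangent F k) :
    (𝔄.vertMap c x₀ p)^[k + 1] z = 0 := by
  have h : ∀ (n : ℕ) (r : Fin (k + 1)), (r : ℕ) < n → (𝔄.vertMap c x₀ p)^[n] z r = 0 := by
    intro n
    induction n with
    | zero => intro r hr; omega
    | succ n ih =>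
      intro r hr
      rw [Function.iterate_succ_apply']
      exact vertMap_eq_zero ih r hr
  exact funext fun r => h _ r r.2

end Variations

/-! ### The vertical endomorphism -/

section VerticalEndomorphism

variable {𝔄} {c c' x₀ : M} {k l : ℕ} {t : ℝ}

/-- The components of a section of `E^*`. -/
def locForm (_ : LieAlgebroid B F E) (c x₀ : M) (θ : ∀ x : M, E x →L[ℝ] ℝ) (u : B) : F →L[ℝ] ℝ :=
  (θ ((extChartAt 𝓘(ℝ, B) x₀).symm u)).comp
    ((trivializationAt F E c).symmL ℝ ((extChartAt 𝓘(ℝ, B) x₀).symm u))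

/-- Supplies global forms with constant components near a point, which are used to detect the
derivatives of `w` in `eq_zero_of_basicForm`. -/
theorem exists_coform [FiniteDimensional ℝ B] [T2Space M] {x : M}
    (hx : x ∈ (trivializationAt F E c).baseSet) (f : F →L[ℝ] ℝ) :
    ∃ θ : ∀ x : M, E x →L[ℝ] ℝ,
      ContMDiff (𝓘(ℝ, B).prod 𝓘(ℝ, F)) 𝓘(ℝ, ℝ) ∞ (fun v : TotalSpace F E => θ v.1 v.2) ∧
      ∀ᶠ y in 𝓝 x, θ y = f.comp ((trivializationAt F E c).continuousLinearMapAt ℝ y) := by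
  obtain ⟨ψ, hψ, hψ1, hψt⟩ := exists_bump (B := B)
    ((trivializationAt F E c).open_baseSet.mem_nhds hx)
  refine ⟨fun y => ψ y • f.comp ((trivializationAt F E c).continuousLinearMapAt ℝ y), fun v => ?_, ?_⟩
  · by_cases hv : v.1 ∈ (trivializationAt F E c).baseSet
    · have h1 : ContMDiffAt (𝓘(ℝ, B).prod 𝓘(ℝ, F)) 𝓘(ℝ, F) ∞
          (fun v : TotalSpace F E => (trivializationAt F E c v).2) v :=
        (((trivializationAt F E c).contMDiffAt_iff (IB := 𝓘(ℝ, B)) (n := ∞) (f := id)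
          (by rwa [Trivialization.mem_source])).1 contMDiffAt_id).2
      have h2 : ContMDiffAt (𝓘(ℝ, B).prod 𝓘(ℝ, F)) 𝓘(ℝ, ℝ) ∞
          (fun v : TotalSpace F E => ψ v.1) v :=
        hψ.contMDiffAt.comp v (Bundle.contMDiffAt_proj E)
      refine (h2.smul (f.contMDiff.contMDiffAt.comp v h1)).congr_of_eventuallyEq ?_
      filter_upwards [(FiberBundle.continuous_proj F E).continuousAt.preimage_mem_nhds
        ((trivializationAt F E c).open_baseSet.mem_nhds hv)] with w hw
      change ψ w.1 • f ((trivializationAt F E c).continuousLinearMapAt ℝ w.1 w.2) = _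
      rw [Trivialization.continuousLinearMapAt_apply_of_mem ℝ _ hw]
      rfl
    · refine (contMDiffAt_const (c := (0 : ℝ))).congr_of_eventuallyEq ?_
      have hv' : v.1 ∈ (tsupport ψ)ᶜ := fun h => hv (hψt h)
      filter_upwards [(FiberBundle.continuous_proj F E).continuousAt.preimage_mem_nhds
        ((isClosed_tsupport ψ).isOpen_compl.mem_nhds hv')] with w hw
      change ψ w.1 • _ = (0 : ℝ)
      rw [image_eq_zero_of_notMem_tsupport hw, zero_smul]
  · filter_upwards [hψ1] with y hy
    rw [hy, one_smul]

variable [FiniteDimensional ℝ F]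

theorem contDiffOn_locForm {θ : ∀ x : M, E x →L[ℝ] ℝ}
    (hθ : ContMDiff (𝓘(ℝ, B).prod 𝓘(ℝ, F)) 𝓘(ℝ, ℝ) ∞ (fun v : TotalSpace F E => θ v.1 v.2)) :
    ContDiffOn ℝ ∞ (𝔄.locForm c x₀ θ) (𝔄.dom c x₀ univ) := by
  rw [contDiffOn_clm_apply]
  intro f
  have h1 : ContMDiffOn 𝓘(ℝ, B) (𝓘(ℝ, B).prod 𝓘(ℝ, F)) ∞
      (fun x => (trivializationAt F E c).toOpenPartialHomeomorph.symm (x, f))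
      (trivializationAt F E c).baseSet := by
    refine ((trivializationAt F E c).contMDiffOn_symm (IB := 𝓘(ℝ, B)) (n := ∞)).comp
      (contMDiffOn_id.prodMk contMDiffOn_const) fun x hx => ?_
    rw [(trivializationAt F E c).target_eq]
    exact ⟨hx, trivial⟩
  refine ((contDiffOn_comp_extChartAt_symm (x₀ := x₀) (hθ.comp_contMDiffOn h1)).mono
    fun u hu => ⟨hu.1, hu.2.1⟩).congr fun u hu => ?_
  change θ _ ((trivializationAt F E c).symmL ℝ _ f) = _
  rw [Trivialization.symmL_apply _ hu.2.1]
  dsimp only [Function.comp_def]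
  rw [← Trivialization.mk_symm _ hu.2.1]

variable [FiniteDimensional ℝ B] [T2Space M]

theorem basicForm_jetOf (θ : ∀ x : M, E x →L[ℝ] ℝ) {p : B × (Fin 0 → F)}
    (hp : p.1 ∈ 𝔄.dom c x₀ univ) (z : ETangent F 0) :
    (basicForm 𝔄 θ).inFrame c (𝔄.jetOf c x₀ p) z = 𝔄.locForm c x₀ θ p.1 (z 0) := by
  have hb := base_jetOf hp
  change θ (base (𝔄.jetOf c x₀ p)) ((trivializationAt F E (base (𝔄.jetOf c x₀ p))).symmL ℝ
    (base (𝔄.jetOf c x₀ p)) ((trivializationAt F E (base (𝔄.jetOf c x₀ p))).continuousLinearMapAt ℝ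
    (base (𝔄.jetOf c x₀ p)) ((trivializationAt F E c).symmL ℝ (base (𝔄.jetOf c x₀ p)) (z 0)))) = _
  rw [Trivialization.symmL_continuousLinearMapAt _ (mem_baseSet_trivializationAt F E _), hb]
  rfl

theorem smForm_basicForm {θ : ∀ x : M, E x →L[ℝ] ℝ}
    (hθ : ContMDiff (𝓘(ℝ, B).prod 𝓘(ℝ, F)) 𝓘(ℝ, ℝ) ∞ (fun v : TotalSpace F E => θ v.1 v.2)) :
    SmForm (basicForm 𝔄 θ) := fun _ _ =>
  (((contDiffOn_locForm hθ).comp contDiff_fst.contDiffOn fun _ hp => hp.1).clm_comp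
    (contDiffOn_const (c := (ContinuousLinearMap.proj 0 : ETangent F 0 →L[ℝ] F)))).congr
    fun _ hp => ContinuousLinearMap.ext fun z => basicForm_jetOf θ hp.1 z

theorem CurvePair.pairing_basicForm (P : CurvePair 𝔄 c x₀) (θ : ∀ x : M, E x →L[ℝ] ℝ)
    (ht : t ∈ P.I) : P.pairing (basicForm 𝔄 θ) t = 𝔄.locForm c x₀ θ (P.x t) (P.w t) :=
  basicForm_jetOf θ (P.mem t ht) _

theorem CurvePair.pairing_totalDerivIter_pull (P : CurvePair 𝔄 c x₀) {θ : ∀ x : M, E x →L[ℝ] ℝ}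
    (hθ : ContMDiff (𝓘(ℝ, B).prod 𝓘(ℝ, F)) 𝓘(ℝ, ℝ) ∞ (fun v : TotalSpace F E => θ v.1 v.2))
    {r : ℕ} (hr : 0 + r ≤ k) (ht : t ∈ P.I) :
    P.pairing (((basicForm 𝔄 θ).totalDerivIter r).pull hr) t =
      iteratedDeriv r (fun s => 𝔄.locForm c x₀ θ (P.x s) (P.w s)) t := by
  rw [P.pairing_pull hr _ ht, P.pairing_totalDerivIter (smForm_basicForm hθ) r ht]
  refine Filter.EventuallyEq.iteratedDeriv_eq r ?_
  filter_upwards [P.isOpen.mem_nhds ht] with s hs using P.pairing_basicForm θ hs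

/-- The defining property of the vertical endomorphism. -/
theorem comp_vertMap {p : B × (Fin k → F)} (hp : p.1 ∈ 𝔄.dom c x₀ univ)
    {θ : ∀ x : M, E x →L[ℝ] ℝ}
    (hθ : ContMDiff (𝓘(ℝ, B).prod 𝓘(ℝ, F)) 𝓘(ℝ, ℝ) ∞ (fun v : TotalSpace F E => θ v.1 v.2))
    {r : ℕ} (hr : 0 + r ≤ k) (hr' : 0 + (r - 1) ≤ k) :
    ((((basicForm 𝔄 θ).totalDerivIter r).pull hr).inFrame c (𝔄.jetOf c x₀ p)).comp
      (𝔄.vertMap c x₀ p) =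
    (r : ℝ) • (((basicForm 𝔄 θ).totalDerivIter (r - 1)).pull hr').inFrame c
      (𝔄.jetOf c x₀ p) := by
  refine ContinuousLinearMap.ext fun z => ?_
  obtain ⟨P, h0, rfl, rfl⟩ := CurvePair.exists_through k hp z
  rw [ContinuousLinearMap.comp_apply, ← P.Z_timesTime_self h0]
  refine ((P.timesTime 0).pairing_totalDerivIter_pull hθ hr h0).trans ?_
  change iteratedDeriv r (fun s => 𝔄.locForm c x₀ θ (P.x s) ((s - 0) • P.w s)) 0 =
    (r : ℝ) • P.pairing (((basicForm 𝔄 θ).totalDerivIter (r - 1)).pull hr') 0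
  rw [P.pairing_totalDerivIter_pull hθ hr' h0]
  simp only [map_smul]
  have hs : ContDiffOn ℝ ∞ (fun s => 𝔄.locForm c x₀ θ (P.x s) (P.w s)) P.I :=
    ((contDiffOn_locForm hθ).comp P.x_smooth P.mem).clm_apply P.w_smooth
  -- The factor `r` of the vertical endomorphism is the Leibniz factor from differentiating `s · ⟨θ,
  -- w⟩` at `s = 0`.
  rw [iteratedDeriv_sub_smul P.isOpen hs 0 r h0, sub_self, zero_smul, zero_add]

/-- The forms `d_𝖳^r θ` separate the vectors. -/
theorem eq_zero_of_basicForm {p : B × (Fin k → F)} (hp : p.1 ∈ 𝔄.dom c x₀ univ) {z : ETangent F k}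
    (h : ∀ θ : ∀ x : M, E x →L[ℝ] ℝ,
      ContMDiff (𝓘(ℝ, B).prod 𝓘(ℝ, F)) 𝓘(ℝ, ℝ) ∞ (fun v : TotalSpace F E => θ v.1 v.2) →
      ∀ (r : ℕ) (hr : 0 + r ≤ k),
      (((basicForm 𝔄 θ).totalDerivIter r).pull hr).inFrame c (𝔄.jetOf c x₀ p) z = 0) : z = 0 := by
  obtain ⟨P, h0, rfl, rfl⟩ := CurvePair.exists_through k hp z
  -- The comparison with the zero variation of the same curve reduces the claim, through
  -- `Z_eq_of_w`, to the vanishing of the derivatives of `w`.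
  set Q := P.withW (fun _ => 0) contDiffOn_const with hQ
  have hQZ : Q.Z k 0 = 0 := by
    have hζ : Q.ζ = fun _ => 0 := by
      funext s
      simp [hQ, CurvePair.withW]
    funext r
    refine Fin.cases rfl (fun r => ?_) r
    change iteratedDeriv r Q.ζ 0 = 0
    rw [hζ]
    simp
  rw [← hQZ]
  refine CurvePair.Z_eq_of_w h0 h0 rfl rfl fun j hj => ?_
  have hQw : iteratedDeriv j Q.w 0 = 0 := by
    change iteratedDeriv j (fun _ => (0 : F)) 0 = 0
    simp
  rw [hQw]
  -- A functional `f` detecting a nonzero derivative extends to `θ` with constant components;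
  -- pairing its `j`-th total derivative then gives `f` of that derivative.
  by_contra hne
  obtain ⟨f, hf⟩ := SeparatingDual.exists_ne_zero (R := ℝ) hne
  obtain ⟨θ, hθ, hθe⟩ := exists_coform (B := B) (P.mem 0 h0).2.1 f
  refine hf ?_
  have h1 := (P.pairing_totalDerivIter_pull hθ (k := k) (r := j) (by omega) h0).symm.trans
    (h θ hθ j (by omega))
  have h2 : (fun s => 𝔄.locForm c x₀ θ (P.x s) (P.w s)) =ᶠ[𝓝 0] fun s => f (P.w s) := by
    have hc : ContinuousAt (fun s => (extChartAt 𝓘(ℝ, B) x₀).symm (P.x s)) 0 :=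
      ((continuousOn_extChartAt_symm x₀).continuousAt
        ((isOpen_extChartAt_target x₀).mem_nhds (P.mem 0 h0).1)).comp
        (P.x_deriv 0 h0).continuousAt
    filter_upwards [hc.eventually hθe, P.isOpen.mem_nhds h0] with s hs hsI
    rw [locForm, hs, ContinuousLinearMap.comp_apply, ContinuousLinearMap.comp_apply,
      Trivialization.continuousLinearMapAt_symmL _ (P.mem s hsI).2.1]
  rw [h2.iteratedDeriv_eq] at h1
  refine Eq.trans ?_ h1
  have h3 := f.iteratedFDeriv_comp_left ((P.w_smooth.contDiffAt (P.isOpen.mem_nhds h0)))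
    (i := j) (by exact_mod_cast le_top)
  simp only [iteratedDeriv]
  rw [show (fun s => f (P.w s)) = f ∘ P.w from rfl, h3]
  rfl

/-- Composition with `vertMap` has the defining property, so the `dif` is in its first branch. The
map chosen there is the same one because the forms `d_𝖳^r θ` span the dual of the fibre. -/
theorem vertEndoAt_eq {p : B × (Fin k → F)} (hp : p.1 ∈ 𝔄.dom c x₀ univ)
    (hb : base (𝔄.jetOf c x₀ p) = c) (μ : ETangent F k →L[ℝ] ℝ) :
    vertEndoAt (𝔄.jetOf c x₀ p) μ = μ.comp (𝔄.vertMap c x₀ p) := by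
  have hex : ∃ S : (ETangent F k →L[ℝ] ℝ) →ₗ[ℝ] (ETangent F k →L[ℝ] ℝ),
      ∀ θ : ∀ x : M, E x →L[ℝ] ℝ,
        ContMDiff (𝓘(ℝ, B).prod 𝓘(ℝ, F)) 𝓘(ℝ, ℝ) ∞ (fun v : TotalSpace F E => θ v.1 v.2) →
        ∀ (r : ℕ) (hr : r ≤ k),
          S (((basicForm 𝔄 θ).totalDerivIter r).pull (show 0 + r ≤ k by omega) (𝔄.jetOf c x₀ p)) =
            (r : ℝ) • ((basicForm 𝔄 θ).totalDerivIter (r - 1)).pull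
              (show 0 + (r - 1) ≤ k by omega) (𝔄.jetOf c x₀ p) := by
    refine ⟨⟨⟨fun μ => μ.comp (𝔄.vertMap c x₀ p), fun _ _ => rfl⟩, fun _ _ => rfl⟩,
      fun θ hθ r hr => ?_⟩
    have h := comp_vertMap hp hθ (r := r) (show 0 + r ≤ k by omega) (by omega)
    rwa [inFrame_of_base _ hb, inFrame_of_base _ hb] at h
  rw [vertEndoAt, dif_pos hex]
  set S := hex.choose with hS
  have hspec := hex.choose_spec
  rw [← hS] at hspec
  set N : (ETangent F k →L[ℝ] ℝ) →ₗ[ℝ] (ETangent F k →L[ℝ] ℝ) :=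
    ⟨⟨fun μ => μ.comp (𝔄.vertMap c x₀ p), fun _ _ => rfl⟩, fun _ _ => rfl⟩ with hN
  suffices LinearMap.eqLocus S N = ⊤ from
    (by rw [this]; trivial : μ ∈ LinearMap.eqLocus S N)
  -- If the two maps agreed only on a proper subspace, a nonzero functional would vanish on it. In
  -- finite dimension this functional is evaluation at some `z`, and `z` is annihilated by all
  -- `d_𝖳^r θ`.
  by_contra hne
  obtain ⟨f, hf0, hf⟩ := Submodule.exists_le_ker_of_lt_top _ (lt_top_iff_ne_top.2 hne)
  set ev : Module.Dual ℝ (Module.Dual ℝ (ETangent F k)) :=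
    f.comp (LinearMap.toContinuousLinearMap : (ETangent F k →ₗ[ℝ] ℝ) ≃ₗ[ℝ] _).toLinearMap with hev
  set z := (Module.evalEquiv ℝ (ETangent F k)).symm ev with hz
  have hfz : ∀ μ : ETangent F k →L[ℝ] ℝ, f μ = μ z := fun μ => by
    have h1 : ev (μ : ETangent F k →ₗ[ℝ] ℝ) = f μ := rfl
    rw [← h1, hz]
    exact (Module.apply_evalEquiv_symm_apply ℝ (ETangent F k) (μ : ETangent F k →ₗ[ℝ] ℝ) ev).symm
  have hz0 : z = 0 := eq_zero_of_basicForm hp fun θ hθ r hr => by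
    rw [inFrame_of_base _ hb, ← hfz]
    refine hf ?_
    change S _ = N _
    rw [hspec θ hθ r (by omega)]
    have h := comp_vertMap hp hθ (r := r) hr (by omega)
    rw [inFrame_of_base _ hb, inFrame_of_base _ hb] at h
    exact h.symm
  exact hf0 (LinearMap.ext fun μ => by rw [hfz, hz0, map_zero]; rfl)

/-- The vertical endomorphism is transposed to the multiplication of variations by the time. -/
theorem CurvePair.pairing_vertEndo (P : CurvePair 𝔄 c x₀) (lam : OneForm 𝔄 k) (ht : t ∈ P.I) :
    P.pairing (vertEndo lam) t = (P.timesTime t).pairing lam t := by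
  obtain ⟨c', hc'⟩ : ∃ c', base (𝔄.jetOf c x₀ (P.ξ k t)) = c' := ⟨_, rfl⟩
  have ht' : t ∈ (P.gaugeChange c').I := P.mem_gaugeChange ht ⟨(P.mem t ht).1, (P.mem t ht).2.1, by
    rw [← hc', ← P.base_jetOf ht k]
    exact mem_baseSet_trivializationAt F E _⟩
  have hb : base (𝔄.jetOf c' x₀ ((P.gaugeChange c').ξ k t)) = c' := by
    rw [P.jetOf_gaugeChange ht', hc']
  rw [← P.pairing_gaugeChange _ ht', ← (P.timesTime t).pairing_gaugeChange (c' := c') _ ht']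
  have h1 : (P.gaugeChange c').pairing (vertEndo lam) t =
      ((P.gaugeChange c').timesTime t).pairing lam t := by
    change _ = lam.inFrame c' (𝔄.jetOf c' x₀ ((P.gaugeChange c').ξ k t))
      (((P.gaugeChange c').timesTime t).Z k t)
    rw [pairing, inFrame_of_base _ hb, inFrame_of_base _ hb, vertEndo,
      vertEndoAt_eq ((P.gaugeChange c').mem t ht') hb, (P.gaugeChange c').Z_timesTime_self ht']
    rfl
  rw [h1]
  change lam.inFrame c' _ _ = lam.inFrame c' _ _
  congr 1
  -- The two operations commute on `w` because `gauge` is linear, and `w` determines the remaining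
  -- components.
  refine Z_eq_of_w (P := (P.gaugeChange c').timesTime t) (Q := (P.timesTime t).gaugeChange c')
    ht' ht' rfl rfl fun j _ => ?_
  congr 1
  funext s
  exact (map_smul _ _ _).symm

theorem inFrame_vertEndo (lam : OneForm 𝔄 k) {p : B × (Fin k → F)} (hp : p.1 ∈ 𝔄.dom c x₀ univ) :
    (vertEndo lam).inFrame c (𝔄.jetOf c x₀ p) =
      (lam.inFrame c (𝔄.jetOf c x₀ p)).comp (𝔄.vertMap c x₀ p) := by
  refine ContinuousLinearMap.ext fun z => ?_
  obtain ⟨P, h0, rfl, rfl⟩ := CurvePair.exists_through k hp z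
  refine (P.pairing_vertEndo lam h0).trans ?_
  rw [CurvePair.pairing, P.Z_timesTime_self h0]
  rfl

theorem SmForm.vertEndo {lam : OneForm 𝔄 k} (hl : SmForm lam) :
    SmForm (LieAlgebroid.vertEndo lam) := fun c x₀ =>
  ((hl c x₀).clm_comp contDiffOn_vertMap).congr fun _ hp => inFrame_vertEndo lam hp.1

theorem SmForm.vertEndo_iterate {lam : OneForm 𝔄 k} (hl : SmForm lam) (j : ℕ) :
    SmForm (LieAlgebroid.vertEndo^[j] lam) := by
  induction j with
  | zero => exact hl
  | succ j ih =>
    rw [Function.iterate_succ_apply']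
    exact ih.vertEndo

end VerticalEndomorphism

/-! ### The variational operator -/

section VariationalOperator

variable {𝔄} [FiniteDimensional ℝ F] [FiniteDimensional ℝ B] [T2Space M] {c c' x₀ : M}
  {k l : ℕ} {t : ℝ}

theorem inFrame_vertEndo_iterate (lam : OneForm 𝔄 k) (j : ℕ) {p : B × (Fin k → F)}
    (hp : p.1 ∈ 𝔄.dom c x₀ univ) (z : ETangent F k) :
    (vertEndo^[j] lam).inFrame c (𝔄.jetOf c x₀ p) z =
      lam.inFrame c (𝔄.jetOf c x₀ p) ((𝔄.vertMap c x₀ p)^[j] z) := by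
  induction j generalizing z with
  | zero => rfl
  | succ j ih =>
    rw [Function.iterate_succ_apply', inFrame_vertEndo _ hp, ContinuousLinearMap.comp_apply, ih,
      Function.iterate_succ_apply]

theorem CurvePair.pairing_vertEndo_iterate_succ (P : CurvePair 𝔄 c x₀) (lam : OneForm 𝔄 k)
    (ht : t ∈ P.I) : P.pairing (vertEndo^[k + 1] lam) t = 0 := by
  rw [pairing, inFrame_vertEndo_iterate lam _ (P.mem t ht), vertMap_iterate_eq_zero, map_zero]

theorem CurvePair.pairing_timesTime (P : CurvePair 𝔄 c x₀) (lam : OneForm 𝔄 k) (t₀ : ℝ)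
    (ht : t ∈ P.I) : (P.timesTime t₀).pairing lam t =
      P.pairing (vertEndo lam) t + (t - t₀) • P.pairing lam t := by
  rw [P.pairing_vertEndo lam ht]
  change lam.inFrame c (𝔄.jetOf c x₀ (P.ξ k t)) ((P.timesTime t₀).Z k t) =
    lam.inFrame c (𝔄.jetOf c x₀ (P.ξ k t)) ((P.timesTime t).Z k t) + _
  rw [P.Z_timesTime t₀ ht, P.Z_timesTime_self ht, map_add, map_smul]
  rfl

theorem CurvePair.pairing_variationalOp (P : CurvePair 𝔄 c x₀) {lam : OneForm 𝔄 k}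
    (hl : SmForm lam) (ht : t ∈ P.I) : P.pairing (variationalOp lam) t =
      ∑ j ∈ Finset.range (k + 1), ((-1 : ℝ) ^ j / (j.factorial : ℝ)) *
        iteratedDeriv j (P.pairing (vertEndo^[j] lam)) t := by
  have h1 : P.pairing (variationalOp lam) t = ∑ j : Fin (k + 1), ((-1 : ℝ) ^ (j : ℕ) /
      (Nat.factorial (j : ℕ) : ℝ)) * P.pairing ((OneForm.totalDerivIter (vertEndo^[(j : ℕ)] lam)
        j).pull (show k + (j : ℕ) ≤ 2 * k by omega)) t := by
    rw [pairing]
    refine (DFunLike.congr_fun (inFrame_sum Finset.univ (fun j : Fin (k + 1) => (fun A =>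
      ((-1 : ℝ) ^ (j : ℕ) / (Nat.factorial (j : ℕ) : ℝ)) •
        (OneForm.totalDerivIter (vertEndo^[(j : ℕ)] lam) j).pull
        (show k + (j : ℕ) ≤ 2 * k by omega) A : OneForm 𝔄 (2 * k))) _) _).trans ?_
    rw [sum_apply]
    rfl
  rw [h1, Finset.sum_range]
  refine Finset.sum_congr rfl fun j _ => ?_
  rw [P.pairing_pull _ _ ht, P.pairing_totalDerivIter (hl.vertEndo_iterate j) j ht]

theorem CurvePair.pairing_cartanOp (P : CurvePair 𝔄 c x₀) {lam : OneForm 𝔄 k}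
    (hl : SmForm lam) (ht : t ∈ P.I) : P.pairing (cartanOp lam) t =
      ∑ i ∈ Finset.range k, ((-1 : ℝ) ^ i / ((i + 1).factorial : ℝ)) *
        iteratedDeriv i (P.pairing (vertEndo^[i + 1] lam)) t := by
  have h1 : P.pairing (cartanOp lam) t = ∑ i : Fin k, ((-1 : ℝ) ^ (i : ℕ) /
      (Nat.factorial ((i : ℕ) + 1) : ℝ)) *
        P.pairing ((OneForm.totalDerivIter (vertEndo^[(i : ℕ) + 1] lam)
        i).pull (show k + (i : ℕ) ≤ 2 * k - 1 by omega)) t := by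
    rw [pairing]
    refine (DFunLike.congr_fun (inFrame_sum Finset.univ (fun i : Fin k => (fun A =>
      ((-1 : ℝ) ^ (i : ℕ) / (Nat.factorial ((i : ℕ) + 1) : ℝ)) •
        (OneForm.totalDerivIter (vertEndo^[(i : ℕ) + 1] lam) i).pull
        (show k + (i : ℕ) ≤ 2 * k - 1 by omega) A : OneForm 𝔄 (2 * k - 1))) _) _).trans ?_
    rw [sum_apply]
    rfl
  rw [h1, Finset.sum_range]
  refine Finset.sum_congr rfl fun i _ => ?_
  rw [P.pairing_pull _ _ ht, P.pairing_totalDerivIter (hl.vertEndo_iterate _) i ht]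

theorem smForm_cartanOp {lam : OneForm 𝔄 k} (hl : SmForm lam) : SmForm (cartanOp lam) :=
  SmForm.sum _ fun i _ => (((hl.vertEndo_iterate (i + 1)).totalDerivIter i).pull
    (show k + (i : ℕ) ≤ 2 * k - 1 by omega)).smul _

/-- Pairings of the variational operator with a variation multiplied by the time vanish. -/
theorem CurvePair.pairing_variationalOp_timesTime (P : CurvePair 𝔄 c x₀) {lam : OneForm 𝔄 k}
    (hl : SmForm lam) (ht : t ∈ P.I) : (P.timesTime t).pairing (variationalOp lam) t = 0 := by
  set g : ℕ → ℝ → ℝ := fun j => P.pairing (vertEndo^[j] lam) with hg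
  have hgs : ∀ j, ContDiffOn ℝ ∞ (g j) P.I := fun j =>
    P.contDiffOn_pairing (hl.vertEndo_iterate j)
  have hI := P.isOpen.mem_nhds ht
  -- For the variation `(s - t) w` the form `S^j λ` pairs to `g (j + 1) + (s - t) g j`. The weight
  -- `(-1)^j / j!` turns its `j`-th derivative at `t` into `a j - a (j - 1)`, so the sum telescopes
  -- to `a k`.
  set a : ℕ → ℝ := fun j => (-1 : ℝ) ^ j / (j.factorial : ℝ) * iteratedDeriv j (g (j + 1)) t with ha
  have h1 : ∀ j, (-1 : ℝ) ^ j / (j.factorial : ℝ) *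
      iteratedDeriv j ((P.timesTime t).pairing (vertEndo^[j] lam)) t =
        a j - if j = 0 then 0 else a (j - 1) := fun j => by
    have he : (P.timesTime t).pairing (vertEndo^[j] lam) =ᶠ[𝓝 t]
        fun s => g (j + 1) s + (s - t) • g j s := by
      filter_upwards [hI] with s hs
      rw [P.pairing_timesTime _ t hs, hg]
      simp only [Function.iterate_succ_apply']
    have hs : ContDiffOn ℝ ∞ (fun s => (s - t) • g j s) P.I :=
      (contDiff_id.sub contDiff_const).contDiffOn.smul (hgs j)
    rw [he.iteratedDeriv_eq, iteratedDeriv_fun_add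
      (((hgs (j + 1)).contDiffAt hI).of_le (by exact_mod_cast le_top))
      ((hs.contDiffAt hI).of_le (by exact_mod_cast le_top)),
      iteratedDeriv_sub_smul P.isOpen (hgs j) t j ht, sub_self, zero_smul, zero_add, mul_add]
    cases j with
    | zero => simp [ha]
    | succ j =>
      simp only [ha, Nat.add_sub_cancel, Nat.succ_ne_zero, if_false, Nat.factorial_succ, smul_eq_mul]
      have h2 : ((j : ℝ) + 1) ≠ 0 := by positivity
      have h3 : (j.factorial : ℝ) ≠ 0 := by positivity
      push_cast
      field_simp
      ring
  have h2 : ∀ n, ∑ j ∈ Finset.range (n + 1), (a j - if j = 0 then 0 else a (j - 1)) = a n := by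
    intro n
    induction n with
    | zero => simp
    | succ n ih =>
      rw [Finset.sum_range_succ, ih]
      simp
  rw [(P.timesTime t).pairing_variationalOp hl ht, Finset.sum_congr rfl fun j _ => h1 j, h2, ha]
  -- The surviving term contains `S^(k+1) λ`, which is zero by nilpotency.
  have h3 : g (k + 1) =ᶠ[𝓝 t] fun _ => 0 := by
    filter_upwards [hI] with s hs using P.pairing_vertEndo_iterate_succ lam hs
  simp only
  rw [h3.iteratedDeriv_eq]
  simp

/-- The form `𝔼(λ)` is semibasic. -/
theorem variationalOp_eq_zero {lam : OneForm 𝔄 k} (hl : SmForm lam) (A : 𝔄.Jet (2 * k))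
    {z : ETangent F (2 * k)} (hz : z 0 = 0) : variationalOp lam A z = 0 := by
  obtain ⟨P, h0, hA, rfl, -⟩ := exists_curvePair A z
  have hI := P.isOpen.mem_nhds h0
  -- Since `P.w` vanishes at `0`, it agrees to order `2 * k` with `s` times a curve whose `i`-th
  -- derivative is the derivative of `P.w` of order `i + 1` divided by `i + 1`. Only this jet
  -- matters.
  obtain ⟨w, hw, hwv⟩ := exists_iteratedDeriv_eq (2 * k)
    fun i => ((i : ℝ) + 1)⁻¹ • iteratedDeriv (i + 1) P.w 0
  set R := P.withW w hw.contDiffOn with hR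
  have hZ : (R.timesTime 0).Z (2 * k) 0 = P.Z (2 * k) 0 := by
    refine CurvePair.Z_eq_of_w (P := R.timesTime 0) h0 h0 rfl rfl fun j hj => ?_
    refine (iteratedDeriv_sub_smul P.isOpen hw.contDiffOn 0 j h0).trans ?_
    rw [sub_self, zero_smul, zero_add]
    cases j with
    | zero =>
      rw [Nat.cast_zero, zero_smul, iteratedDeriv_zero]
      exact hz.symm
    | succ j =>
      rw [Nat.add_sub_cancel, hwv j (by omega), smul_smul, Nat.cast_succ,
        mul_inv_cancel₀ (by positivity), one_smul]
  have h1 := R.pairing_variationalOp_timesTime hl h0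
  rw [CurvePair.pairing, hZ] at h1
  rw [show 𝔄.jetOf (base A) (base A) ((R.timesTime 0).ξ (2 * k) 0) = A from hA,
    inFrame_self] at h1
  exact h1

end VariationalOperator

/-! ### Complete lifts and Noether's theorem -/

section Noether

variable {𝔄} [FiniteDimensional ℝ F] [FiniteDimensional ℝ B] [T2Space M] {c c' x₀ : M}
  {k l : ℕ} {t : ℝ} {O : Set M} {V : Type*} [NormedAddCommGroup V] [NormedSpace ℝ V]
  (η : Cₛ^∞⟮𝓘(ℝ, B); F, E⟯)

theorem CurvePair.totalDerivIter_jetOf (P : CurvePair 𝔄 c x₀) {Φ : 𝔄.Jet k → V} (hO : IsOpen O)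
    (hΦ : SmOn O Φ) (hP : ∀ s ∈ P.I, P.x s ∈ 𝔄.dom c x₀ O) (r : ℕ) (ht : t ∈ P.I) :
    totalDerivIter Φ r (𝔄.jetOf c x₀ (P.ξ (k + r) t)) =
      iteratedDeriv r (fun s => Φ (𝔄.jetOf c x₀ (P.ξ k s))) t := by
  induction r generalizing t with
  | zero => rfl
  | succ r ih =>
    rw [iteratedDeriv_succ]
    have he : iteratedDeriv r (fun s => Φ (𝔄.jetOf c x₀ (P.ξ k s))) =ᶠ[𝓝 t]
        fun s => totalDerivIter Φ r (𝔄.jetOf c x₀ (P.ξ (k + r) s)) := by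
      filter_upwards [P.isOpen.mem_nhds ht] with s hs using (ih hs).symm
    rw [he.deriv_eq]
    exact (P.hasDerivAt_totalDeriv hO (hΦ.totalDerivIter hO r) ht (hP t ht)).deriv.symm

theorem sectionCoord_jetOf {p : B × (Fin 0 → F)} (hp : p.1 ∈ 𝔄.dom c x₀ univ) (c' : M) :
    sectionCoord 𝔄 c' η (𝔄.jetOf c x₀ p) = 𝔄.locSec c' x₀ η p.1 := by
  rw [sectionCoord, base_jetOf hp]
  rfl

theorem dom_subset_dom : 𝔄.dom c x₀ (trivializationAt F E c').baseSet ⊆ 𝔄.dom c' x₀ univ :=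
  fun _ hu => ⟨hu.1, hu.2.2, trivial⟩

theorem smOn_sectionCoord (c : M) :
    SmOn (trivializationAt F E c).baseSet (sectionCoord 𝔄 c η) := fun _ _ =>
  ((contDiffOn_locSec η).comp contDiff_fst.contDiffOn fun _ hp => dom_subset_dom hp.1).congr
    fun _ hp => sectionCoord_jetOf η (dom_subset_univ hp.1) c

theorem smOn_liftCoord (c : M) : SmOn (trivializationAt F E c).baseSet (liftCoord 𝔄 c η) := by
  have ho := (trivializationAt F E c).open_baseSet
  have h1 := (smOn_sectionCoord (𝔄 := 𝔄) η c).totalDeriv ho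
  have h2 := (smOn_sectionCoord (𝔄 := 𝔄) η c).comp_proj (Nat.zero_le 1)
  have h3 := smOn_coord (𝔄 := 𝔄) (k := 1) c
  intro c' x₀
  have h4 : ContDiffOn ℝ ∞ (fun p : B × (Fin 1 → F) => 𝔄.locStr c x₀ p.1)
      (𝔄.dom c' x₀ (trivializationAt F E c).baseSet ×ˢ univ) :=
    contDiffOn_locStr.comp contDiff_fst.contDiffOn fun _ hp => dom_subset_dom hp.1
  refine ((h1 c' x₀).add ((h4.clm_apply (contDiffOn_pi.1 (h3 c' x₀) 0)).clm_apply
    (h2 c' x₀))).congr fun p hp => ?_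
  rw [liftCoord, base_jetOf (dom_subset_univ hp.1)]
  rfl

/-- The components of the complete lift in the trivialization `e_c`. -/
def liftComp (c : M) (η : Cₛ^∞⟮𝓘(ℝ, B); F, E⟯) (A : 𝔄.Jet k) : ETangent F k :=
  Fin.cons (sectionCoord 𝔄 c η (proj (Nat.zero_le k) A))
    (fun r : Fin k => totalDerivIter (liftCoord 𝔄 c η) r (proj (show 1 + (r : ℕ) ≤ k by omega) A))

theorem contDiffOn_liftComp : ContDiffOn ℝ ∞ (fun p => liftComp c η (𝔄.jetOf (k := k) c x₀ p))
    (𝔄.dom c x₀ univ ×ˢ univ) := by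
  have ho := (trivializationAt F E c).open_baseSet
  have hsub : 𝔄.dom c x₀ univ ×ˢ (univ : Set (Fin k → F)) ⊆
      𝔄.dom c x₀ (trivializationAt F E c).baseSet ×ˢ univ :=
    fun p hp => ⟨⟨hp.1.1, hp.1.2.1, hp.1.2.1⟩, trivial⟩
  refine contDiffOn_pi.2 fun r => Fin.cases ?_ (fun r => ?_) r
  · exact ((smOn_sectionCoord η c).comp_proj (Nat.zero_le k) c x₀).mono hsub
  · exact (((smOn_liftCoord η c).totalDerivIter ho r).comp_proj
      (show 1 + (r : ℕ) ≤ k by omega) c x₀).mono hsub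

namespace CurvePair

variable (P : CurvePair 𝔄 c x₀)

/-- The variation of a curve induced by a section of `E`. -/
def lift : CurvePair 𝔄 c x₀ :=
  P.withW (fun s => 𝔄.locSec c x₀ η (P.x s)) ((contDiffOn_locSec η).comp P.x_smooth P.mem)

/-- With `w = η(x)` the induced `ζ` is `d/dt η + C(y, η)`, which is `liftCoord` along the curve;
iterated total derivatives become time derivatives. -/
theorem Z_lift (ht : t ∈ P.I) : (P.lift η).Z k t = liftComp c η (𝔄.jetOf c x₀ (P.ξ k t)) := by
  have ho := (trivializationAt F E c).open_baseSet
  have hP : ∀ s ∈ P.I, P.x s ∈ 𝔄.dom c x₀ (trivializationAt F E c).baseSet :=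
    fun s hs => ⟨(P.mem s hs).1, (P.mem s hs).2.1, (P.mem s hs).2.1⟩
  funext r
  refine Fin.cases ?_ (fun r => ?_) r
  · change 𝔄.locSec c x₀ η (P.x t) = sectionCoord 𝔄 c η (proj (Nat.zero_le k) _)
    rw [proj_jetOf _ (P.mem t ht), sectionCoord_jetOf η (P.mem t ht)]
    rfl
  · change iteratedDeriv r (P.lift η).ζ t =
      totalDerivIter (liftCoord 𝔄 c η) r (proj (show 1 + (r : ℕ) ≤ k by omega) _)
    rw [proj_jetOf _ (P.mem t ht)]
    refine Eq.trans ?_ (P.totalDerivIter_jetOf ho (smOn_liftCoord η c) hP r ht).symm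
    refine Filter.EventuallyEq.iteratedDeriv_eq _ ?_
    filter_upwards [P.isOpen.mem_nhds ht] with s hs
    have h1 := P.hasDerivAt_totalDeriv ho (smOn_sectionCoord (𝔄 := 𝔄) η c) hs (hP s hs)
    have h2 : (fun s => sectionCoord 𝔄 c η (𝔄.jetOf c x₀ (P.ξ 0 s))) =ᶠ[𝓝 s]
        fun s => 𝔄.locSec c x₀ η (P.x s) := by
      filter_upwards [P.isOpen.mem_nhds hs] with s' hs' using sectionCoord_jetOf η (P.mem s' hs') c
    have h3 := (h1.congr_of_eventuallyEq h2.symm).deriv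
    rw [liftCoord, proj_jetOf _ (P.mem s hs)]
    change deriv (fun s => 𝔄.locSec c x₀ η (P.x s)) s +
      𝔄.locStr c x₀ (P.x s) (P.y s) (𝔄.locSec c x₀ η (P.x s)) = _
    rw [h3, LieAlgebroid.base_jetOf (P.mem s hs), LieAlgebroid.coord_jetOf (P.mem s hs),
      sectionCoord_jetOf η (P.mem s hs)]
    rw [show (P.ξ 1 s).2 0 = P.y s by simp [ξ]]
    rfl

/-- The complete lift is given in the preferred trivialization. One may pass to it because lifting
commutes with `gaugeChange`: the components of `η` transform by `gauge`, and `w` determines `Z`. -/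
theorem pairing_lift (lam : OneForm 𝔄 k) (ht : t ∈ P.I) : (P.lift η).pairing lam t =
    lam (𝔄.jetOf c x₀ (P.ξ k t)) (completeLift η (𝔄.jetOf c x₀ (P.ξ k t))) := by
  obtain ⟨c', hc'⟩ : ∃ c', base (𝔄.jetOf c x₀ (P.ξ k t)) = c' := ⟨_, rfl⟩
  have ht' : t ∈ (P.gaugeChange c').I := P.mem_gaugeChange ht ⟨(P.mem t ht).1, (P.mem t ht).2.1, by
    rw [← hc', ← P.base_jetOf ht k]
    exact mem_baseSet_trivializationAt F E _⟩
  have hb : base (𝔄.jetOf c' x₀ ((P.gaugeChange c').ξ k t)) = c' := by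
    rw [P.jetOf_gaugeChange ht', hc']
  have h1 : ((P.lift η).gaugeChange c').Z k t = ((P.gaugeChange c').lift η).Z k t := by
    refine Z_eq_of_w (P := (P.lift η).gaugeChange c') (Q := (P.gaugeChange c').lift η)
      ht' ht' rfl rfl fun j _ => Filter.EventuallyEq.iteratedDeriv_eq j ?_
    filter_upwards [(P.gaugeChange c').isOpen.mem_nhds ht'] with s hs
    exact gauge_locSec hs.2 η
  rw [← (P.lift η).pairing_gaugeChange (c' := c') _ ht', pairing, h1,
    (P.gaugeChange c').Z_lift η ht', ← P.jetOf_gaugeChange ht']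
  change lam.inFrame c' (𝔄.jetOf c' x₀ ((P.gaugeChange c').ξ k t)) _ = _
  rw [inFrame_of_base _ hb]
  have h2 : ∀ A : 𝔄.Jet k, base A = c' → completeLift η A = liftComp c' η A := by
    rintro A rfl
    rfl
  rw [h2 _ hb]

end CurvePair

/-- The preferred trivialization varies with the base point, so smoothness is read off in a fixed
one, where the lift has components `liftComp`. -/
theorem smOn_pairing_completeLift {lam : OneForm 𝔄 k} (hl : SmForm lam) :
    SmOn univ fun A => lam A (completeLift η A) := fun c x₀ => by
  refine ((hl c x₀).clm_apply (contDiffOn_liftComp η)).congr fun p hp => ?_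
  obtain ⟨P, h0, rfl, -⟩ := CurvePair.exists_through k hp.1 0
  refine (P.pairing_lift η lam h0).symm.trans ?_
  rw [CurvePair.pairing, P.Z_lift η h0]
  rfl

variable {L : 𝔄.Jet k → ℝ} {Φ : 𝔄.Jet (k - 1) → ℝ}

/-- The total time derivative of the Noether function. -/
theorem totD_noether (hk : 1 ≤ k) (h₁ : k - 1 + 1 ≤ k) (h₂ : k - 1 ≤ 2 * k - 1)
    (hL : SmOn univ L) (hΦ : SmOn univ Φ)
    (hsymm : ∀ A : 𝔄.Jet k, dFun L A (completeLift η A) =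
      totalDeriv Φ (proj h₁ A))
    {p : B × (Fin (2 * k) → F)} (hp : p.1 ∈ 𝔄.dom c x₀ univ)
    (hδ : deltaL L (𝔄.jetOf c x₀ p) = 0) :
    𝔄.totD c x₀ (fun q => Φ (proj h₂ (𝔄.jetOf c x₀ q)) -
        cartanForm L (𝔄.jetOf c x₀ q) (completeLift η (𝔄.jetOf c x₀ q)))
      (trunc B F (show 2 * k - 1 + 1 ≤ 2 * k by omega) p) = 0 := by
  have hdL : SmForm (dFun L : OneForm 𝔄 k) := SmForm.dFun hL
  have hθ : SmForm (cartanForm L) := smForm_cartanOp hdL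
  -- Any smooth admissible curve through the given jet may be used, as the claim concerns a single
  -- point. Only its curve matters: the variation will be the one induced by `η`.
  obtain ⟨P, h0, rfl, -⟩ := CurvePair.exists_through (2 * k) hp 0
  have hI := P.isOpen.mem_nhds h0
  set g : ℕ → ℝ → ℝ := fun j => (P.lift η).pairing (vertEndo^[j] (dFun L : OneForm 𝔄 k)) with hg
  have hgs : ∀ j, ContDiffOn ℝ ∞ (g j) P.I := fun j =>
    (P.lift η).contDiffOn_pairing (hdL.vertEndo_iterate j)
  have h1 : HasDerivAt (fun s => Φ (𝔄.jetOf c x₀ (P.ξ (k - 1) s))) (g 0 0) 0 := by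
    refine (P.hasDerivAt_totalDeriv isOpen_univ hΦ h0 (P.mem 0 h0)).congr_deriv ?_
    have h2 : proj h₁ (𝔄.jetOf c x₀ (P.ξ k 0)) =
      𝔄.jetOf c x₀ (P.ξ (k - 1 + 1) 0) := proj_jetOf _ (P.mem 0 h0)
    rw [← h2, ← hsymm]
    exact (P.pairing_lift η (dFun L) h0).symm
  have h3 : HasDerivAt (fun s => cartanForm L (𝔄.jetOf c x₀ (P.ξ (2 * k - 1) s))
      (completeLift η (𝔄.jetOf c x₀ (P.ξ (2 * k - 1) s))))
      (∑ i ∈ Finset.range k, ((-1 : ℝ) ^ i / ((i + 1).factorial : ℝ)) *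
        iteratedDeriv (i + 1) (g (i + 1)) 0) 0 := by
    have h4 : HasDerivAt (fun s => ∑ i ∈ Finset.range k, ((-1 : ℝ) ^ i / ((i + 1).factorial : ℝ)) *
        iteratedDeriv i (g (i + 1)) s) (∑ i ∈ Finset.range k,
        ((-1 : ℝ) ^ i / ((i + 1).factorial : ℝ)) * iteratedDeriv (i + 1) (g (i + 1)) 0) 0 :=
      HasDerivAt.fun_sum fun i _ =>
        (hasDerivAt_iteratedDeriv P.isOpen (hgs (i + 1)) i h0).const_mul _
    refine h4.congr_of_eventuallyEq ?_
    filter_upwards [hI] with s hs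
    rw [← P.pairing_lift η (cartanForm L) hs]
    exact (P.lift η).pairing_cartanOp hdL hs
  have h5 : variationalOp (dFun L) (𝔄.jetOf c x₀ (P.ξ (2 * k) 0))
      (completeLift η (𝔄.jetOf c x₀ (P.ξ (2 * k) 0))) = 0 := by
    set A := 𝔄.jetOf c x₀ (P.ξ (2 * k) 0)
    set z := completeLift η A with hz
    -- The first summand is paired to `⟨δL, η⟩ = 0`; the second is vertical and is killed by
    -- semibasicity.
    have h6 : z = Pi.single 0 (z 0) + (z - Pi.single 0 (z 0)) := by abel
    have h7 : variationalOp (dFun L) A (Pi.single 0 (z 0)) = deltaL L A (z 0) := rfl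
    rw [h6, map_add, h7, hδ, variationalOp_eq_zero hdL A (by simp)]
    simp
  rw [← P.pairing_lift η _ h0, (P.lift η).pairing_variationalOp hdL h0,
    Finset.sum_range_succ'] at h5
  have h8 : DifferentiableAt ℝ (fun q => Φ (proj h₂
      (𝔄.jetOf c x₀ q)) - cartanForm L (𝔄.jetOf c x₀ q) (completeLift η (𝔄.jetOf c x₀ q)))
      (P.ξ (2 * k - 1) 0) :=
    ((hΦ.comp_proj h₂).differentiableAt isOpen_univ
      (P.mem 0 h0)).sub ((smOn_pairing_completeLift η hθ).differentiableAt isOpen_univ (P.mem 0 h0))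
  have h9 := P.hasDerivAt_comp_ξ h0 h8
  have h10 := (h1.sub h3).congr_of_eventuallyEq (f₁ := fun s =>
    Φ (proj h₂ (𝔄.jetOf c x₀ (P.ξ (2 * k - 1) s))) -
      cartanForm L (𝔄.jetOf c x₀ (P.ξ (2 * k - 1) s))
        (completeLift η (𝔄.jetOf c x₀ (P.ξ (2 * k - 1) s)))) (by
    filter_upwards [hI] with s hs
    rw [proj_jetOf _ (P.mem s hs)]
    rfl)
  -- The term `g 0` from `Φ` is the `j = 0` term of `𝔼(dL)`; the minus sign before the Cartan form
  -- supplies the sign `(-1)^j` in the terms with `j = i + 1`.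
  refine (h9.unique h10).trans (Eq.trans ?_ h5)
  simp only [pow_zero, Nat.factorial_zero, Nat.cast_one, div_one, one_mul, iteratedDeriv_zero]
  rw [sub_eq_add_neg, add_comm, ← Finset.sum_neg_distrib]
  refine congrArg₂ _ (Finset.sum_congr rfl fun i _ => ?_) rfl
  rw [pow_succ, hg]
  ring

end Noether

/-! ### Conservation along solutions -/

section Conservation

variable {𝔄} [FiniteDimensional ℝ F] [FiniteDimensional ℝ B] [T2Space M] {c x₀ : M} {k : ℕ} {a : ℝ → TotalSpace F E} {t : ℝ}

theorem AdmissibleAt.eventually {n : ℕ} (ha : 𝔄.AdmissibleAt n a t) :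
    ∀ᶠ s in 𝓝 t, 𝔄.AdmissibleAt n a s := by
  have : IsManifold (𝓘(ℝ, B).prod 𝓘(ℝ, F)) ∞ (TotalSpace F E) :=
    Bundle.TotalSpace.isManifold F E
  have : IsManifold (𝓘(ℝ, B).prod 𝓘(ℝ, F)) n (TotalSpace F E) :=
    IsManifold.of_le (n := ∞) (by exact_mod_cast le_top)
  filter_upwards [(contMDiffAt_iff_contMDiffAt_nhds (by simp)).1 ha.1, ha.2.eventually_nhds] with s h1 h2 using ⟨h1, h2⟩

/-- The derivative of a function of the jet of an admissible curve. -/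
theorem AdmissibleAt.hasDerivAt_jet (ha : 𝔄.AdmissibleAt k a t)
    (hx : (a t).proj ∈ (extChartAt 𝓘(ℝ, B) x₀).source)
    (hc : (a t).proj ∈ (trivializationAt F E c).baseSet) {G : 𝔄.Jet k → ℝ} (hG : SmOn univ G)
    {h : ℝ → ℝ} (hh : ∀ s (hs : 𝔄.AdmissibleAt (k - 1) a s), h s = G (𝔄.jet k a s hs)) :
    HasDerivAt h (𝔄.totD c x₀ (fun q => G (𝔄.jetOf c x₀ q))
      (basePart B x₀ a t, fun j : Fin (k + 1) => iteratedDeriv j (fibrePart c a) t)) t := by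
  set ξ : ℝ → B × (Fin k → F) :=
    fun s => (basePart B x₀ a s, fun j => iteratedDeriv j (fibrePart c a) s)
  have h1 : h =ᶠ[𝓝 t] fun s => G (𝔄.jetOf c x₀ (ξ s)) := by
    filter_upwards [ha.eventually, ha.eventually_mem ((isOpen_extChartAt_source x₀).mem_nhds hx),
      ha.eventually_mem ((trivializationAt F E c).open_baseSet.mem_nhds hc)] with s h1 h2 h3
    rw [hh s (h1.of_le (Nat.sub_le k 1)), jet_eq_jetOf _ h2 h3]
  have h2 : HasDerivAt ξ (𝔄.vvec c x₀ (basePart B x₀ a t)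
      fun j : Fin (k + 1) => iteratedDeriv j (fibrePart c a) t) t := by
    refine HasDerivAt.prodMk (ha.eventually_hasDerivAt hx hc).self_of_nhds
      (hasDerivAt_pi.2 fun j => ?_)
    -- The coordinates of the jet in `E^k` are derivatives of order below `k`, so class `C^k` is
    -- just enough to differentiate them.
    exact hasDerivAt_iteratedDeriv_of_contDiffAt (ha.contDiffAt_fibrePart hc) j.2
  have h3 := (hG.differentiableAt isOpen_univ (c := c) (x₀ := x₀) (p := ξ t)
    (mem_dom_of_mem hx hc (mem_univ _))).hasFDerivAt
  exact (h3.comp_hasDerivAt t h2).congr_of_eventuallyEq h1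

/-- By the chain rule the derivative of `G` along the solution is its total derivative at the jet in
`E^(2k)`, a point where `δL = 0`. A zero derivative on an interval gives constancy. -/
theorem IsSolution.const_of_totD {L : 𝔄.Jet k → ℝ} {J : Set ℝ} (ha : IsSolution L J a)
    {G : 𝔄.Jet (2 * k - 1) → ℝ} (hk : 1 ≤ k) (hG : SmOn univ G)
    (hD : ∀ (c : M) {p : B × (Fin (2 * k) → F)}, p.1 ∈ 𝔄.dom c c univ →
      deltaL L (𝔄.jetOf c c p) = 0 → 𝔄.totD c c (fun q => G (𝔄.jetOf c c q))
        (trunc B F (show 2 * k - 1 + 1 ≤ 2 * k by omega) p) = 0)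
    {t₁ t₂ : ℝ} (ht₁ : t₁ ∈ J) (ht₂ : t₂ ∈ J) :
    G (𝔄.jet (2 * k - 1) a t₁ ((ha.admissible t₁ ht₁).of_le (Nat.sub_le _ 1))) =
      G (𝔄.jet (2 * k - 1) a t₂ ((ha.admissible t₂ ht₂).of_le (Nat.sub_le _ 1))) := by
  classical
  -- A function on all of `ℝ`, with a default value where the jet is undefined. Each time in `J` has
  -- a neighbourhood of admissible times, so the derivative there is two-sided even at endpoints of
  -- `J`.
  set h : ℝ → ℝ := fun s =>
    if hs : 𝔄.AdmissibleAt (2 * k - 1 - 1) a s then G (𝔄.jet (2 * k - 1) a s hs) else 0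
  have hh : ∀ s (hs : 𝔄.AdmissibleAt (2 * k - 1 - 1) a s), h s = G (𝔄.jet (2 * k - 1) a s hs) :=
    fun s hs => dif_pos hs
  have h1 : ∀ t ∈ J, HasDerivAt h 0 t := fun t ht => by
    have hx := mem_extChartAt_source (I := 𝓘(ℝ, B)) (a t).proj
    have hc := mem_baseSet_trivializationAt F E (a t).proj
    have h2 := (ha.admissible t ht).hasDerivAt_jet hx hc hG hh
    have h3 := ha.eulerLagrange t ht
    rw [jet_eq_jetOf _ hx hc] at h3
    exact h2.congr_deriv (hD _ (mem_dom_of_mem hx hc (mem_univ _)) h3)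
  rw [← hh, ← hh]
  wlog h12 : t₁ ≤ t₂ generalizing t₁ t₂
  · exact (this ht₂ ht₁ (le_of_not_ge h12)).symm
  have hJ := ha.ordConnected.out ht₁ ht₂
  exact (constant_of_has_deriv_right_zero (fun t ht => (h1 t (hJ ht)).continuousAt.continuousWithinAt)
    (fun t ht => (h1 t (hJ (Ico_subset_Icc_self ht))).hasDerivWithinAt) t₂ ⟨h12, le_rfl⟩).symm

end Conservation

end LieAlgebroid

end

theorem mainTheorem5 {B F : Type*} [NormedAddCommGroup B] [NormedSpace ℝ B]
    [FiniteDimensional ℝ B] [NormedAddCommGroup F] [NormedSpace ℝ F] [FiniteDimensional ℝ F]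
    {M : Type*} [TopologicalSpace M] [ChartedSpace B M] [IsManifold 𝓘(ℝ, B) ∞ M]
    [T2Space M] [SigmaCompactSpace M]
    {E : M → Type*} [TopologicalSpace (TotalSpace F E)] [∀ x, TopologicalSpace (E x)]
    [∀ x, AddCommGroup (E x)] [∀ x, Module ℝ (E x)] [FiberBundle F E] [VectorBundle ℝ F E]
    [ContMDiffVectorBundle ∞ F E 𝓘(ℝ, B)]
    (𝔄 : LieAlgebroid B F E) (k : ℕ) (hk : 1 ≤ k)
    (L : 𝔄.Jet k → ℝ) (hL : LieAlgebroid.IsSmooth L)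
    (η : Cₛ^∞⟮𝓘(ℝ, B); F, E⟯)
    (Φ : 𝔄.Jet (k - 1) → ℝ) (hΦ : LieAlgebroid.IsSmooth Φ)
    (hsymm : ∀ A : 𝔄.Jet k,
      LieAlgebroid.dFun L A (LieAlgebroid.completeLift η A) =
        LieAlgebroid.totalDeriv Φ (LieAlgebroid.proj (show k - 1 + 1 ≤ k by omega) A)) :
    LieAlgebroid.IsFirstIntegral L (fun A : 𝔄.Jet (2 * k - 1) =>
      Φ (LieAlgebroid.proj (show k - 1 ≤ 2 * k - 1 by omega) A)
        - LieAlgebroid.cartanForm L A (LieAlgebroid.completeLift η A)) := by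
  have hΦ' := (hΦ.smOn).comp_proj (show k - 1 ≤ 2 * k - 1 by omega)
  have hθ := LieAlgebroid.smOn_pairing_completeLift η
    (LieAlgebroid.smForm_cartanOp (LieAlgebroid.SmForm.dFun hL.smOn))
  have hG : LieAlgebroid.SmOn univ fun A : 𝔄.Jet (2 * k - 1) =>
      Φ (LieAlgebroid.proj (show k - 1 ≤ 2 * k - 1 by omega) A)
        - LieAlgebroid.cartanForm L A (LieAlgebroid.completeLift η A) :=
    fun c x₀ => (hΦ' c x₀).sub (hθ c x₀)
  exact ⟨hG.isSmooth, fun J a ha t₁ ht₁ t₂ ht₂ => ha.const_of_totD hk hG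
    (fun c _ hp hδ => LieAlgebroid.totD_noether η hk _ _ hL.smOn hΦ.smOn hsymm hp hδ) ht₁ ht₂⟩
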